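/- **Definitions.** An oriented virtual link diagram $D$ (with at least one component) is considered up to planar isotopy; its crossings are classical (positive or negative) or virtual, and *virtual links* are diagrams up to Reidemeister moves and detour moves (an arc containing only virtual crossings may be redrawn in any position, all its new crossings being virtual). A diagram $\mathrm{Zh}^{op}(D)=D\cup\omega^{op}$ is obtained as follows. At each classical crossing $c$ of $D$, let $X$ be the strand that crosses the other strand $Y$ from left to right. Draw two short arcs of $\omega^{op}$, each passing over $D$ once next to $c$: either one over $X$ after $c$ and one over $Y$ before $c$, with $c$ to the right of these arcs, or one over $X$ before $c$ and one over $Y$ after $c$, with $c$ to the left of these arcs. (Thus the new crossings are positive on $X$ and negative on $Y$.) Connect all these arcs, in any order, into one closed component $\omega^{op}$; all further crossings of $\omega^{op}$ with $D$ and with itself are virtual. More generally let $L=D\cup\omega$ be any diagram with a distinguished component $\omega$ over which $D$ never passes at a classical crossing. *Semi-welded moves* on such diagrams are the Reidemeister and detour moves, together with the $\omega$-over-crossings-commute ($\omega$OCC) move, which interchanges two consecutive over-crossings on $\omega$. A *state* $S$ of $L$ arises by choosing the $A$- or the $B$-smoothing at every classical crossing of $D$ with itself; crossings with $\omega$ are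 not smoothed. Let $\alpha(S)$, $\beta(S)$ be the numbers of $A$- and $B$-smoothings, and $|S|$ the number of state curves other than $\omega$. For a state curve $C\neq\omega$ with an orientation $\vec C$, let $v\ell k(\omega,\vec C)$ be the signed number of times that $\omega$ crosses over $\vec C$. Over the ring $\mathbb{Z}[A^{\pm1},Z_1,Z_2,\dots]$, with $Z_0=1$, put $$[S]=\prod_{C}Z_{\lfloor |v\ell k(\omega,\vec C)|/2\rfloor},\qquad \langle\langle L\rangle\rangle=\sum_S A^{\alpha(S)-\beta(S)}(-A^2-A^{-2})^{|S|-1}[S],\qquad V(L)=(-A)^{-3w(D)}\langle\langle L\rangle\rangle,$$ where $w(D)$ is the writhe of $D$. The Zh-bracket and the Zh-polynomial of $D$ are $\langle\langle D\rangle\rangle_{\mathrm{Zh}}=\langle\langle \mathrm{Zh}^{op}(D)\rangle\rangle$ and $V_{\mathrm{Zh}}(D)=V(\mathrm{Zh}^{op}(D))$. **Proposition.** The Zh-polynomial is a well-defined invariant of oriented virtual links. In detail: 1. Every diagram $D$ has a diagram $\mathrm{Zh}^{op}(D)$, the state curves of every $L$ can be oriented, and $v\ell k(\omega^{op},\vec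 C)$ is even for every state curve $C$ of every $\mathrm{Zh}^{op}(D)$. 2. $|v\ell k(\omega,\vec C)|$, $\langle\langle L\rangle\rangle$ and $V(L)$ do not depend on the orientations chosen on the state curves. 3. $\langle\langle L\rangle\rangle$ is invariant under the $\omega$OCC move, and $V(L)$ is invariant under all semi-welded moves between diagrams $L$ as above. 4. $V_{\mathrm{Zh}}(D)$ does not depend on the choices made in the construction of $\mathrm{Zh}^{op}(D)$ and is invariant under the Reidemeister moves and the detour moves of $D$; hence there is exactly one function $V$ on oriented virtual links with $V([D])=V_{\mathrm{Zh}}(D)$ for all $D$. -/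

import Mathlib

/-!
# Virtual link diagrams, the Zh-construction and the Zh-polynomial

An oriented virtual link diagram is recorded by its Gauss code with the virtual crossings kept:
every component is a cyclic word listing, in the direction of its orientation, the crossings met
along it. Planarity of the drawing is not imposed; it plays no role in any of the definitions, and
the moves below include all Reidemeister and detour moves between planar diagrams.
-/

namespace Virt

/-- One passage of a strand through a crossing: through the classical crossing `c` of sign `s` as
the over-strand or as the under-strand, or through the virtual crossing `c`. -/
inductive Letter where
  | over (c : ℕ) (s : ℤˣ)
  | under (c : ℕ) (s : ℤˣ)
  | virt (c : ℕ)
  deriving DecidableEq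

/-- The name of the crossing. -/
def Letter.label : Letter → ℕ
  | .over c _ => c
  | .under c _ => c
  | .virt c => c

/-- Renaming of the crossings. -/
def Letter.relabel (f : ℕ → ℕ) : Letter → Letter
  | .over c s => .over (f c) s
  | .under c s => .under (f c) s
  | .virt c => .virt (f c)

/-- A code: a list of components, each a word that is read cyclically. The empty word is a
component without crossings. -/
abbrev Code := List (List Letter)

/-- Every crossing is passed exactly twice: a classical one once over and once under, with the same
sign both times, a virtual one twice. -/
def Code.WF (G : Code) : Prop :=
  ∀ c : ℕ,
    (G.flatten.filter fun x => x.label = c) = [] ∨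
    (∃ s : ℤˣ, (G.flatten.filter fun x => x.label = c).Perm [.over c s, .under c s]) ∨
    (G.flatten.filter fun x => x.label = c) = [.virt c, .virt c]

/-- Delete all passages through the crossings whose names lie in `N`. -/
def eraseWord (N : Finset ℕ) (w : List Letter) : List Letter :=
  w.filter fun x => x.label ∉ N

/-! ### Moves -/

/-- A code with `k` holes (the letters `Sum.inr i`): the part of a diagram outside the strands to
which a local move is applied. -/
abbrev Template (k : ℕ) := List (List (Letter ⊕ Fin k))

/-- Every hole occurs exactly once. -/
def Template.Linear {k : ℕ} (T : Template k) : Prop :=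
  ∀ i : Fin k, T.flatten.count (Sum.inr i) = 1

/-- Put the word `f i` into the hole `i`. -/
def Template.fill {k : ℕ} (T : Template k) (f : Fin k → List Letter) : Code :=
  T.map fun w => w.flatMap (Sum.elim (fun x => [x]) f)

/-- Delete all passages through the crossings whose names lie in `N`; the holes stay. -/
def Template.erase {k : ℕ} (T : Template k) (N : Finset ℕ) : Template k :=
  T.map fun w => w.filter (Sum.elim (fun x => decide (x.label ∉ N)) fun _ => true)

/-- The letters `x`, `y` in this order if `p = 1` and in the opposite order if `p = -1`. -/
def ord (p : ℤˣ) (x y : Letter) : List Letter :=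
  if p = 1 then [x, y] else [y, x]

/-- The oriented Reidemeister moves, each from one side to the other.

* `r1`: a curl, with either strand first and of either sign, is removed.
* `r2`: two crossings of opposite signs, consecutive on the over-strand and consecutive on the
  under-strand, are removed. The two strands are parallel (`p = 1`) or antiparallel (`p = -1`).
* `r3`: the top strand meets the middle strand in `c` (sign `a`) and the bottom strand in `d`
  (sign `b`), the middle strand meets the bottom strand in `e` (sign `f`). The move reverses the
  order of the two crossings on each of the three strands. The equations between the
  orders `p`, `q`, `r` and the signs characterize the triangles that are formed by three
  oriented lines in the plane. -/
inductive Reidemeister : Code → Code → Prop where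
  | r1 (T : Template 1) (hT : T.Linear) (c : ℕ) (s p : ℤˣ) :
      Reidemeister (T.fill ![ord p (.over c s) (.under c s)]) (T.fill ![[]])
  | r2 (T : Template 2) (hT : T.Linear) (c d : ℕ) (s p : ℤˣ) :
      Reidemeister
        (T.fill ![[.over c s, .over d (-s)], ord p (.under c s) (.under d (-s))])
        (T.fill ![[], []])
  | r3 (T : Template 3) (hT : T.Linear) (c d e : ℕ) (a b f p q r : ℤˣ)
      (h₁ : p * f = q * b) (h₂ : q * b = r * a) :
      Reidemeister
        (T.fill ![ord p (.over c a) (.over d b), ord q (.under c a) (.over e f),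
          ord r (.under d b) (.under e f)])
        (T.fill ![ord (-p) (.over c a) (.over d b), ord (-q) (.under c a) (.over e f),
          ord (-r) (.under d b) (.under e f)])

/-- The detour move: an arc containing only virtual crossings (the passages `u`) is cut out,
together with all its crossings, and an arc with the same end points, again containing only virtual
crossings (the passages `v`), is put in. -/
inductive Detour : Code → Code → Prop where
  | mk (T T' : Template 1) (hT : T.Linear) (hT' : T'.Linear) (u v : List ℕ)
      (h : T.erase u.toFinset = T'.erase v.toFinset) :
      Detour (T.fill ![u.map .virt]) (T'.fill ![v.map .virt])

/-- Two words that agree up to the renaming `f` of crossings and the choice of the starting point. -/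
def SameWord (f : ℕ → ℕ) (w w' : List Letter) : Prop :=
  (w.map (Letter.relabel f)).IsRotated w'

/-- Two lists of components that agree up to the renaming `f` of crossings, the choice of the
starting points and the order of the components. -/
def SameCode (f : ℕ → ℕ) (G G' : Code) : Prop :=
  ∃ H : Code, List.Forall₂ (SameWord f) G H ∧ H.Perm G'

/-! ### Virtual links -/

/-- An oriented virtual link diagram with at least one component. -/
structure Diagram where
  code : Code
  wf : code.WF
  nonempty : code ≠ []

/-- One step of virtual Reidemeister equivalence. -/
def Diagram.Step (D D' : Diagram) : Prop :=
  Reidemeister D.code D'.code ∨ Detour D.code D'.code ∨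
    ∃ f : ℕ → ℕ, f.Injective ∧ SameCode f D.code D'.code

/-- Virtual Reidemeister equivalence. -/
def virtualEquivalence : Setoid Diagram := Relation.EqvGen.setoid Diagram.Step

/-- Oriented virtual links (of any number of components). -/
abbrev VirtualLink := Quotient virtualEquivalence

/-! ### Diagrams with an over-crossing component `ω` -/

/-- A diagram `D ∪ ω` with base `D` and a distinguished component `ω`, such that `D` nowhere passes
over `ω` at a classical crossing. -/
structure OmegaDiagram where
  omega : List Letter
  base : Code
  wf : Code.WF (omega :: base)
  nonempty : base ≠ []
  omega_over : ∀ c s, Letter.over c s ∈ base.flatten → Letter.under c s ∈ base.flatten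

namespace OmegaDiagram

/-- The code of `D ∪ ω`, with `ω` as the first component. -/
def code (L : OmegaDiagram) : Code := L.omega :: L.base

/-- The ω-over-crossings-commute move, in which `ω` passes over one strand at `c` and over another
strand at `d`. In `drawn`, the two lower strands meet in the virtual crossing `e`, and `ω` is moved
across it; the orders and signs are those of a triangle, the sign of a virtual
crossing being unrecorded. `gauss` is the move on Gauss diagrams, which ignore virtual crossings. -/
inductive OCC : OmegaDiagram → OmegaDiagram → Prop where
  | drawn (L L' : OmegaDiagram) (u v : List Letter) (T : Template 2) (hT : T.Linear) (c d e : ℕ)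
      (a b p q r : ℤˣ) (h : q * b = r * a)
      (hω : L.omega = u ++ ord p (.over c a) (.over d b) ++ v)
      (hω' : L'.omega = u ++ ord (-p) (.over c a) (.over d b) ++ v)
      (hb : L.base = T.fill ![ord q (.under c a) (.virt e), ord r (.under d b) (.virt e)])
      (hb' : L'.base = T.fill ![ord (-q) (.under c a) (.virt e), ord (-r) (.under d b) (.virt e)]) :
      OCC L L'
  | gauss (L L' : OmegaDiagram) (u v : List Letter) (c d : ℕ) (a b : ℤˣ)
      (hω : L.omega = u ++ [.over c a, .over d b] ++ v)
      (hω' : L'.omega = u ++ [.over d b, .over c a] ++ v)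
      (hb : L.base = L'.base) :
      OCC L L'

/-- One step of semi-welded equivalence. -/
def SemiWeldedStep (L L' : OmegaDiagram) : Prop :=
  Reidemeister L.code L'.code ∨ Detour L.code L'.code ∨ OCC L L' ∨
    ∃ f : ℕ → ℕ, f.Injective ∧ SameWord f L.omega L'.omega ∧ SameCode f L.base L'.base

/-- Semi-welded equivalence (through diagrams in which `ω` is never under-crossing). -/
def SemiWelded : OmegaDiagram → OmegaDiagram → Prop := Relation.EqvGen SemiWeldedStep

/-! ### States -/

/-- The passages of the base components. -/
abbrev Pos (L : OmegaDiagram) := (i : Fin L.base.length) × Fin (L.base.get i).length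

/-- The edges into which the base components are cut by all their crossings and by their
starting points. The edge `⟨i, j⟩` of component `i` precedes the passage `j` of that component; the
last edge `⟨i, Fin.last _⟩` follows the last passage. -/
abbrev Edge (L : OmegaDiagram) := (i : Fin L.base.length) × Fin ((L.base.get i).length + 1)

/-- What happens at the passage `p`. -/
def letter (L : OmegaDiagram) (p : L.Pos) : Letter := (L.base.get p.1).get p.2

/-- The edge that arrives at the passage `p`. -/
def inEdge (L : OmegaDiagram) (p : L.Pos) : L.Edge := ⟨p.1, p.2.castSucc⟩

/-- The edge that leaves the passage `p`. -/
def outEdge (L : OmegaDiagram) (p : L.Pos) : L.Edge := ⟨p.1, p.2.succ⟩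

/-- The classical crossings of the base with itself. -/
def crossings (L : OmegaDiagram) : Finset ℕ :=
  (L.base.flatten.filterMap fun
    | .over c _ => some c
    | _ => none).toFinset

/-- The writhe of the base. -/
def writhe (L : OmegaDiagram) : ℤ :=
  (L.base.flatten.map fun
    | .over _ s => (s : ℤ)
    | _ => 0).sum

/-- `L.Join S e e' δ`: in the state in which the crossings in `S` are `A`-smoothed and the other
crossings of the base are `B`-smoothed, an end of the edge `e` is joined to an end of `e'`; the
orientations of the two edges in the diagram agree there if `δ = 1` and are opposite if `δ = -1`.
Crossings with `ω` and virtual crossings are not smoothed. The `A`-smoothing of a positive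
crossing and the `B`-smoothing of a negative one are the smoothings along the orientation. -/
inductive Join (L : OmegaDiagram) (S : Finset ℕ) : L.Edge → L.Edge → ℤˣ → Prop where
  | close (i : Fin L.base.length) : Join L S ⟨i, Fin.last _⟩ ⟨i, 0⟩ 1
  | virt (p : L.Pos) (c : ℕ) (hp : L.letter p = .virt c) :
      Join L S (L.inEdge p) (L.outEdge p) 1
  | omega (p : L.Pos) (c : ℕ) (s : ℤˣ) (hp : L.letter p = .under c s)
      (hω : Letter.over c s ∈ L.omega) :
      Join L S (L.inEdge p) (L.outEdge p) 1
  | oriented_over (p q : L.Pos) (c : ℕ) (s : ℤˣ) (hp : L.letter p = .over c s)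
      (hq : L.letter q = .under c s) (hS : c ∈ S ↔ s = 1) :
      Join L S (L.inEdge p) (L.outEdge q) 1
  | oriented_under (p q : L.Pos) (c : ℕ) (s : ℤˣ) (hp : L.letter p = .over c s)
      (hq : L.letter q = .under c s) (hS : c ∈ S ↔ s = 1) :
      Join L S (L.inEdge q) (L.outEdge p) 1
  | disoriented_in (p q : L.Pos) (c : ℕ) (s : ℤˣ) (hp : L.letter p = .over c s)
      (hq : L.letter q = .under c s) (hS : ¬ (c ∈ S ↔ s = 1)) :
      Join L S (L.inEdge p) (L.inEdge q) (-1)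
  | disoriented_out (p q : L.Pos) (c : ℕ) (s : ℤˣ) (hp : L.letter p = .over c s)
      (hq : L.letter q = .under c s) (hS : ¬ (c ∈ S ↔ s = 1)) :
      Join L S (L.outEdge p) (L.outEdge q) (-1)

/-- The state curves other than `ω`: the classes of edges that are joined to each other. -/
def Curve (L : OmegaDiagram) (S : Finset ℕ) : Type :=
  Quot fun e e' : L.Edge => ∃ δ, L.Join S e e' δ

/-- The state curve that contains the edge `e`. -/
def curveOf (L : OmegaDiagram) (S : Finset ℕ) (e : L.Edge) : L.Curve S := Quot.mk _ e

open Classical in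
noncomputable instance (L : OmegaDiagram) (S : Finset ℕ) : Fintype (L.Curve S) :=
  Fintype.ofSurjective (L.curveOf S) Quot.mk_surjective

/-- `ε` orients the state curves: `ε e = 1` if the curve through `e` runs in the direction that `e`
has in the diagram, and `ε e = -1` if it runs against it. -/
def IsOrientation (L : OmegaDiagram) (S : Finset ℕ) (ε : L.Edge → ℤˣ) : Prop :=
  ∀ e e' δ, L.Join S e e' δ → ε e' = δ * ε e

/-- A choice of orientations for the state curves of every state. -/
abbrev Orientations (L : OmegaDiagram) :=
  (S : Finset ℕ) → {ε : L.Edge → ℤˣ // L.IsOrientation S ε}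

open Classical in
/-- The virtual linking number of `ω` with the state curve `C`, oriented by `ε`: the signed number
of times that `ω` crosses over `C`. -/
noncomputable def vlk (L : OmegaDiagram) (S : Finset ℕ) (ε : L.Edge → ℤˣ) (C : L.Curve S) : ℤ :=
  ∑ p : L.Pos,
    match L.letter p with
    | .under c s =>
        if Letter.over c s ∈ L.omega ∧ L.curveOf S (L.inEdge p) = C then
          ((s * ε (L.inEdge p) : ℤˣ) : ℤ)
        else 0
    | _ => 0

end OmegaDiagram

/-! ### The Zh-bracket and the Zh-polynomial -/

/-- The ring `ℤ[A, A⁻¹, Z₁, Z₂, …]`. -/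
def ZhRing : Type := LaurentPolynomial (MvPolynomial ℕ+ ℤ)

noncomputable instance : CommRing ZhRing :=
  inferInstanceAs (CommRing (LaurentPolynomial (MvPolynomial ℕ+ ℤ)))

/-- The powers of the variable `A`. -/
noncomputable def Apow (k : ℤ) : ZhRing :=
  (LaurentPolynomial.T k : LaurentPolynomial (MvPolynomial ℕ+ ℤ))

theorem Apow_add (j k : ℤ) : Apow (j + k) = Apow j * Apow k :=
  LaurentPolynomial.T_add j k

theorem Apow_zero : Apow 0 = 1 :=
  LaurentPolynomial.T_zero

/-- The variables `Z₁, Z₂, …`, and `Z₀ = 1`. -/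
noncomputable def Z (k : ℕ) : ZhRing :=
  if h : 0 < k then
    (LaurentPolynomial.C (MvPolynomial.X ⟨k, h⟩) : LaurentPolynomial (MvPolynomial ℕ+ ℤ))
  else 1

/-- The variable `A`, as a unit. -/
noncomputable def unitA : ZhRingˣ where
  val := Apow 1
  inv := Apow (-1)
  val_inv := by rw [← Apow_add, add_neg_cancel, Apow_zero]
  inv_val := by rw [← Apow_add, neg_add_cancel, Apow_zero]

namespace OmegaDiagram

/-- The weight `[S]` of a state whose curves are oriented by `ε`. -/
noncomputable def weight (L : OmegaDiagram) (S : Finset ℕ) (ε : L.Edge → ℤˣ) : ZhRing :=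
  ∏ C : L.Curve S, Z ((L.vlk S ε C).natAbs / 2)

/-- The Zh-bracket, computed from `D ∪ ω` and the orientations `o` of the state curves. The states
are given by the set `S` of the `A`-smoothed crossings. -/
noncomputable def bracket (L : OmegaDiagram) (o : L.Orientations) : ZhRing :=
  ∑ S ∈ L.crossings.powerset,
    Apow ((S.card : ℤ) - ((L.crossings \ S).card : ℤ)) *
      (-Apow 2 - Apow (-2)) ^ (Fintype.card (L.Curve S) - 1) * L.weight S (o S)

/-- The Zh-polynomial, computed from `D ∪ ω` and the orientations `o` of the state curves. -/
noncomputable def polynomial (L : OmegaDiagram) (o : L.Orientations) : ZhRing :=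
  (((-unitA) ^ (-3 * L.writhe) : ZhRingˣ) : ZhRing) * L.bracket o

end OmegaDiagram

/-! ### The Zh-construction -/

/-- What becomes of the passages of `D` in `D ∪ ωᵒᵖ`: next to each passage through a classical
crossing of `D` the strand passes under `ωᵒᵖ`, in a new crossing that is named by `l`.

The two arcs of `ωᵒᵖ` at a crossing `c` lie on the same side of it. They cross the over-strand behind
`c` and the under-strand before `c` (`k c = true`), or the over-strand before `c` and the
under-strand behind `c` (`k c = false`). The crossing `c` lies to the right of the arcs of `ωᵒᵖ` if
these are on the right side of `c` and to the left of them otherwise; hence the sign of the new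
crossing is `1` on the strand of `D` that crosses the other strand of `D` from left to right, and
`-1` on the other strand. -/
def decorate (k : ℕ → Bool) (l : Bool → ℕ → ℕ) : Letter → List Letter
  | .over c s =>
      if k c then [.over c s, .under (l true c) s] else [.under (l true c) s, .over c s]
  | .under c s =>
      if k c then [.under (l false c) (-s), .under c s] else [.under c s, .under (l false c) (-s)]
  | .virt c => [.virt c]

/-- The passages of `ωᵒᵖ` over `D`. -/
def omegaPassages (l : Bool → ℕ → ℕ) : Letter → List Letter
  | .over c s => [.over (l true c) s]
  | .under c s => [.over (l false c) (-s)]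
  | .virt _ => []

/-- `L` is a diagram `Zhᵒᵖ(D) = D ∪ ωᵒᵖ`: at each classical crossing of `D` one of the two possible
pairs of arcs of `ωᵒᵖ` is drawn, these are connected in any order, and all further crossings of `ωᵒᵖ`
with `D` or with itself (those in `N`) are virtual. That the new crossings have new, pairwise
distinct names is part of `L` being a diagram. -/
def IsZhOp (D : Diagram) (L : OmegaDiagram) : Prop :=
  ∃ (k : ℕ → Bool) (l : Bool → ℕ → ℕ) (N : Finset ℕ),
    (∀ c ∈ N, Letter.virt c ∈ L.omega) ∧
    L.base.map (eraseWord N) = D.code.map (fun w => w.flatMap (decorate k l)) ∧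
    (eraseWord N L.omega).Perm (D.code.flatten.flatMap (omegaPassages l))

end Virt

/-! A state of `D ∪ ω` is treated as a list of weighted bonds between points. The strands of `D`
between crossings are bonds whose weight is the signed number of times `ω` passes over them; a
smoothing is a pair of bonds of weight 0. Along a state curve these two kinds of bonds alternate, so
a sign function that changes along every bond (`Bip`) is the same as an orientation of the curves.
Reversing a curve negates its total weight, hence `val`, the product of `f |weight|` over all
components, needs no choice. With `f n = (-A² - A⁻²) Z_{⌊n/2⌋}` the sum over all states is `-A² -
A⁻²` times the bracket (`loopValue_mul_bracket`), and this factor can be cancelled in a domain.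
Everything is therefore proved for the state sum.

The value obeys four local laws (`Lawful`): bonds may be permuted, reversed with negated weight,
merged across a bond of weight 0, and split off as closed circles. Sums over smoothings inherit
these laws, so local computations hold in any surroundings. Kauffman's computations become
`Lawful.curl`, `Lawful.bigon` and `Lawful.triangle`; reversing a strand only exchanges the two
coefficients of a crossing, which reduces all oriented versions to these. The new ingredient is
`Lawful.crossing`: if the four arcs at a crossing carry weights, adding the same number to both
incoming arcs and subtracting it from both outgoing ones changes nothing. This is `ω` sliding over a
crossing.

Since `ω` enters only through weights, the order of its crossings is irrelevant, which gives ωOCC; a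
second Reidemeister move under `ω` cancels two weights, and a third one with only its top strand on
`ω` is a slide. Detour moves disappear after virtual crossings are dropped, and the writhe factor
compensates for curls (`normalized_semiWelded`).

For `Zhᵒᵖ(D)` the system of bonds depends only on `D` and on the choice, at each crossing, between
two pairs of arcs (`IsZhOp.system`). The two choices differ by a slide (`zhSum_indep`). For a
Reidemeister move of `D` the choices are adapted so that the weights inside the move cancel and, on
the strands that leave it, both sides carry the same total weights; the unweighted local computation
then applies (`zhSum_step`).

The linking numbers are even because, modulo 2, only smoothings against the orientation contribute,
and their contributions add up to half of the total change, around closed strands, of the indicator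
function of the curve; this change is zero (`even_total`). -/

namespace Virt

/-! ### Weighted bonds and the value of a system of closed curves -/

/-- A weighted bond between two points. -/
abbrev Bond (P : Type) := P × P × ℤ

section Bonds

variable {P P' : Type} {R : Type} [CommRing R]

/-- Two points are connected by a path of bonds. -/
def Reach (B : List (Bond P)) : P → P → Prop :=
  Relation.EqvGen fun x y => ∃ n, (x, y, n) ∈ B

/-- The connected component of a point. -/
def comp (B : List (Bond P)) (x : P) : Set P := {y | Reach B x y}

/-- The end points of the bonds, with multiplicity. -/
def ends (B : List (Bond P)) : List P := B.flatMap fun b => [b.1, b.2.1]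

/-- `ε` takes opposite values at the two ends of every bond. -/
def Bip (B : List (Bond P)) (ε : P → ℤˣ) : Prop :=
  ∀ x y n, (x, y, n) ∈ B → ε y = -ε x

open Classical in
/-- The total weight of the bonds in `C`, directed by `ε`. -/
noncomputable def total (B : List (Bond P)) (ε : P → ℤˣ) (C : Set P) : ℤ :=
  (B.map fun b => if b.1 ∈ C then (ε b.1 : ℤ) * b.2.2 else 0).sum

open Classical in
/-- The product of `f |weight|` over all components, computed with the help of `ε`. -/
noncomputable def valWith (f : ℕ → R) (B : List (Bond P)) (ε : P → ℤˣ) : R :=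
  ∏ C ∈ (ends B).toFinset.image (comp B), f (total B ε C).natAbs

open Classical in
/-- The product of `f |weight|` over all components. -/
noncomputable def val (f : ℕ → R) (B : List (Bond P)) : R :=
  if h : ∃ ε, Bip B ε then valWith f B h.choose else 0

theorem Reach.refl (B : List (Bond P)) (x : P) : Reach B x x := Relation.EqvGen.refl x

theorem Reach.symm {B : List (Bond P)} {x y : P} (h : Reach B x y) : Reach B y x :=
  Relation.EqvGen.symm _ _ h

theorem Reach.trans {B : List (Bond P)} {x y z : P} (h : Reach B x y) (h' : Reach B y z) :
    Reach B x z := Relation.EqvGen.trans _ _ _ h h'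

theorem Reach.of_mem {B : List (Bond P)} {x y : P} {n : ℤ} (h : (x, y, n) ∈ B) : Reach B x y :=
  Relation.EqvGen.rel _ _ ⟨n, h⟩

theorem mem_comp {B : List (Bond P)} {x y : P} : y ∈ comp B x ↔ Reach B x y := Iff.rfl

theorem comp_eq_iff {B : List (Bond P)} {x y : P} : comp B x = comp B y ↔ Reach B x y := by
  constructor
  · intro h
    have : y ∈ comp B y := Reach.refl B y
    rw [← h] at this
    exact this
  · intro h
    ext z
    exact ⟨fun hz => h.symm.trans hz, fun hz => h.trans hz⟩

theorem Reach.map {B : List (Bond P)} {B' : List (Bond P')} {φ : P → P'}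
    (h : ∀ x y n, (x, y, n) ∈ B → Reach B' (φ x) (φ y)) {a b : P} (hab : Reach B a b) :
    Reach B' (φ a) (φ b) := by
  induction hab with
  | rel x y hxy => obtain ⟨n, hn⟩ := hxy; exact h x y n hn
  | refl x => exact Reach.refl _ _
  | symm x y _ ih => exact ih.symm
  | trans x y z _ _ ih₁ ih₂ => exact ih₁.trans ih₂

theorem Reach.mono {B B' : List (Bond P)} (h : ∀ x y n, (x, y, n) ∈ B → Reach B' x y) {a b : P}
    (hab : Reach B a b) : Reach B' a b :=
  Reach.map (φ := id) h hab

/-- Used to separate components: a function that is constant along bonds takes one value on each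
component. -/
theorem Reach.invariant {α : Sort*} {B : List (Bond P)} {g : P → α}
    (h : ∀ x y n, (x, y, n) ∈ B → g x = g y) {a b : P} (hab : Reach B a b) : g a = g b := by
  induction hab with
  | rel x y hxy => obtain ⟨n, hn⟩ := hxy; exact h x y n hn
  | refl x => rfl
  | symm x y _ ih => exact ih.symm
  | trans x y z _ _ ih₁ ih₂ => exact ih₁.trans ih₂

theorem mem_ends {B : List (Bond P)} {x : P} :
    x ∈ ends B ↔ ∃ y n, (x, y, n) ∈ B ∨ (y, x, n) ∈ B := by
  simp only [ends, List.mem_flatMap, List.mem_cons, List.not_mem_nil, or_false, Prod.exists]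
  constructor
  · rintro ⟨a, b, n, h, rfl | rfl⟩
    · exact ⟨b, n, Or.inl h⟩
    · exact ⟨a, n, Or.inr h⟩
  · rintro ⟨y, n, h | h⟩
    · exact ⟨x, y, n, h, Or.inl rfl⟩
    · exact ⟨y, x, n, h, Or.inr rfl⟩

theorem left_mem_ends {B : List (Bond P)} {x y : P} {n : ℤ} (h : (x, y, n) ∈ B) : x ∈ ends B :=
  mem_ends.2 ⟨y, n, Or.inl h⟩

theorem right_mem_ends {B : List (Bond P)} {x y : P} {n : ℤ} (h : (x, y, n) ∈ B) : y ∈ ends B :=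
  mem_ends.2 ⟨x, n, Or.inr h⟩

@[simp] theorem ends_nil : ends ([] : List (Bond P)) = [] := rfl

@[simp] theorem ends_cons (x y : P) (n : ℤ) (B : List (Bond P)) :
    ends ((x, y, n) :: B) = x :: y :: ends B := rfl

@[simp] theorem ends_append (B B' : List (Bond P)) : ends (B ++ B') = ends B ++ ends B' :=
  List.flatMap_append

theorem total_cons (b : Bond P) (B : List (Bond P)) (ε : P → ℤˣ) (C : Set P) [Decidable (b.1 ∈ C)] :
    total (b :: B) ε C = (if b.1 ∈ C then (ε b.1 : ℤ) * b.2.2 else 0) + total B ε C := by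
  simp only [total, List.map_cons, List.sum_cons]
  congr

theorem total_append (B B' : List (Bond P)) (ε : P → ℤˣ) (C : Set P) :
    total (B ++ B') ε C = total B ε C + total B' ε C := by
  simp [total]

theorem total_congr {B : List (Bond P)} {ε ε' : P → ℤˣ} {C C' : Set P}
    (h : ∀ x ∈ ends B, (x ∈ C ↔ x ∈ C') ∧ (x ∈ C → ε x = ε' x)) : total B ε C = total B ε' C' := by
  unfold total
  congr 1
  apply List.map_congr_left
  rintro ⟨x, y, n⟩ hb
  obtain ⟨h₁, h₂⟩ := h x (left_mem_ends hb)
  by_cases hx : x ∈ C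
  · simp [hx, h₁.1 hx, h₂ hx]
  · have : x ∉ C' := fun h' => hx (h₁.2 h')
    simp [hx, this]

/-- `g₁` and `g₂` have the same fibres on `s`, so both products run over the classes of one
equivalence relation. It allows products over components of different systems to be compared class
by class. -/
theorem prod_image_congr {α β γ M : Type*} [CommMonoid M] [DecidableEq β] [DecidableEq γ]
    (s : Finset α) (g₁ : α → β) (g₂ : α → γ) (F₁ : β → M) (F₂ : γ → M)
    (h : ∀ x ∈ s, ∀ y ∈ s, g₁ x = g₁ y ↔ g₂ x = g₂ y)
    (hF : ∀ x ∈ s, F₁ (g₁ x) = F₂ (g₂ x)) :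
    ∏ C ∈ s.image g₁, F₁ C = ∏ C ∈ s.image g₂, F₂ C := by
  classical
  induction s using Finset.induction_on with
  | empty => simp
  | insert a s ha ih =>
    have ih' := ih (fun x hx y hy => h x (Finset.mem_insert_of_mem hx) y (Finset.mem_insert_of_mem hy))
      (fun x hx => hF x (Finset.mem_insert_of_mem hx))
    have hiff : g₁ a ∈ s.image g₁ ↔ g₂ a ∈ s.image g₂ := by
      simp only [Finset.mem_image]
      refine exists_congr fun x => and_congr_right fun hx => ?_
      exact h x (Finset.mem_insert_of_mem hx) a (Finset.mem_insert_self _ _)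
    rw [Finset.image_insert, Finset.image_insert]
    by_cases hm : g₁ a ∈ s.image g₁
    · rw [Finset.insert_eq_of_mem hm, Finset.insert_eq_of_mem (hiff.1 hm), ih']
    · rw [Finset.prod_insert hm, Finset.prod_insert (fun h' => hm (hiff.2 h')), ih',
        hF a (Finset.mem_insert_self _ _)]

/-- The map `φ` need be neither injective nor surjective; only the induced map of components has to
be bijective and to preserve the absolute weights. The laws of `val` below are instances. -/
theorem valWith_transfer (f : ℕ → R) {B : List (Bond P)} {B' : List (Bond P')} {φ : P → P'}
    {ε : P → ℤˣ} {ε' : P' → ℤˣ}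
    (hr : ∀ x ∈ ends B, ∀ y ∈ ends B, Reach B x y ↔ Reach B' (φ x) (φ y))
    (hm : ∀ x ∈ ends B, φ x ∈ ends B')
    (hs : ∀ x' ∈ ends B', ∃ x ∈ ends B, Reach B' (φ x) x')
    (ht : ∀ x ∈ ends B, (total B ε (comp B x)).natAbs = (total B' ε' (comp B' (φ x))).natAbs) :
    valWith f B ε = valWith f B' ε' := by
  classical
  unfold valWith
  have himg : (ends B').toFinset.image (comp B') =
      (ends B).toFinset.image (fun x => comp B' (φ x)) := by
    ext C
    simp only [Finset.mem_image, List.mem_toFinset]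
    constructor
    · rintro ⟨x', hx', rfl⟩
      obtain ⟨x, hx, hxx⟩ := hs x' hx'
      exact ⟨x, hx, comp_eq_iff.2 hxx⟩
    · rintro ⟨x, hx, rfl⟩
      exact ⟨φ x, hm x hx, rfl⟩
  convert prod_image_congr (ends B).toFinset (comp B) (fun x => comp B' (φ x))
    (fun C => f (total B ε C).natAbs) (fun C => f (total B' ε' C).natAbs) ?_ ?_ using 2
  · intro x hx y hy
    rw [List.mem_toFinset] at hx hy
    simp only [comp_eq_iff]
    exact hr x hx y hy
  · intro x hx
    rw [List.mem_toFinset] at hx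
    simp only [ht x hx]

/-- Both signs change along every bond, so their product does not. -/
theorem Bip.comp_eq {B : List (Bond P)} {ε ε' : P → ℤˣ} (h : Bip B ε) (h' : Bip B ε') {x y : P}
    (hxy : Reach B x y) : ε x * ε' x = ε y * ε' y :=
  Reach.invariant (g := fun x => ε x * ε' x)
    (fun x y n hn => by simp [h x y n hn, h' x y n hn]) hxy

/-- On one component two alternating sign functions differ by a global sign, which is the reversal
of the curve. -/
theorem Bip.natAbs_total {B : List (Bond P)} {ε ε' : P → ℤˣ} (h : Bip B ε) (h' : Bip B ε') (x : P) :
    (total B ε (comp B x)).natAbs = (total B ε' (comp B x)).natAbs := by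
  classical
  have : total B ε (comp B x) = ((ε x * ε' x : ℤˣ) : ℤ) * total B ε' (comp B x) := by
    simp only [total, ← List.sum_map_mul_left]
    congr 1
    apply List.map_congr_left
    rintro ⟨y, z, n⟩ _
    by_cases hy : y ∈ comp B x
    · have h1 := h.comp_eq h' hy
      have h2 : ε y = ε x * ε' x * ε' y := by
        rw [h1, mul_assoc, Int.units_mul_self, mul_one]
      simp only [hy, if_true]
      rw [← mul_assoc, ← Units.val_mul, ← h2]
    · simp [hy]
  rw [this, Int.natAbs_mul, Int.natAbs_of_isUnit (Units.isUnit _), one_mul]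

theorem val_eq (f : ℕ → R) {B : List (Bond P)} {ε : P → ℤˣ} (h : Bip B ε) :
    val f B = valWith f B ε := by
  have hex : ∃ ε, Bip B ε := ⟨ε, h⟩
  rw [val, dif_pos hex]
  exact valWith_transfer f (φ := id) (fun x _ y _ => Iff.rfl) (fun x hx => hx)
    (fun x hx => ⟨x, hx, Reach.refl _ _⟩) fun x _ => hex.choose_spec.natAbs_total h x

theorem val_eq_zero (f : ℕ → R) {B : List (Bond P)} (h : ¬ ∃ ε, Bip B ε) : val f B = 0 := dif_neg h

/-- Non-bipartite systems have the value 0, so it must be checked that neither side is bipartite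
without the other; otherwise one convenient sign function suffices. -/
theorem val_congr (f : ℕ → R) {B : List (Bond P)} {B' : List (Bond P')}
    (h₁ : ∀ ε, Bip B ε → ∃ ε', Bip B' ε')
    (h₂ : ∀ ε', Bip B' ε' → ∃ ε, Bip B ε ∧ valWith f B ε = valWith f B' ε') :
    val f B = val f B' := by
  by_cases h : ∃ ε', Bip B' ε'
  · obtain ⟨ε', h'⟩ := h
    obtain ⟨ε, hε, hv⟩ := h₂ ε' h'
    rw [val_eq f hε, val_eq f h', hv]
  · rw [val_eq_zero f h, val_eq_zero f]
    rintro ⟨ε, hε⟩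
    exact h (h₁ ε hε)

/-! ### Laws -/

/-- The laws of the value of a system of bonds, when the points in `N` are used elsewhere. -/
structure Lawful (f : ℕ → R) (F : List (Bond P) → R) (N : Set P) : Prop where
  perm : ∀ {B B'}, B.Perm B' → F B = F B'
  flip : ∀ x y n B, F ((x, y, n) :: B) = F ((y, x, -n) :: B)
  merge : ∀ x y z w n k B, y ≠ z → y ∉ N → z ∉ N → y ≠ x → y ≠ w → z ≠ x → z ≠ w →
    y ∉ ends B → z ∉ ends B →
    F ((x, y, n) :: (y, z, 0) :: (z, w, k) :: B) = F ((x, w, n + k) :: B)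
  loop : ∀ y z n B, y ≠ z → y ∉ N → z ∉ N → y ∉ ends B → z ∉ ends B →
    F ((y, z, n) :: (y, z, 0) :: B) = f n.natAbs * F B

theorem Bip.perm {B B' : List (Bond P)} {ε : P → ℤˣ} (h : B.Perm B') (hε : Bip B ε) : Bip B' ε :=
  fun x y n hn => hε x y n (h.mem_iff.2 hn)

theorem ends_perm {B B' : List (Bond P)} (h : B.Perm B') : (ends B).Perm (ends B') :=
  h.flatMap_right _

theorem val_perm (f : ℕ → R) {B B' : List (Bond P)} (h : B.Perm B') : val f B = val f B' := by
  have hR : ∀ x y, Reach B x y ↔ Reach B' x y := fun x y =>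
    ⟨Reach.mono fun a b n hn => Reach.of_mem (h.mem_iff.1 hn),
      Reach.mono fun a b n hn => Reach.of_mem (h.mem_iff.2 hn)⟩
  have hC : ∀ x, comp B x = comp B' x := fun x => by ext y; exact hR x y
  refine val_congr f (fun ε hε => ⟨ε, hε.perm h⟩) fun ε hε => ⟨ε, hε.perm h.symm, ?_⟩
  refine valWith_transfer f (φ := id) (fun x _ y _ => hR x y)
    (fun x hx => (ends_perm h).mem_iff.1 hx)
    (fun x hx => ⟨x, (ends_perm h).mem_iff.2 hx, Reach.refl _ _⟩) fun x _ => ?_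
  rw [hC]
  unfold total
  rw [(h.map _).sum_eq]
  rfl

/-- Both the sign at the first end of the bond and its weight are negated, and the two changes
cancel. -/
theorem val_flip (f : ℕ → R) (x y : P) (n : ℤ) (B : List (Bond P)) :
    val f ((x, y, n) :: B) = val f ((y, x, -n) :: B) := by
  classical
  have key : ∀ (x y : P) (n : ℤ) {a b : P},
      Reach ((x, y, n) :: B) a b → Reach ((y, x, -n) :: B) a b := by
    intro x y n a b
    refine Reach.mono fun a b m hm => ?_
    rcases List.mem_cons.1 hm with h | h
    · cases h
      exact (Reach.of_mem (n := -n) (by simp)).symm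
    · exact Reach.of_mem (List.mem_cons_of_mem _ h)
  have hR : ∀ a b, Reach ((x, y, n) :: B) a b ↔ Reach ((y, x, -n) :: B) a b := fun a b =>
    ⟨key x y n, fun h => by simpa using key y x (-n) h⟩
  have hC : ∀ a, comp ((x, y, n) :: B) a = comp ((y, x, -n) :: B) a := fun a => by
    ext b; exact hR a b
  have hB : ∀ (x y : P) (n : ℤ) ε, Bip ((x, y, n) :: B) ε → Bip ((y, x, -n) :: B) ε := by
    intro x y n ε hε a b m hm
    rcases List.mem_cons.1 hm with h | h
    · cases h
      rw [hε x y n (by simp), neg_neg]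
    · exact hε a b m (List.mem_cons_of_mem _ h)
  refine val_congr f (fun ε hε => ⟨ε, hB x y n ε hε⟩) fun ε hε =>
    ⟨ε, by simpa using hB y x (-n) ε hε, ?_⟩
  have hmem : ∀ a, a ∈ ends ((x, y, n) :: B) ↔ a ∈ ends ((y, x, -n) :: B) := by
    intro a; simp only [ends_cons, List.mem_cons]; tauto
  refine valWith_transfer f (φ := id) (fun a _ b _ => hR a b) (fun a ha => (hmem a).1 ha)
    (fun a ha => ⟨a, (hmem a).2 ha, Reach.refl _ _⟩) fun a _ => ?_
  rw [hC, total_cons, total_cons]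
  have hxy : x ∈ comp ((y, x, -n) :: B) a ↔ y ∈ comp ((y, x, -n) :: B) a := by
    have h0 : Reach ((y, x, -n) :: B) y x := Reach.of_mem (n := -n) (by simp)
    exact ⟨fun h => h.trans h0.symm, fun h => h.trans h0⟩
  have hε' := hε y x (-n) (by simp)
  simp only [id, hxy, hε']
  congr 2
  split_ifs <;> simp

/-- Three bonds, and not two, are replaced by one: an odd path keeps the alternation of signs. It
makes the signs at `x` and `z` equal, so that `n` and `k` add up. -/
theorem val_merge (f : ℕ → R) (x y z w : P) (n k : ℤ) (B : List (Bond P)) (hyz : y ≠ z)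
    (hyx : y ≠ x) (hyw : y ≠ w) (hzx : z ≠ x) (hzw : z ≠ w) (hy : y ∉ ends B) (hz : z ∉ ends B) :
    val f ((x, y, n) :: (y, z, 0) :: (z, w, k) :: B) = val f ((x, w, n + k) :: B) := by
  classical
  set B₁ : List (Bond P) := (x, y, n) :: (y, z, 0) :: (z, w, k) :: B with hB₁
  set B₂ : List (Bond P) := (x, w, n + k) :: B with hB₂
  have r1 : Reach B₁ x y := Reach.of_mem (n := n) (by simp [B₁])
  have r2 : Reach B₁ y z := Reach.of_mem (n := 0) (by simp [B₁])
  have r3 : Reach B₁ z w := Reach.of_mem (n := k) (by simp [B₁])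
  have r4 : Reach B₂ x w := Reach.of_mem (n := n + k) (by simp [B₂])
  -- The removed points are sent to the remaining end of the path that has the same sign: `y` to `w`
  -- and `z` to `x`. Hence `ε ∘ φ` is again alternating.
  let φ : P → P := fun p => if p = y then w else if p = z then x else p
  have φy : φ y = w := by simp [φ]
  have φz : φ z = x := by simp [φ, hyz.symm]
  have φo : ∀ p, p ≠ y → p ≠ z → φ p = p := fun p h1 h2 => by simp [φ, h1, h2]
  have φx : φ x = x := φo x hyx.symm hzx.symm
  have φw : φ w = w := φo w hyw.symm hzw.symm
  have φB : ∀ p ∈ ends B, φ p = p := fun p hp =>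
    φo p (fun h => hy (h ▸ hp)) (fun h => hz (h ▸ hp))
  have hφ : ∀ p, Reach B₁ (φ p) p := by
    intro p
    by_cases h1 : p = y
    · subst h1; rw [φy]; exact (r2.trans r3).symm
    · by_cases h2 : p = z
      · subst h2; rw [φz]; exact r1.trans r2
      · rw [φo p h1 h2]; exact Reach.refl _ _
  have up : ∀ {a b}, Reach B₁ a b → Reach B₂ (φ a) (φ b) := by
    intro a b hab
    refine Reach.map (fun a b m hm => ?_) hab
    simp only [B₁, List.mem_cons, Prod.mk.injEq] at hm
    rcases hm with ⟨rfl, rfl, -⟩ | ⟨rfl, rfl, -⟩ | ⟨rfl, rfl, -⟩ | hm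
    · rw [φx, φy]; exact r4
    · rw [φy, φz]; exact r4.symm
    · rw [φz, φw]; exact r4
    · rw [φB _ (left_mem_ends hm), φB _ (right_mem_ends hm)]
      exact Reach.of_mem (List.mem_cons_of_mem _ hm)
  have down : ∀ {a b}, Reach B₂ a b → Reach B₁ a b := by
    intro a b hab
    refine Reach.mono (fun a b m hm => ?_) hab
    simp only [B₂, List.mem_cons, Prod.mk.injEq] at hm
    rcases hm with ⟨rfl, rfl, -⟩ | hm
    · exact r1.trans (r2.trans r3)
    · exact Reach.of_mem (n := m) (by simp [B₁, hm])
  have hmem : ∀ a, a ∈ ends B₂ → a ∈ ends B₁ := by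
    intro a; simp only [B₁, B₂, ends_cons, List.mem_cons]; tauto
  refine val_congr f (fun ε hε => ⟨ε, ?_⟩) fun ε hε => ⟨ε ∘ φ, ?_, ?_⟩
  · intro a b m hm
    simp only [B₂, List.mem_cons, Prod.mk.injEq] at hm
    rcases hm with ⟨rfl, rfl, -⟩ | hm
    · rw [hε z b k (by simp [B₁]), hε y z 0 (by simp [B₁]), hε a y n (by simp [B₁])]
      simp
    · exact hε a b m (by simp [B₁, hm])
  · have hxw : ε w = -ε x := hε x w (n + k) (by simp [B₂])
    intro a b m hm
    simp only [B₁, List.mem_cons, Prod.mk.injEq] at hm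
    simp only [Function.comp]
    rcases hm with ⟨rfl, rfl, -⟩ | ⟨rfl, rfl, -⟩ | ⟨rfl, rfl, -⟩ | hm
    · rw [φx, φy, hxw]
    · rw [φy, φz, hxw, neg_neg]
    · rw [φz, φw, hxw]
    · rw [φB _ (left_mem_ends hm), φB _ (right_mem_ends hm)]
      exact hε a b m (List.mem_cons_of_mem _ hm)
  · refine valWith_transfer f (φ := φ) (fun a _ b _ => ⟨up, fun h => ?_⟩) (fun a ha => ?_)
      (fun a ha => ⟨a, hmem a ha, ?_⟩) fun a _ => ?_
    · exact (hφ a).symm.trans ((down h).trans (hφ b))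
    · by_cases h1 : a = y
      · rw [h1, φy]; simp [B₂]
      · by_cases h2 : a = z
        · rw [h2, φz]; simp [B₂]
        · rw [φo a h1 h2]
          simp only [B₁, B₂, ends_cons, List.mem_cons] at ha ⊢
          tauto
    · have hay : a ≠ y ∧ a ≠ z := by
        simp only [B₂, ends_cons, List.mem_cons] at ha
        rcases ha with rfl | rfl | ha
        · exact ⟨hyx.symm, hzx.symm⟩
        · exact ⟨hyw.symm, hzw.symm⟩
        · exact ⟨fun h => hy (h ▸ ha), fun h => hz (h ▸ ha)⟩
      rw [φo a hay.1 hay.2]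
      exact Reach.refl _ _
    · have hcl : ∀ p, p ∈ comp B₁ a ↔ φ p ∈ comp B₂ (φ a) := fun p =>
        ⟨fun h => up h, fun h => (hφ a).symm.trans ((down h).trans (hφ p))⟩
      have hBt : total B (ε ∘ φ) (comp B₁ a) = total B ε (comp B₂ (φ a)) := by
        refine total_congr fun p hp => ⟨?_, fun _ => ?_⟩
        · rw [hcl p, φB p hp]
        · simp [φB p hp]
      have hx' : x ∈ comp B₁ a ↔ x ∈ comp B₂ (φ a) := by rw [hcl x, φx]
      have hz' : z ∈ comp B₁ a ↔ x ∈ comp B₂ (φ a) := by rw [hcl z, φz]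
      rw [hB₁, hB₂, total_cons, total_cons, total_cons, total_cons, ← hB₁, ← hB₂, hBt]
      simp only [hx', hz', Function.comp, φx, φz]
      congr 1
      split_ifs <;> simp <;> ring

theorem Bip.update {B : List (Bond P)} [DecidableEq P] {ε : P → ℤˣ} (h : Bip B ε) {y : P}
    (hy : y ∉ ends B) (u : ℤˣ) : Bip B (Function.update ε y u) := by
  intro a b m hm
  rw [Function.update_of_ne (fun e => hy (by rw [← e]; exact right_mem_ends hm)),
    Function.update_of_ne (fun e => hy (by rw [← e]; exact left_mem_ends hm)), h a b m hm]

theorem val_loop (f : ℕ → R) (y z : P) (n : ℤ) (B : List (Bond P)) (hyz : y ≠ z)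
    (hy : y ∉ ends B) (hz : z ∉ ends B) :
    val f ((y, z, n) :: (y, z, 0) :: B) = f n.natAbs * val f B := by
  classical
  set B₁ : List (Bond P) := (y, z, n) :: (y, z, 0) :: B with hB₁
  have hsub : ∀ ε, Bip B₁ ε → Bip B ε := fun ε h a b m hm => h a b m (by simp [B₁, hm])
  by_cases hex : ∃ ε, Bip B ε
  · obtain ⟨ε₀, hε₀⟩ := hex
    -- No bond of `B` ends at `y` or `z`, so opposite signs can be prescribed there.
    set ε := Function.update (Function.update ε₀ y 1) z (-1) with hεdef
    have hε : Bip B ε := (hε₀.update hy 1).update hz (-1)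
    have hεz : ε z = -1 := by simp [ε]
    have hεy : ε y = 1 := by simp [ε, hyz]
    have hε₁ : Bip B₁ ε := by
      intro a b m hm
      simp only [B₁, List.mem_cons, Prod.mk.injEq] at hm
      rcases hm with ⟨rfl, rfl, -⟩ | ⟨rfl, rfl, -⟩ | hm
      · rw [hεy, hεz]
      · rw [hεy, hεz]
      · exact hε a b m hm
    have ryz : Reach B₁ y z := Reach.of_mem (n := n) (by simp [B₁])
    have hin : ∀ {a b}, Reach B₁ a b → ((a = y ∨ a = z) ↔ (b = y ∨ b = z)) := by
      intro a b hab
      refine iff_of_eq (Reach.invariant (g := fun a => (a = y ∨ a = z)) ?_ hab)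
      intro a b m hm
      simp only [B₁, List.mem_cons, Prod.mk.injEq] at hm
      rcases hm with ⟨rfl, rfl, -⟩ | ⟨rfl, rfl, -⟩ | hm
      · simp
      · simp
      · have h1 : ¬ (a = y ∨ a = z) := by
          rintro (rfl | rfl)
          · exact hy (left_mem_ends hm)
          · exact hz (left_mem_ends hm)
        have h2 : ¬ (b = y ∨ b = z) := by
          rintro (rfl | rfl)
          · exact hy (right_mem_ends hm)
          · exact hz (right_mem_ends hm)
        simp only [h1, h2]
    -- The circle through `y` and `z` meets no other bond: a path outside of it stays in `B`.
    have hBr : ∀ {a b}, Reach B₁ a b → (Reach B a b ∨ (a = y ∨ a = z)) := by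
      intro a b hab
      induction hab with
      | rel a b h =>
        obtain ⟨m, hm⟩ := h
        simp only [B₁, List.mem_cons, Prod.mk.injEq] at hm
        rcases hm with ⟨rfl, rfl, -⟩ | ⟨rfl, rfl, -⟩ | hm
        · simp
        · simp
        · exact Or.inl (Reach.of_mem hm)
      | refl a => exact Or.inl (Reach.refl _ _)
      | symm a b h ih =>
        rcases ih with ih | ih
        · exact Or.inl ih.symm
        · exact Or.inr ((hin h).1 ih)
      | trans a b c h₁ h₂ ih₁ ih₂ =>
        rcases ih₁ with ih₁ | ih₁
        · rcases ih₂ with ih₂ | ih₂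
          · exact Or.inl (ih₁.trans ih₂)
          · exact Or.inr ((hin h₁).2 ih₂)
        · exact Or.inr ih₁
    have hBr' : ∀ {a b}, Reach B a b → Reach B₁ a b :=
      Reach.mono fun a b m hm => Reach.of_mem (n := m) (by simp [B₁, hm])
    have hne : ∀ a ∈ ends B, ¬ (a = y ∨ a = z) := by
      rintro a ha (rfl | rfl)
      · exact hy ha
      · exact hz ha
    have hC : ∀ a ∈ ends B, comp B₁ a = comp B a := by
      intro a ha
      ext b
      exact ⟨fun h => (hBr h).resolve_right (hne a ha), fun h => hBr' h⟩
    have hCt : ∀ a ∈ ends B, total B₁ ε (comp B₁ a) = total B ε (comp B a) := by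
      intro a ha
      have : y ∉ comp B₁ a := fun h => hne a ha ((hin h).2 (Or.inl rfl))
      rw [hB₁, total_cons, total_cons, ← hB₁]
      simp only [this, if_false, zero_add]
      rw [hC a ha]
    have hCy : (total B₁ ε (comp B₁ y)).natAbs = n.natAbs := by
      rw [hB₁, total_cons, total_cons, ← hB₁]
      have h0 : total B ε (comp B₁ y) = 0 := by
        unfold total
        apply List.sum_eq_zero
        intro t ht
        obtain ⟨⟨a, b, m⟩, hb, rfl⟩ := List.mem_map.1 ht
        have : a ∉ comp B₁ y := fun h => hne a (left_mem_ends hb) ((hin h).1 (Or.inl rfl))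
        simp [this]
      simp [h0, mem_comp, Reach.refl, hεy]
    rw [val_eq f hε₁, val_eq f hε]
    unfold valWith
    have himg : (ends B₁).toFinset.image (comp B₁) =
        insert (comp B₁ y) ((ends B).toFinset.image (comp B₁)) := by
      ext C
      simp only [B₁, ends_cons, List.toFinset_cons, Finset.image_insert, Finset.mem_insert]
      rw [← hB₁, comp_eq_iff.2 ryz]
      tauto
    have hnot : comp B₁ y ∉ (ends B).toFinset.image (comp B₁) := by
      simp only [Finset.mem_image, List.mem_toFinset, not_exists, not_and]
      intro a ha hc
      exact hne a ha ((hin (comp_eq_iff.1 hc)).2 (Or.inl rfl))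
    rw [himg, Finset.prod_insert hnot, hCy]
    congr 1
    refine prod_image_congr _ _ _ _ _ (fun a ha b hb => ?_) fun a ha => ?_
    · rw [List.mem_toFinset] at ha hb
      rw [hC a ha, hC b hb]
    · rw [List.mem_toFinset] at ha
      rw [hCt a ha]
  · rw [val_eq_zero f hex, val_eq_zero f, mul_zero]
    rintro ⟨ε, hε⟩
    exact hex ⟨ε, hsub ε hε⟩

theorem lawful_val (f : ℕ → R) : Lawful f (val f : List (Bond P) → R) ∅ where
  perm := val_perm f
  flip := val_flip f
  merge x y z w n k B hyz _ _ hyx hyw hzx hzw hy hz :=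
    val_merge f x y z w n k B hyz hyx hyw hzx hzw hy hz
  loop y z n B hyz _ _ hy hz := val_loop f y z n B hyz hy hz

theorem val_rename (f : ℕ → R) (ρ : P → P') (hρ : ρ.Injective) (B : List (Bond P)) :
    val f (B.map fun b => (ρ b.1, ρ b.2.1, b.2.2)) = val f B := by
  classical
  symm
  set B' := B.map fun b => (ρ b.1, ρ b.2.1, b.2.2) with hB'
  have hmem : ∀ {x y n}, (x, y, n) ∈ B → (ρ x, ρ y, n) ∈ B' := fun h =>
    List.mem_map.2 ⟨_, h, rfl⟩
  have hmem' : ∀ {x' y' n}, (x', y', n) ∈ B' → ∃ x y, (x, y, n) ∈ B ∧ ρ x = x' ∧ ρ y = y' := by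
    intro x' y' n h
    obtain ⟨⟨x, y, m⟩, hb, he⟩ := List.mem_map.1 h
    simp only [Prod.mk.injEq] at he
    obtain ⟨h1, h2, rfl⟩ := he
    exact ⟨x, y, hb, h1, h2⟩
  have up : ∀ {a b}, Reach B a b → Reach B' (ρ a) (ρ b) :=
    Reach.map fun a b m hm => Reach.of_mem (hmem hm)
  have down' : ∀ {a' b'}, Reach B' a' b' → ∀ a, ρ a = a' → ∃ b, ρ b = b' ∧ Reach B a b := by
    intro a' b' hab
    -- Lifting is proved in both directions at once, because a step of the generated equivalence may
    -- be reversed.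
    have key : ∀ a' b', Reach B' a' b' → (∀ a, ρ a = a' → ∃ b, ρ b = b' ∧ Reach B a b) ∧
        (∀ b, ρ b = b' → ∃ a, ρ a = a' ∧ Reach B b a) := by
      intro a' b' hab
      induction hab with
      | rel a' b' h =>
        obtain ⟨m, hm⟩ := h
        obtain ⟨x, y, hb, rfl, rfl⟩ := hmem' hm
        exact ⟨fun a ha => ⟨y, rfl, by rw [hρ ha]; exact Reach.of_mem hb⟩,
          fun b hb' => ⟨x, rfl, by rw [hρ hb']; exact (Reach.of_mem hb).symm⟩⟩
      | refl a' => exact ⟨fun a ha => ⟨a, ha, Reach.refl _ _⟩, fun a ha => ⟨a, ha, Reach.refl _ _⟩⟩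
      | symm a' b' _ ih => exact ⟨ih.2, ih.1⟩
      | trans a' b' c' _ _ ih₁ ih₂ =>
        refine ⟨fun a ha => ?_, fun c hc => ?_⟩
        · obtain ⟨b, hb, h1⟩ := ih₁.1 a ha
          obtain ⟨c, hc, h2⟩ := ih₂.1 b hb
          exact ⟨c, hc, h1.trans h2⟩
        · obtain ⟨b, hb, h1⟩ := ih₂.2 c hc
          obtain ⟨a, ha, h2⟩ := ih₁.2 b hb
          exact ⟨a, ha, h1.trans h2⟩
    exact (key a' b' hab).1
  have down : ∀ {a b}, Reach B' (ρ a) (ρ b) → Reach B a b := by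
    intro a b h
    obtain ⟨c, hc, h'⟩ := down' h a rfl
    rwa [← hρ hc]
  -- The default sign outside the range of `ρ` is irrelevant: no bond of `B'` ends there.
  refine val_congr f (fun ε hε => ⟨fun p => if h : ∃ x, ρ x = p then ε h.choose else 1, ?_⟩)
    fun ε' hε' => ⟨ε' ∘ ρ, fun x y n h => hε' _ _ n (hmem h), ?_⟩
  · have hval : ∀ x, (if h : ∃ a, ρ a = ρ x then ε h.choose else 1) = ε x := by
      intro x
      have hx : ∃ a, ρ a = ρ x := ⟨x, rfl⟩
      rw [dif_pos hx, hρ hx.choose_spec]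
    intro x' y' n h
    obtain ⟨x, y, hb, rfl, rfl⟩ := hmem' h
    simp only [hval]
    exact hε x y n hb
  · refine valWith_transfer f (φ := ρ) (fun a _ b _ => ⟨up, down⟩) (fun a ha => ?_) (fun a' ha' => ?_)
      fun a _ => ?_
    · obtain ⟨y, n, h | h⟩ := mem_ends.1 ha
      · exact left_mem_ends (hmem h)
      · exact right_mem_ends (hmem h)
    · obtain ⟨y, n, h | h⟩ := mem_ends.1 ha'
      · obtain ⟨x, y, hb, rfl, rfl⟩ := hmem' h
        exact ⟨x, left_mem_ends hb, Reach.refl _ _⟩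
      · obtain ⟨x, y, hb, rfl, rfl⟩ := hmem' h
        exact ⟨y, right_mem_ends hb, Reach.refl _ _⟩
    · unfold total
      rw [hB', List.map_map]
      congr 3
      funext b
      have : b.1 ∈ comp B a ↔ ρ b.1 ∈ comp B' (ρ a) := ⟨up, down⟩
      simp [this, ← hB']

end Bonds

/-! ### Lawful functions: surroundings, crossings, state sums -/

section Laws

variable {P : Type} {R : Type} [CommRing R] {f : ℕ → R} {F : List (Bond P) → R} {N : Set P}

theorem Lawful.mono (hF : Lawful f F N) {N' : Set P} (h : N ⊆ N') : Lawful f F N' where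
  perm := hF.perm
  flip := hF.flip
  merge x y z w n k B hyz hy hz := hF.merge x y z w n k B hyz (fun e => hy (h e)) fun e => hz (h e)
  loop y z n B hyz hy hz := hF.loop y z n B hyz (fun e => hy (h e)) fun e => hz (h e)

/-- Fixed surroundings `C` are absorbed into the function; only their end points become unavailable
for merging. This is what makes computations local. -/
theorem Lawful.append (hF : Lawful f F N) (C : List (Bond P)) :
    Lawful f (fun B => F (B ++ C)) (N ∪ {x | x ∈ ends C}) where
  perm h := hF.perm (h.append_right C)
  flip x y n B := hF.flip x y n (B ++ C)
  merge x y z w n k B hyz hy hz hyx hyw hzx hzw hyB hzB :=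
    hF.merge x y z w n k (B ++ C) hyz (fun e => hy (Or.inl e)) (fun e => hz (Or.inl e))
      hyx hyw hzx hzw
      (by rw [ends_append, List.mem_append, not_or]; exact ⟨hyB, fun e => hy (Or.inr e)⟩)
      (by rw [ends_append, List.mem_append, not_or]; exact ⟨hzB, fun e => hz (Or.inr e)⟩)
  loop y z n B hyz hy hz hyB hzB :=
    hF.loop y z n (B ++ C) hyz (fun e => hy (Or.inl e)) (fun e => hz (Or.inl e))
      (by rw [ends_append, List.mem_append, not_or]; exact ⟨hyB, fun e => hy (Or.inr e)⟩)
      (by rw [ends_append, List.mem_append, not_or]; exact ⟨hzB, fun e => hz (Or.inr e)⟩)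

theorem Lawful.prepend (hF : Lawful f F N) (C : List (Bond P)) :
    Lawful f (fun B => F (C ++ B)) (N ∪ {x | x ∈ ends C}) := by
  have : (fun B => F (C ++ B)) = fun B => F (B ++ C) :=
    funext fun B => hF.perm List.perm_append_comm
  rw [this]
  exact hF.append C

theorem Lawful.linear (hF : Lawful f F N) {G : List (Bond P) → R} (hG : Lawful f G N) (a b : R) :
    Lawful f (fun B => a * F B + b * G B) N where
  perm h := by rw [hF.perm h, hG.perm h]
  flip x y n B := by rw [hF.flip, hG.flip]
  merge x y z w n k B h1 h2 h3 h4 h5 h6 h7 h8 h9 := by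
    rw [hF.merge x y z w n k B h1 h2 h3 h4 h5 h6 h7 h8 h9,
      hG.merge x y z w n k B h1 h2 h3 h4 h5 h6 h7 h8 h9]
  loop y z n B h1 h2 h3 h4 h5 := by
    rw [hF.loop y z n B h1 h2 h3 h4 h5, hG.loop y z n B h1 h2 h3 h4 h5]
    ring

/-- A crossing with the ends `o₁`, `o₂` of the over-strand and `u₁`, `u₂` of the under-strand; the
smoothing that joins `o₁` to `u₂` has the coefficient `α`, the other one has the coefficient `β`. -/
structure Cross (P R : Type) where
  α : R
  β : R
  o₁ : P
  o₂ : P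
  u₁ : P
  u₂ : P

/-- The two smoothings of a crossing. -/
def Cross.apply (x : Cross P R) (F : List (Bond P) → R) (B : List (Bond P)) : R :=
  x.α * F ((x.o₁, x.u₂, 0) :: (x.u₁, x.o₂, 0) :: B) +
    x.β * F ((x.o₁, x.u₁, 0) :: (x.o₂, x.u₂, 0) :: B)

/-- The ends of a crossing. -/
def Cross.pts (x : Cross P R) : Set P := {x.o₁, x.o₂, x.u₁, x.u₂}

/-- A crossing is a linear combination of two fixed surroundings, one for each smoothing. -/
theorem Lawful.cross (hF : Lawful f F N) (x : Cross P R) :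
    Lawful f (x.apply F) (N ∪ x.pts) := by
  refine Lawful.linear
    ((hF.prepend [(x.o₁, x.u₂, 0), (x.u₁, x.o₂, 0)]).mono ?_)
    ((hF.prepend [(x.o₁, x.u₁, 0), (x.o₂, x.u₂, 0)]).mono ?_) _ _
  all_goals
    refine Set.union_subset_union_right _ fun p hp => ?_
    simp only [ends_cons, ends_nil, List.mem_cons, List.not_mem_nil, or_false,
      Set.mem_ofPred_eq] at hp
    simp only [Cross.pts, Set.mem_insert_iff, Set.mem_singleton_iff]
    tauto

/-- The sum over all states of a list of crossings. -/
noncomputable def stateSum (f : ℕ → R) : List (Cross P R) → List (Bond P) → R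
  | [] => val f
  | x :: l => x.apply (stateSum f l)

theorem lawful_stateSum (f : ℕ → R) (l : List (Cross P R)) :
    Lawful f (stateSum f l) {p | ∃ x ∈ l, p ∈ x.pts} := by
  induction l with
  | nil => exact (lawful_val f).mono (Set.empty_subset _)
  | cons x l ih =>
    refine (ih.cross x).mono ?_
    rintro p (⟨y, hy, hp⟩ | hp)
    · exact ⟨y, List.mem_cons_of_mem _ hy, hp⟩
    · exact ⟨x, List.mem_cons_self, hp⟩

/-- Smoothing two crossings in either order adds the same four pairs of joins, up to a permutation
of bonds. -/
theorem Cross.apply_comm (hF : Lawful f F N) (x y : Cross P R) (B : List (Bond P)) :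
    x.apply (y.apply F) B = y.apply (x.apply F) B := by
  have key : ∀ (a b c d : Bond P), F (a :: b :: c :: d :: B) = F (c :: d :: a :: b :: B) := by
    intro a b c d
    have := (List.perm_append_comm (l₁ := [a, b]) (l₂ := [c, d])).append_right B
    exact hF.perm this
  simp only [Cross.apply]
  rw [key, key (y.o₁, y.u₁, 0), key (y.o₁, y.u₂, 0) _ (x.o₁, x.u₁, 0),
    key (y.o₁, y.u₁, 0) _ (x.o₁, x.u₁, 0)]
  ring

theorem stateSum_perm (f : ℕ → R) {l l' : List (Cross P R)} (h : l.Perm l') :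
    (stateSum f l : List (Bond P) → R) = stateSum f l' := by
  induction h with
  | nil => rfl
  | cons x _ ih => rw [stateSum, ih]; rfl
  | swap x y l => funext B; exact Cross.apply_comm (lawful_stateSum f l) y x B
  | trans _ _ ih₁ ih₂ => exact ih₁.trans ih₂

/-- The crossing with the over-strand reversed. -/
def Cross.flipOver (x : Cross P R) : Cross P R := ⟨x.β, x.α, x.o₂, x.o₁, x.u₁, x.u₂⟩

/-- The crossing with the under-strand reversed. -/
def Cross.flipUnder (x : Cross P R) : Cross P R := ⟨x.β, x.α, x.o₁, x.o₂, x.u₂, x.u₁⟩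

theorem Lawful.flip_zero (hF : Lawful f F N) (x y : P) (B : List (Bond P)) :
    F ((x, y, 0) :: B) = F ((y, x, 0) :: B) := by
  rw [hF.flip, neg_zero]

theorem Lawful.swap (hF : Lawful f F N) (a b : Bond P) (B : List (Bond P)) :
    F (a :: b :: B) = F (b :: a :: B) := hF.perm (List.Perm.swap _ _ _)

/-- The two smoothings do not depend on the direction of a strand, but which of them follows the
orientation does; hence the coefficients are exchanged together with the ends. -/
theorem Cross.apply_flipOver (hF : Lawful f F N) (x : Cross P R) (B : List (Bond P)) :
    x.flipOver.apply F B = x.apply F B := by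
  simp only [Cross.apply, Cross.flipOver]
  rw [hF.swap (x.o₂, x.u₂, 0), hF.swap (x.o₂, x.u₁, 0), hF.flip_zero x.u₁ x.o₁,
    hF.swap (x.o₁, x.u₂, 0) (x.o₂, x.u₁, 0), hF.flip_zero x.o₂ x.u₁, hF.swap (x.u₁, x.o₂, 0)]
  ring

theorem Cross.apply_flipUnder (hF : Lawful f F N) (x : Cross P R) (B : List (Bond P)) :
    x.flipUnder.apply F B = x.apply F B := by
  simp only [Cross.apply, Cross.flipUnder]
  rw [hF.swap (x.o₁, x.u₁, 0), hF.flip_zero x.u₂ x.o₂, hF.swap (x.o₂, x.u₂, 0),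
    hF.swap (x.o₁, x.u₂, 0) (x.o₂, x.u₁, 0), hF.flip_zero x.o₂ x.u₁, hF.swap (x.u₁, x.o₂, 0)]
  ring

/-! ### Words of tokens -/

/-- What a strand meets: a weight, or a crossing which it enters at `a` and leaves at `b`. -/
inductive Tok (P : Type) where
  | wt (n : ℤ)
  | pass (a b : P)

/-- The points of a word. -/
def tokPts : List (Tok P) → List P
  | [] => []
  | .wt _ :: w => tokPts w
  | .pass a b :: w => a :: b :: tokPts w

/-- The arcs of a strand that starts at `x`, reads the word and ends at `y`; the weight `n` is added
to the first arc. -/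
def arcs (x : P) (n : ℤ) : List (Tok P) → P → List (Bond P)
  | [], y => [(x, y, n)]
  | .wt m :: w, y => arcs x (n + m) w y
  | .pass a b :: w, y => (x, a, n) :: arcs b 0 w y

@[simp] theorem arcs_nil (x : P) (n : ℤ) (y : P) : arcs x n [] y = [(x, y, n)] := rfl
@[simp] theorem arcs_wt (x : P) (n m : ℤ) (w : List (Tok P)) (y : P) :
    arcs x n (.wt m :: w) y = arcs x (n + m) w y := rfl
@[simp] theorem arcs_pass (x : P) (n : ℤ) (a b : P) (w : List (Tok P)) (y : P) :
    arcs x n (.pass a b :: w) y = (x, a, n) :: arcs b 0 w y := rfl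
@[simp] theorem tokPts_nil : tokPts ([] : List (Tok P)) = [] := rfl
@[simp] theorem tokPts_wt (n : ℤ) (w : List (Tok P)) : tokPts (.wt n :: w) = tokPts w := rfl
@[simp] theorem tokPts_pass (a b : P) (w : List (Tok P)) :
    tokPts (.pass a b :: w) = a :: b :: tokPts w := rfl

@[simp] theorem tokPts_append (u v : List (Tok P)) : tokPts (u ++ v) = tokPts u ++ tokPts v := by
  induction u with
  | nil => rfl
  | cons t u ih => cases t <;> simp [ih]

theorem arcs_append_pass (x : P) (n : ℤ) (u : List (Tok P)) (a b : P) (v : List (Tok P)) (y : P) :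
    arcs x n (u ++ .pass a b :: v) y = arcs x n u a ++ arcs b 0 v y := by
  induction u generalizing x n with
  | nil => rfl
  | cons t u ih => cases t <;> simp [ih]

theorem ends_arcs (x : P) (n : ℤ) (w : List (Tok P)) (y : P) :
    (ends (arcs x n w y)).Perm (x :: y :: tokPts w) := by
  induction w generalizing x n with
  | nil => simp
  | cons t w ih =>
    cases t with
    | wt m => exact ih x _
    | pass a b =>
      simp only [arcs_pass, ends_cons, tokPts_pass]
      refine List.Perm.cons _ ?_
      refine ((ih b 0).cons a).trans ?_
      exact ((List.Perm.swap _ _ _).cons a).trans (List.Perm.swap _ _ _)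

theorem mem_ends_arcs {x : P} {n : ℤ} {w : List (Tok P)} {y p : P} :
    p ∈ ends (arcs x n w y) ↔ p = x ∨ p = y ∨ p ∈ tokPts w := by
  rw [(ends_arcs x n w y).mem_iff, List.mem_cons, List.mem_cons]

/-- Two words have the same arcs. -/
def TokEq (u v : List (Tok P)) : Prop := ∀ x n y, arcs x n u y = arcs x n v y

theorem TokEq.refl (u : List (Tok P)) : TokEq u u := fun _ _ _ => rfl

theorem TokEq.symm {u v : List (Tok P)} (h : TokEq u v) : TokEq v u := fun x n y => (h x n y).symm

theorem TokEq.trans {u v w : List (Tok P)} (h : TokEq u v) (h' : TokEq v w) : TokEq u w :=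
  fun x n y => (h x n y).trans (h' x n y)

theorem TokEq.prepend {u v : List (Tok P)} (h : TokEq u v) (w : List (Tok P)) :
    TokEq (w ++ u) (w ++ v) := by
  intro x n y
  induction w generalizing x n with
  | nil => exact h x n y
  | cons t w ih => cases t <;> simp [ih]

theorem TokEq.append {u v : List (Tok P)} (h : TokEq u v) (w : List (Tok P)) :
    TokEq (u ++ w) (v ++ w) := by
  -- the arcs of `u ++ w` depend on the arcs of `u` only
  have key : ∀ (u : List (Tok P)) (x y z : P) (n : ℤ),
      ∃ l b m, (∀ y, arcs x n u y = l ++ [(b, y, m)]) ∧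
        ∀ w y, arcs x n (u ++ w) y = l ++ arcs b m w y := by
    intro u x y z n
    induction u generalizing x n with
    | nil => exact ⟨[], x, n, fun y => rfl, fun w y => rfl⟩
    | cons t u ih =>
      cases t with
      | wt k => simpa using ih x (n + k)
      | pass a b =>
        obtain ⟨l, b', m, h1, h2⟩ := ih b 0
        exact ⟨(x, a, n) :: l, b', m, fun y => by simp [h1], fun w y => by simp [h2]⟩
  intro x n y
  obtain ⟨l, b, m, h1, h2⟩ := key u x y y n
  obtain ⟨l', b', m', h1', h2'⟩ := key v x y y n
  have := h x n y
  rw [h1, h1'] at this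
  obtain ⟨e1, e2⟩ := List.append_inj' this rfl
  simp only [List.cons.injEq, Prod.mk.injEq, and_true, true_and] at e2
  rw [h2, h2', e1, e2.1, e2.2]

theorem TokEq.append_append {u u' v v' : List (Tok P)} (h : TokEq u u') (h' : TokEq v v') :
    TokEq (u ++ v) (u' ++ v') :=
  (h.append v).trans (h'.prepend u')

theorem TokEq.flatMap {α : Type*} {g g' : α → List (Tok P)} (w : List α)
    (h : ∀ t ∈ w, TokEq (g t) (g' t)) : TokEq (w.flatMap g) (w.flatMap g') := by
  induction w with
  | nil => exact TokEq.refl _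
  | cons t w ih =>
    simp only [List.flatMap_cons]
    exact (h t List.mem_cons_self).append_append
      (ih fun s hs => h s (List.mem_cons_of_mem _ hs))

/-- The weights at the beginning of `v` are collected until its first passage, or its end, closes
the arc that starts at `z`; then `merge` applies. -/
theorem Lawful.concat_nil (hF : Lawful f F N) {x y z w : P} (n k : ℤ) (v : List (Tok P))
    (C : List (Bond P)) (hyz : y ≠ z) (hy : y ∉ N) (hz : z ∉ N) (hyx : y ≠ x) (hzx : z ≠ x)
    (hyw : y ≠ w) (hzw : z ≠ w) (hyv : y ∉ tokPts v) (hzv : z ∉ tokPts v) (hyC : y ∉ ends C)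
    (hzC : z ∉ ends C) :
    F ((x, y, n) :: (y, z, 0) :: (arcs z k v w ++ C)) = F (arcs x (n + k) v w ++ C) := by
  induction v generalizing n k with
  | nil =>
    exact hF.merge x y z w n k C hyz hy hz hyx hyw hzx hzw hyC hzC
  | cons t v ih =>
    cases t with
    | wt m =>
      have := ih n (k + m) (by simpa using hyv) (by simpa using hzv)
      simpa [add_assoc] using this
    | pass a b =>
      simp only [tokPts_pass, List.mem_cons, not_or] at hyv hzv
      have h1 : y ∉ ends (arcs b 0 v w ++ C) := by
        rw [ends_append, List.mem_append, mem_ends_arcs]; tauto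
      have h2 : z ∉ ends (arcs b 0 v w ++ C) := by
        rw [ends_append, List.mem_append, mem_ends_arcs]; tauto
      exact hF.merge x y z a n k _ hyz hy hz hyx hyv.1 hzx hzv.1 h1 h2

/-- Two consecutive strands make up one strand. -/
theorem Lawful.concat (hF : Lawful f F N) {x y z w : P} (n : ℤ) (u v : List (Tok P))
    (C : List (Bond P)) (hyz : y ≠ z) (hy : y ∉ N) (hz : z ∉ N) (hyx : y ≠ x) (hzx : z ≠ x)
    (hyw : y ≠ w) (hzw : z ≠ w) (hyu : y ∉ tokPts u) (hzu : z ∉ tokPts u) (hyv : y ∉ tokPts v)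
    (hzv : z ∉ tokPts v) (hyC : y ∉ ends C) (hzC : z ∉ ends C) :
    F (arcs x n u y ++ (y, z, 0) :: (arcs z 0 v w ++ C)) = F (arcs x n (u ++ v) w ++ C) := by
  induction u generalizing x n F N with
  | nil => simpa using hF.concat_nil n 0 v C hyz hy hz hyx hzx hyw hzw hyv hzv hyC hzC
  | cons t u ih =>
    cases t with
    | wt m => exact ih hF (n + m) hy hz hyx hzx (by simpa using hyu) (by simpa using hzu)
    | pass a b =>
      simp only [tokPts_pass, List.mem_cons, not_or] at hyu hzu
      have := ih (F := fun B => F ([(x, a, n)] ++ B)) (x := b) (hF.prepend [(x, a, n)]) 0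
        (by simp [hy, hyx, hyu.1]) (by simp [hz, hzx, hzu.1]) hyu.2.1 hzu.2.1 hyu.2.2 hzu.2.2
      simpa using this

end Laws

/-! ### Systems of closed strands -/

/-- The points used to cut diagrams: the ends of the passages of the crossing `c`, the two sides of
the starting point of a component, and auxiliary points for the holes of a template. -/
inductive Pt where
  | cr (c : ℕ) (o out : Bool)
  | base (i : ℕ) (out : Bool)
  | hole (i j : ℕ)
  deriving DecidableEq

/-- The closed strand that reads the word `w`. -/
def loopAt (i : ℕ) (w : List (Tok Pt)) : List (Bond Pt) :=
  arcs (.base i true) 0 w (.base i false) ++ [(.base i false, .base i true, 0)]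

/-- The closed strands that read the given words. -/
def sys : ℕ → List (List (Tok Pt)) → List (Bond Pt)
  | _, [] => []
  | i, w :: G => loopAt i w ++ sys (i + 1) G

@[simp] theorem sys_nil (i : ℕ) : sys i [] = [] := rfl
@[simp] theorem sys_cons (i : ℕ) (w : List (Tok Pt)) (G : List (List (Tok Pt))) :
    sys i (w :: G) = loopAt i w ++ sys (i + 1) G := rfl

theorem mem_ends_loopAt {i : ℕ} {w : List (Tok Pt)} {p : Pt} :
    p ∈ ends (loopAt i w) ↔ p = .base i true ∨ p = .base i false ∨ p ∈ tokPts w := by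
  simp only [loopAt, ends_append, List.mem_append, mem_ends_arcs, ends_cons, ends_nil,
    List.mem_cons, List.not_mem_nil, or_false]
  tauto

theorem mem_ends_sys {i : ℕ} {G : List (List (Tok Pt))} {p : Pt} (h : p ∈ ends (sys i G)) :
    (∃ j b, i ≤ j ∧ j < i + G.length ∧ p = .base j b) ∨ ∃ w ∈ G, p ∈ tokPts w := by
  induction G generalizing i with
  | nil => simp at h
  | cons w G ih =>
    rw [sys_cons, ends_append, List.mem_append, mem_ends_loopAt] at h
    rcases h with (h | h | h) | h
    · exact Or.inl ⟨i, true, le_rfl, by simp, h⟩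
    · exact Or.inl ⟨i, false, le_rfl, by simp, h⟩
    · exact Or.inr ⟨w, List.mem_cons_self, h⟩
    · rcases ih h with ⟨j, b, h1, h2, h3⟩ | ⟨w', h1, h2⟩
      · exact Or.inl ⟨j, b, by omega, by simp; omega, h3⟩
      · exact Or.inr ⟨w', List.mem_cons_of_mem _ h1, h2⟩

theorem sys_congr {α : Type*} (i : ℕ) (G : List α) (g g' : α → List (Tok Pt))
    (h : ∀ w ∈ G, TokEq (g w) (g' w)) : sys i (G.map g) = sys i (G.map g') := by
  induction G generalizing i with
  | nil => rfl
  | cons w G ih =>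
    simp only [List.map_cons, sys_cons, loopAt]
    rw [h w List.mem_cons_self _ _ _, ih _ fun w' h' => h w' (List.mem_cons_of_mem _ h')]

/-! ### Starting points and order of closed strands -/

section Sys

variable {R : Type} [CommRing R] {f : ℕ → R} {F : List (Bond Pt) → R} {N : Set Pt}

/-- The word has no base points. -/
def NoBase (w : List (Tok Pt)) : Prop := ∀ i b, Pt.base i b ∉ tokPts w

/-- Both sides equal the strand that is cut at two places, named `i` and `j`. Gluing it at `j`
leaves the starting point `i`, and gluing it at `i` leaves `j`. -/
theorem Lawful.loopAt_rotate (hF : Lawful f F N) {i j : ℕ} (hij : i ≠ j) (u v : List (Tok Pt))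
    (C : List (Bond Pt))
    (hu : NoBase u) (hv : NoBase v) (hi : ∀ b, Pt.base i b ∉ N) (hj : ∀ b, Pt.base j b ∉ N)
    (hiC : ∀ b, Pt.base i b ∉ ends C) (hjC : ∀ b, Pt.base j b ∉ ends C) :
    F (loopAt i (u ++ v) ++ C) = F (loopAt j (v ++ u) ++ C) := by
  have key : ∀ {i j : ℕ} (hij : i ≠ j) (u v : List (Tok Pt)) (hu : NoBase u) (hv : NoBase v)
      (hj : ∀ b, Pt.base j b ∉ N) (hjC : ∀ b, Pt.base j b ∉ ends C),
      F (loopAt i (u ++ v) ++ C) = F (arcs (.base i true) 0 u (.base j false) ++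
        (.base j false, .base j true, 0) :: (arcs (.base j true) 0 v (.base i false) ++
          (.base i false, .base i true, 0) :: C)) := by
    intro i j hij u v hu hv hj hjC
    have h := hF.concat (x := .base i true) (y := .base j false) (z := .base j true)
      (w := .base i false) 0 u v ((.base i false, .base i true, 0) :: C)
      (by simp) (hj _) (hj _) (by simp) (by simp [hij.symm]) (by simp [hij.symm]) (by simp)
      (hu _ _) (hu _ _) (hv _ _) (hv _ _)
      (by simp [hij.symm, hjC]) (by simp [hij.symm, hjC])
    rw [h, loopAt, List.append_assoc]
    rfl
  rw [key hij u v hu hv hj hjC, key hij.symm v u hv hu hi hiC]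
  apply hF.perm
  have := (List.perm_append_comm (l₁ := arcs (.base i true) 0 u (.base j false) ++
        [(.base j false, .base j true, 0)]) (l₂ := arcs (.base j true) 0 v (.base i false) ++
          [(.base i false, .base i true, 0)])).append_right C
  simpa using this

/-- A rotation by the empty word, which still changes the name of the starting point. -/
theorem Lawful.loopAt_rename (hF : Lawful f F N) {i j : ℕ} (hij : i ≠ j) (u : List (Tok Pt))
    (C : List (Bond Pt)) (hu : NoBase u) (hi : ∀ b, Pt.base i b ∉ N) (hj : ∀ b, Pt.base j b ∉ N)
    (hiC : ∀ b, Pt.base i b ∉ ends C) (hjC : ∀ b, Pt.base j b ∉ ends C) :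
    F (loopAt i u ++ C) = F (loopAt j u ++ C) := by
  have := hF.loopAt_rotate hij u [] C hu (fun _ _ => by simp) hi hj hiC hjC
  simpa using this

theorem base_notMem_loopAt {i j : ℕ} {b : Bool} {w : List (Tok Pt)} (hw : NoBase w) (h : j ≠ i) :
    Pt.base j b ∉ ends (loopAt i w) := by
  rw [mem_ends_loopAt]
  have := hw j b
  simp [this, h]

theorem Lawful.sys_rotate {G H : List (List (Tok Pt))} (h : List.Forall₂ List.IsRotated G H)
    (hG : ∀ w ∈ G, NoBase w) {F : List (Bond Pt) → R} {N : Set Pt} (hF : Lawful f F N) (i : ℕ)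
    (hN : ∀ j b, i ≤ j → Pt.base j b ∉ N) :
    F (sys i G) = F (sys i H) := by
  induction h generalizing F N i with
  | nil => rfl
  | @cons w w' G H hw _ ih =>
    have hw0 := hG w List.mem_cons_self
    have hG' : ∀ v ∈ G, NoBase v := fun v hv => hG v (List.mem_cons_of_mem _ hv)
    obtain ⟨u, v, rfl, rfl⟩ : ∃ u v, w = u ++ v ∧ w' = v ++ u := by
      obtain ⟨n, hn⟩ := hw
      refine ⟨w.take (n % w.length), w.drop (n % w.length), (List.take_append_drop _ _).symm, ?_⟩
      rw [← hn, List.rotate_eq_drop_append_take_mod]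
    have hu : NoBase u := fun j b h => hw0 j b (by simp [h])
    have hv : NoBase v := fun j b h => hw0 j b (by simp [h])
    have hvu : NoBase (v ++ u) := fun j b h => hw0 j b (by
      rw [tokPts_append, List.mem_append] at h ⊢; tauto)
    have hout : ∀ j b, (j < i + 1 ∨ i + 1 + G.length ≤ j) → Pt.base j b ∉ ends (sys (i + 1) G) := by
      intro j b hj hmem
      rcases mem_ends_sys hmem with ⟨j', b', h1, h2, h3⟩ | ⟨w, h1, h2⟩
      · cases h3; omega
      · exact hG' w h1 j b h2
    simp only [sys_cons]
    -- The first index beyond the system is free: the rotated strand is moved there and renamed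
    -- back.
    have hne : i ≠ i + 1 + G.length := by omega
    rw [hF.loopAt_rotate hne u v _ hu hv (fun b => hN _ b le_rfl) (fun b => hN _ b (by omega))
      (fun b => hout _ b (by omega)) (fun b => hout _ b (by omega)),
      hF.loopAt_rename hne.symm (v ++ u) _ hvu
      (fun b => hN _ b (by omega)) (fun b => hN _ b le_rfl)
      (fun b => hout _ b (by omega)) (fun b => hout _ b (by omega))]
    refine ih hG' (hF.prepend (loopAt i (v ++ u))) (i + 1) fun j b hj => ?_
    rintro (h | h)
    · exact hN j b (by omega) h
    · exact base_notMem_loopAt hvu (by omega) h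

theorem Lawful.sys_perm {G H : List (List (Tok Pt))} (h : G.Perm H)
    (hG : ∀ w ∈ G, NoBase w) {F : List (Bond Pt) → R} {N : Set Pt} (hF : Lawful f F N) (i : ℕ)
    (hN : ∀ j b, i ≤ j → Pt.base j b ∉ N) :
    F (sys i G) = F (sys i H) := by
  induction h generalizing F N i with
  | nil => rfl
  | @cons w G H h ih =>
    have hw := hG w List.mem_cons_self
    simp only [sys_cons]
    refine ih (fun v hv => hG v (List.mem_cons_of_mem _ hv)) (hF.prepend (loopAt i w)) (i + 1)
      fun j b hj => ?_
    rintro (h | h)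
    · exact hN j b (by omega) h
    · exact base_notMem_loopAt hw (by omega) h
  | swap v w G =>
    have hv := hG v (by simp)
    have hw := hG w (by simp)
    have hG' : ∀ v ∈ G, NoBase v := fun v hv => hG v (by simp [hv])
    have hout : ∀ j b, (j < i + 2 ∨ i + 2 + G.length ≤ j) → Pt.base j b ∉ ends (sys (i + 2) G) := by
      intro j b hj hmem
      rcases mem_ends_sys hmem with ⟨j', b', h1, h2, h3⟩ | ⟨w, h1, h2⟩
      · cases h3; omega
      · exact hG' w h1 j b h2
    -- Exchanging the names of two strands takes three renamings, through the free index `i + 2 +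
    -- G.length`.
    have key : ∀ {i₁ i₂ i₃ : ℕ} (u u' : List (Tok Pt)), NoBase u → NoBase u' → i ≤ i₁ → i ≤ i₂ →
        i ≤ i₃ → i₁ ≠ i₂ → i₁ ≠ i₃ → i₂ ≠ i₃ →
        (i₁ < i + 2 ∨ i + 2 + G.length ≤ i₁) → (i₂ < i + 2 ∨ i + 2 + G.length ≤ i₂) →
        F (loopAt i₁ u ++ (loopAt i₃ u' ++ sys (i + 2) G)) =
          F (loopAt i₂ u ++ (loopAt i₃ u' ++ sys (i + 2) G)) := by
      intro i₁ i₂ i₃ u u' hu hu' h1 h2 h3 h12 h13 h23 h1' h2'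
      refine hF.loopAt_rename h12 u _ hu (fun b => hN _ b h1) (fun b => hN _ b h2) (fun b => ?_)
        fun b => ?_
      · rw [ends_append, List.mem_append, not_or]
        exact ⟨base_notMem_loopAt hu' h13, hout _ b h1'⟩
      · rw [ends_append, List.mem_append, not_or]
        exact ⟨base_notMem_loopAt hu' h23, hout _ b h2'⟩
    have comm : ∀ (A B C : List (Bond Pt)), F (A ++ (B ++ C)) = F (B ++ (A ++ C)) := by
      intro A B C
      apply hF.perm
      rw [← List.append_assoc, ← List.append_assoc]
      exact List.perm_append_comm.append_right C
    simp only [sys_cons]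
    rw [key (i₂ := i + 2 + G.length) w v hw hv (by omega) (by omega) (by omega) (by omega) (by omega)
        (by omega) (by omega) (by omega),
      comm, key (i₂ := i) v w hv hw (by omega) (by omega) (by omega) (by omega) (by omega)
        (by omega) (by omega) (by omega),
      comm, key (i₂ := i + 1) w v hw hv (by omega) (by omega) (by omega) (by omega) (by omega)
        (by omega) (by omega) (by omega), comm]
  | trans h₁ h₂ ih₁ ih₂ =>
    rw [ih₁ hG hF i hN, ih₂ (fun w hw => hG w (h₁.mem_iff.2 hw)) hF i hN]

end Sys

/-! ### Local computations without weights -/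

section Unweighted

variable {Q R : Type} [CommRing R] {δ : R} {U : List (Q × Q) → R} {inner : Q → Bool}

/-- The end points of a list of arcs. -/
def uends (B : List (Q × Q)) : List Q := B.flatMap fun b => [b.1, b.2]

/-- The laws for arcs without weights, when the points that are not inner are used elsewhere. -/
structure ULawful (δ : R) (U : List (Q × Q) → R) (inner : Q → Bool) : Prop where
  perm : ∀ {B B'}, B.Perm B' → U B = U B'
  flip : ∀ x y B, U ((x, y) :: B) = U ((y, x) :: B)
  merge : ∀ x y z w B, y ≠ z → inner y → inner z → y ≠ x → y ≠ w → z ≠ x → z ≠ w →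
    y ∉ uends B → z ∉ uends B → U ((x, y) :: (y, z) :: (z, w) :: B) = U ((x, w) :: B)
  loop : ∀ y z B, y ≠ z → inner y → inner z → y ∉ uends B → z ∉ uends B →
    U ((y, z) :: (y, z) :: B) = δ * U B

/-- Local pictures are computed with finitely many abstract points and then placed into the diagram
by `ι`; only the inner points have to be unused elsewhere. -/
theorem Lawful.unweighted {P : Type} {f : ℕ → R} {F : List (Bond P) → R} {N : Set P}
    (hF : Lawful f F N) (ι : Q → P) (hι : ι.Injective) (hN : ∀ q, inner q → ι q ∉ N) :
    ULawful (f 0) (fun B => F (B.map fun b => (ι b.1, ι b.2, 0))) inner := by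
  have hends : ∀ (B : List (Q × Q)) (y : Q), y ∉ uends B →
      ι y ∉ ends (B.map fun b => ((ι b.1, ι b.2, 0) : Bond P)) := by
    intro B y hy h
    apply hy
    induction B with
    | nil => simp at h
    | cons b B ih =>
      simp only [List.map_cons, ends_cons, List.mem_cons, hι.eq_iff] at h
      simp only [uends, List.flatMap_cons, List.mem_append, List.mem_cons, List.not_mem_nil,
        or_false]
      rcases h with h | h | h
      · exact Or.inl (Or.inl h)
      · exact Or.inl (Or.inr h)
      · refine Or.inr (ih (fun h' => hy ?_) h)
        simp only [uends, List.flatMap_cons, List.mem_append]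
        exact Or.inr h'
  refine ⟨fun h => hF.perm (h.map _), fun x y B => hF.flip_zero _ _ _, ?_, ?_⟩
  · intro x y z w B h1 h2 h3 h4 h5 h6 h7 h8 h9
    have := hF.merge (ι x) (ι y) (ι z) (ι w) 0 0 (B.map fun b => (ι b.1, ι b.2, 0))
      (hι.ne h1) (hN _ h2) (hN _ h3) (hι.ne h4) (hι.ne h5) (hι.ne h6) (hι.ne h7) (hends _ _ h8)
      (hends _ _ h9)
    simpa using this
  · intro y z B h1 h2 h3 h4 h5
    have := hF.loop (ι y) (ι z) 0 (B.map fun b => (ι b.1, ι b.2, 0))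
      (hι.ne h1) (hN _ h2) (hN _ h3) (hends _ _ h4) (hends _ _ h5)
    simpa using this

/-- Orient all arcs in a standard way. -/
def canon [LE Q] [DecidableLE Q] (B : List (Q × Q)) : List (Q × Q) :=
  B.map fun b => if b.1 ≤ b.2 then b else (b.2, b.1)

/-- Arcs without weights have no direction, so after this normalization equality of pictures is a
decidable permutation test. -/
theorem ULawful.canon [LE Q] [DecidableLE Q] (hU : ULawful δ U inner) (B : List (Q × Q)) :
    U (canon B) = U B := by
  -- The arcs already treated are moved into `C`, since reversal is available only at the head of
  -- the list.
  have key : ∀ C, U (C ++ Virt.canon B) = U (C ++ B) := by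
    induction B with
    | nil => exact fun C => rfl
    | cons b B ih =>
      intro C
      have h := ih (C ++ [if b.1 ≤ b.2 then b else (b.2, b.1)])
      simp only [List.append_assoc, List.singleton_append] at h
      simp only [Virt.canon, List.map_cons] at h ⊢
      rw [h]
      split_ifs
      · rfl
      · rw [hU.perm List.perm_middle, hU.flip]
        exact (hU.perm List.perm_middle).symm
  exact key []

variable [DecidableEq Q]

/-- Remove the first arc that ends at `y`, and return its other end. -/
def pull (y : Q) : List (Q × Q) → Option (Q × List (Q × Q))
  | [] => none
  | (a, b) :: B =>
      if b = y then some (a, B) else if a = y then some (b, B)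
      else (pull y B).map fun r => (r.1, (a, b) :: r.2)

theorem ULawful.pull (hU : ULawful δ U inner) {y x : Q} {B B' : List (Q × Q)}
    (h : pull y B = some (x, B')) (C : List (Q × Q)) : U (C ++ B) = U ((x, y) :: (C ++ B')) := by
  induction B generalizing x B' C with
  | nil => simp [Virt.pull] at h
  | cons b B ih =>
    obtain ⟨a, b⟩ := b
    rw [Virt.pull] at h
    split_ifs at h with h1 h2
    · simp only [Option.some.injEq, Prod.mk.injEq] at h
      rw [← h.1, ← h.2, ← h1]
      exact hU.perm List.perm_middle
    · simp only [Option.some.injEq, Prod.mk.injEq] at h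
      rw [← h.1, ← h.2, ← h2, hU.flip]
      exact hU.perm List.perm_middle
    · rw [Option.map_eq_some_iff] at h
      obtain ⟨⟨x', B₁⟩, hp, he⟩ := h
      simp only [Prod.mk.injEq] at he
      rw [← he.1, ← he.2]
      have := ih hp (C ++ [(a, b)])
      simpa using this

/-- Eliminate the smoothing arcs `J` from the arcs `B`; count the closed curves that split off. -/
def reduceArcs (inner : Q → Bool) : List (Q × Q) → List (Q × Q) → Option (ℕ × List (Q × Q))
  | [], B => some (0, B)
  | (y, z) :: J, B =>
    match pull y B with
    | none => none
    | some (x, B₁) =>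
      if x = z then
        if y ≠ z ∧ inner y ∧ inner z ∧ y ∉ uends (J ++ B₁) ∧ z ∉ uends (J ++ B₁) then
          (reduceArcs inner J B₁).map fun r => (r.1 + 1, r.2)
        else none
      else
        match pull z B₁ with
        | none => none
        | some (w, B₂) =>
          if y ≠ z ∧ inner y ∧ inner z ∧ y ≠ x ∧ y ≠ w ∧ z ≠ w ∧ y ∉ uends (J ++ B₂) ∧
              z ∉ uends (J ++ B₂) then
            reduceArcs inner J ((x, w) :: B₂)
          else none

/-- A smoothing arc either closes up one arc, which is the loop law and gives a factor `δ`, or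
connects two different arcs, which is the merge law. The algorithm tests the side conditions of
these laws itself, so its success is a proof. -/
theorem ULawful.reduceArcs (hU : ULawful δ U inner) {J B B' : List (Q × Q)} {k : ℕ}
    (h : reduceArcs inner J B = some (k, B')) : U (J ++ B) = δ ^ k * U B' := by
  induction J generalizing B k with
  | nil =>
    simp only [Virt.reduceArcs, Option.some.injEq, Prod.mk.injEq] at h
    simp [← h.1, ← h.2]
  | cons j J ih =>
    obtain ⟨y, z⟩ := j
    rw [Virt.reduceArcs] at h
    split at h
    · cases h
    · rename_i x B₁ hp
      have e1 : U ((y, z) :: J ++ B) = U ((x, y) :: (y, z) :: (J ++ B₁)) := by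
        simpa using hU.pull hp ((y, z) :: J)
      split_ifs at h with h1 h2
      · rw [Option.map_eq_some_iff] at h
        obtain ⟨⟨k', B₂⟩, hr, he⟩ := h
        simp only [Prod.mk.injEq] at he
        rw [he.2] at hr
        rw [e1, h1, hU.flip, hU.loop _ _ _ h2.1 h2.2.1 h2.2.2.1 h2.2.2.2.1 h2.2.2.2.2, ih hr,
          ← he.1]
        ring
      · split at h
        · cases h
        · rename_i w B₂ hp2
          split_ifs at h with h2
          have e2 : U ((x, y) :: (y, z) :: (J ++ B₁)) =
              U ((x, y) :: (y, z) :: (z, w) :: (J ++ B₂)) := by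
            have := hU.pull hp2 ((x, y) :: (y, z) :: J)
            simp only [List.cons_append] at this
            rw [this, hU.flip]
            refine hU.perm ?_
            exact (List.Perm.swap _ _ _).trans ((List.Perm.swap _ _ _).cons _)
          rw [e1, e2, hU.merge _ _ _ _ _ h2.1 h2.2.1 h2.2.2.1 h2.2.2.2.1 h2.2.2.2.2.1 (Ne.symm h1)
            h2.2.2.2.2.2.1 h2.2.2.2.2.2.2.1 h2.2.2.2.2.2.2.2, ← ih h]
          exact hU.perm List.perm_middle.symm

/-- The arcs `B`, with the smoothing arcs `J`, reduce to the arcs `T` and `k` closed curves. -/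
def reducesTo [LE Q] [DecidableLE Q] (inner : Q → Bool) (J B : List (Q × Q)) (k : ℕ)
    (T : List (Q × Q)) : Bool :=
  match reduceArcs inner J B with
  | none => false
  | some (k', B') => k' = k ∧ (canon B').isPerm (canon T)

/-- With this lemma the resolution of each state of a local picture is settled by `decide`. -/
theorem ULawful.reducesTo [LE Q] [DecidableLE Q] (hU : ULawful δ U inner) {J B T : List (Q × Q)}
    {k : ℕ} (h : reducesTo inner J B k T = true) : U (J ++ B) = δ ^ k * U T := by
  unfold Virt.reducesTo at h
  split at h
  · cases h
  · rename_i k' B' hr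
    simp only [decide_eq_true_eq, List.isPerm_iff] at h
    rw [hU.reduceArcs hr, h.1, ← hU.canon B', hU.perm h.2, hU.canon]

end Unweighted

/-! ### The local form of the Reidemeister moves -/

section Local

variable {P R : Type} [CommRing R] {f : ℕ → R} {F : List (Bond P) → R} {N : Set P}

/-- One smoothing splits off a circle and the other does not, so the factor is `α * f 0 + β = -α ^
3`. The two parts are the curls with the over-strand and with the under-strand first. -/
theorem Lawful.curl (hF : Lawful f F N) {α β : R} (h₁ : α * β = 1) (h₂ : f 0 = -α ^ 2 - β ^ 2)
    (ι : Fin 6 → P) (hι : ι.Injective) (hN : ∀ q, 2 ≤ q → ι q ∉ N) :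
    Cross.apply ⟨α, β, ι 2, ι 3, ι 4, ι 5⟩ F [(ι 0, ι 2, 0), (ι 3, ι 4, 0), (ι 5, ι 1, 0)] =
        -α ^ 3 * F [(ι 0, ι 1, 0)] ∧
      Cross.apply ⟨α, β, ι 2, ι 3, ι 4, ι 5⟩ F [(ι 0, ι 4, 0), (ι 5, ι 2, 0), (ι 3, ι 1, 0)] =
        -α ^ 3 * F [(ι 0, ι 1, 0)] := by
  have hU := hF.unweighted (inner := fun q => decide (2 ≤ q)) ι hι
    (fun q hq => hN q (of_decide_eq_true hq))
  -- The points 0 and 1 are the outer ends; 2, 3 and 4, 5 are the ends of the over- and the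
  -- under-strand at the crossing.
  have e1 := hU.reducesTo (J := [(2, 5), (4, 3)]) (B := [(0, 2), (3, 4), (5, 1)]) (k := 1)
    (T := [(0, 1)]) (by decide)
  have e2 := hU.reducesTo (J := [(2, 4), (3, 5)]) (B := [(0, 2), (3, 4), (5, 1)]) (k := 0)
    (T := [(0, 1)]) (by decide)
  have e3 := hU.reducesTo (J := [(2, 5), (4, 3)]) (B := [(0, 4), (5, 2), (3, 1)]) (k := 1)
    (T := [(0, 1)]) (by decide)
  have e4 := hU.reducesTo (J := [(2, 4), (3, 5)]) (B := [(0, 4), (5, 2), (3, 1)]) (k := 0)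
    (T := [(0, 1)]) (by decide)
  simp only [List.cons_append, List.nil_append, List.map_cons, List.map_nil] at e1 e2 e3 e4
  simp only [Cross.apply, e1, e2, e3, e4, h₂]
  constructor <;> linear_combination (-β * F [(ι 0, ι 1, 0)]) * h₁

/-- One of the four states separates the strands, with coefficient `α * β = 1`. The other three give
the arcs that turn back, with total coefficient `α ^ 2 + β ^ 2 + α * β * f 0 = 0`. -/
theorem Lawful.bigon (hF : Lawful f F N) {α β : R} (h₁ : α * β = 1) (h₂ : f 0 = -α ^ 2 - β ^ 2)
    (ι : Fin 12 → P) (hι : ι.Injective) (hN : ∀ q, 4 ≤ q → ι q ∉ N) :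
    Cross.apply ⟨α, β, ι 4, ι 5, ι 6, ι 7⟩ (Cross.apply ⟨β, α, ι 8, ι 9, ι 10, ι 11⟩ F)
        [(ι 0, ι 4, 0), (ι 5, ι 8, 0), (ι 9, ι 1, 0), (ι 2, ι 6, 0), (ι 7, ι 10, 0),
          (ι 11, ι 3, 0)] =
      F [(ι 0, ι 1, 0), (ι 2, ι 3, 0)] := by
  have hU := hF.unweighted (inner := fun q => decide (4 ≤ q)) ι hι
    (fun q hq => hN q (of_decide_eq_true hq))
  have e1 := hU.reducesTo (J := [(8, 11), (10, 9), (4, 7), (6, 5)])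
    (B := [(0, 4), (5, 8), (9, 1), (2, 6), (7, 10), (11, 3)]) (k := 0)
    (T := [(0, 1), (2, 3)]) (by decide)
  have e2 := hU.reducesTo (J := [(8, 11), (10, 9), (4, 6), (5, 7)])
    (B := [(0, 4), (5, 8), (9, 1), (2, 6), (7, 10), (11, 3)]) (k := 0)
    (T := [(0, 2), (1, 3)]) (by decide)
  have e3 := hU.reducesTo (J := [(8, 10), (9, 11), (4, 7), (6, 5)])
    (B := [(0, 4), (5, 8), (9, 1), (2, 6), (7, 10), (11, 3)]) (k := 0)
    (T := [(0, 2), (1, 3)]) (by decide)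
  have e4 := hU.reducesTo (J := [(8, 10), (9, 11), (4, 6), (5, 7)])
    (B := [(0, 4), (5, 8), (9, 1), (2, 6), (7, 10), (11, 3)]) (k := 1)
    (T := [(0, 2), (1, 3)]) (by decide)
  simp only [List.cons_append, List.nil_append, List.map_cons, List.map_nil] at e1 e2 e3 e4
  simp only [Cross.apply, e1, e2, e3, e4, h₂]
  linear_combination (F [(ι 0, ι 1, 0), (ι 2, ι 3, 0)] - (α ^ 2 + β ^ 2) *
    F [(ι 0, ι 2, 0), (ι 1, ι 3, 0)]) * h₁

/-- The arcs on one side of a Reidemeister move of type three. -/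
theorem Lawful.triangle_side (hF : Lawful f F N) {α β : R} (h₁ : α * β = 1)
    (h₂ : f 0 = -α ^ 2 - β ^ 2)
    (ι : Fin 18 → P) (hι : ι.Injective) (hN : ∀ q, 6 ≤ q → ι q ∉ N) :
    Cross.apply ⟨α, β, ι 6, ι 7, ι 8, ι 9⟩ (Cross.apply ⟨α, β, ι 10, ι 11, ι 12, ι 13⟩
        (Cross.apply ⟨α, β, ι 14, ι 15, ι 16, ι 17⟩ F))
        [(ι 0, ι 6, 0), (ι 7, ι 10, 0), (ι 11, ι 1, 0), (ι 2, ι 8, 0), (ι 9, ι 14, 0),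
          (ι 15, ι 3, 0), (ι 4, ι 12, 0), (ι 13, ι 16, 0), (ι 17, ι 5, 0)] =
      α ^ 3 * F [(ι 0, ι 5, 0), (ι 2, ι 3, 0), (ι 4, ι 1, 0)] +
      α * (F [(ι 0, ι 2, 0), (ι 4, ι 1, 0), (ι 3, ι 5, 0)] +
        F [(ι 0, ι 5, 0), (ι 2, ι 4, 0), (ι 1, ι 3, 0)]) +
      β * (F [(ι 0, ι 1, 0), (ι 2, ι 4, 0), (ι 3, ι 5, 0)] +
        F [(ι 0, ι 2, 0), (ι 4, ι 5, 0), (ι 1, ι 3, 0)]) := by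
  have hU := hF.unweighted (inner := fun q => decide (6 ≤ q)) ι hι
    (fun q hq => hN q (of_decide_eq_true hq))
  let B : List (Fin 18 × Fin 18) :=
    [(0, 6), (7, 10), (11, 1), (2, 8), (9, 14), (15, 3), (4, 12), (13, 16), (17, 5)]
  have e1 := hU.reducesTo (J := [(14, 17), (16, 15), (10, 13), (12, 11), (6, 9), (8, 7)]) (B := B)
    (k := 0) (T := [(0, 5), (2, 3), (4, 1)]) (by decide)
  have e2 := hU.reducesTo (J := [(14, 16), (15, 17), (10, 13), (12, 11), (6, 9), (8, 7)]) (B := B)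
    (k := 0) (T := [(0, 2), (4, 1), (3, 5)]) (by decide)
  have e3 := hU.reducesTo (J := [(14, 17), (16, 15), (10, 12), (11, 13), (6, 9), (8, 7)]) (B := B)
    (k := 0) (T := [(0, 5), (2, 4), (1, 3)]) (by decide)
  have e4 := hU.reducesTo (J := [(14, 17), (16, 15), (10, 13), (12, 11), (6, 8), (7, 9)]) (B := B)
    (k := 0) (T := [(0, 2), (4, 1), (3, 5)]) (by decide)
  have e5 := hU.reducesTo (J := [(14, 16), (15, 17), (10, 12), (11, 13), (6, 9), (8, 7)]) (B := B)
    (k := 0) (T := [(0, 1), (2, 4), (3, 5)]) (by decide)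
  have e6 := hU.reducesTo (J := [(14, 16), (15, 17), (10, 13), (12, 11), (6, 8), (7, 9)]) (B := B)
    (k := 1) (T := [(0, 2), (4, 1), (3, 5)]) (by decide)
  have e7 := hU.reducesTo (J := [(14, 17), (16, 15), (10, 12), (11, 13), (6, 8), (7, 9)]) (B := B)
    (k := 0) (T := [(0, 2), (4, 5), (1, 3)]) (by decide)
  have e8 := hU.reducesTo (J := [(14, 16), (15, 17), (10, 12), (11, 13), (6, 8), (7, 9)]) (B := B)
    (k := 0) (T := [(0, 2), (4, 1), (3, 5)]) (by decide)
  simp only [B, List.cons_append, List.nil_append, List.map_cons, List.map_nil]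
    at e1 e2 e3 e4 e5 e6 e7 e8
  simp only [Cross.apply, e1, e2, e3, e4, e5, e6, e7, e8, h₂]
  set X := F [(ι 0, ι 2, 0), (ι 4, ι 1, 0), (ι 3, ι 5, 0)]
  set Y := F [(ι 0, ι 5, 0), (ι 2, ι 4, 0), (ι 1, ι 3, 0)]
  set Z := F [(ι 0, ι 1, 0), (ι 2, ι 4, 0), (ι 3, ι 5, 0)]
  set W := F [(ι 0, ι 2, 0), (ι 4, ι 5, 0), (ι 1, ι 3, 0)]
  -- Four of the eight states give the picture `X`. Their coefficients `2 α²β + αβ² f 0 + β³` add up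
  -- to `α`, the coefficient with which `Y` occurs once.
  linear_combination (α * X * 2 + α * Y + β * Z + β * W - (α * (α * β + 1) + β ^ 3) * X) * h₁

/-- Reversing the order of the crossings on all three strands. -/
theorem Lawful.triangle (hF : Lawful f F N) {α β : R} (h₁ : α * β = 1)
    (h₂ : f 0 = -α ^ 2 - β ^ 2)
    (ι : Fin 18 → P) (hι : ι.Injective) (hN : ∀ q, 6 ≤ q → ι q ∉ N) :
    Cross.apply ⟨α, β, ι 6, ι 7, ι 8, ι 9⟩ (Cross.apply ⟨α, β, ι 10, ι 11, ι 12, ι 13⟩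
        (Cross.apply ⟨α, β, ι 14, ι 15, ι 16, ι 17⟩ F))
        [(ι 0, ι 6, 0), (ι 7, ι 10, 0), (ι 11, ι 1, 0), (ι 2, ι 8, 0), (ι 9, ι 14, 0),
          (ι 15, ι 3, 0), (ι 4, ι 12, 0), (ι 13, ι 16, 0), (ι 17, ι 5, 0)] =
    Cross.apply ⟨α, β, ι 6, ι 7, ι 8, ι 9⟩ (Cross.apply ⟨α, β, ι 10, ι 11, ι 12, ι 13⟩
        (Cross.apply ⟨α, β, ι 14, ι 15, ι 16, ι 17⟩ F))
        [(ι 0, ι 10, 0), (ι 11, ι 6, 0), (ι 7, ι 1, 0), (ι 2, ι 14, 0), (ι 15, ι 8, 0),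
          (ι 9, ι 3, 0), (ι 4, ι 16, 0), (ι 17, ι 12, 0), (ι 13, ι 5, 0)] := by
  have hU := hF.unweighted (inner := fun q => decide (6 ≤ q)) ι hι
    (fun q hq => hN q (of_decide_eq_true hq))
  rw [hF.triangle_side h₁ h₂ ι hι hN]
  -- On this side `X` and `Y` exchange their roles: `Y` comes from four states and `X` from one. The
  -- sums agree because both pictures end up with the coefficient `α`.
  let B : List (Fin 18 × Fin 18) :=
    [(0, 10), (11, 6), (7, 1), (2, 14), (15, 8), (9, 3), (4, 16), (17, 12), (13, 5)]
  have e1 := hU.reducesTo (J := [(14, 17), (16, 15), (10, 13), (12, 11), (6, 9), (8, 7)]) (B := B)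
    (k := 0) (T := [(0, 5), (2, 3), (4, 1)]) (by decide)
  have e2 := hU.reducesTo (J := [(14, 16), (15, 17), (10, 13), (12, 11), (6, 9), (8, 7)]) (B := B)
    (k := 0) (T := [(0, 5), (2, 4), (1, 3)]) (by decide)
  have e3 := hU.reducesTo (J := [(14, 17), (16, 15), (10, 12), (11, 13), (6, 9), (8, 7)]) (B := B)
    (k := 0) (T := [(0, 2), (4, 1), (3, 5)]) (by decide)
  have e4 := hU.reducesTo (J := [(14, 17), (16, 15), (10, 13), (12, 11), (6, 8), (7, 9)]) (B := B)
    (k := 0) (T := [(0, 5), (2, 4), (1, 3)]) (by decide)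
  have e5 := hU.reducesTo (J := [(14, 16), (15, 17), (10, 12), (11, 13), (6, 9), (8, 7)]) (B := B)
    (k := 0) (T := [(0, 1), (2, 4), (3, 5)]) (by decide)
  have e6 := hU.reducesTo (J := [(14, 16), (15, 17), (10, 13), (12, 11), (6, 8), (7, 9)]) (B := B)
    (k := 1) (T := [(0, 5), (2, 4), (1, 3)]) (by decide)
  have e7 := hU.reducesTo (J := [(14, 17), (16, 15), (10, 12), (11, 13), (6, 8), (7, 9)]) (B := B)
    (k := 0) (T := [(0, 2), (4, 5), (1, 3)]) (by decide)
  have e8 := hU.reducesTo (J := [(14, 16), (15, 17), (10, 12), (11, 13), (6, 8), (7, 9)]) (B := B)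
    (k := 0) (T := [(0, 5), (2, 4), (1, 3)]) (by decide)
  simp only [B, List.cons_append, List.nil_append, List.map_cons, List.map_nil]
    at e1 e2 e3 e4 e5 e6 e7 e8
  simp only [Cross.apply, e1, e2, e3, e4, e5, e6, e7, e8, h₂]
  set X := F [(ι 0, ι 2, 0), (ι 4, ι 1, 0), (ι 3, ι 5, 0)]
  set Y := F [(ι 0, ι 5, 0), (ι 2, ι 4, 0), (ι 1, ι 3, 0)]
  set Z := F [(ι 0, ι 1, 0), (ι 2, ι 4, 0), (ι 3, ι 5, 0)]
  set W := F [(ι 0, ι 2, 0), (ι 4, ι 5, 0), (ι 1, ι 3, 0)]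
  linear_combination (-(α * Y * 2 + α * X + β * Z + β * W - (α * (α * β + 1) + β ^ 3) * Y)) * h₁

/-- The value of a crossing whose four arcs carry weights. -/
theorem Lawful.crossing (hF : Lawful f F N) (α β : R) (ι : Fin 8 → P) (hι : ι.Injective)
    (hN : ∀ q, 4 ≤ q → ι q ∉ N) (n₁ n₂ n₃ n₄ : ℤ) :
    Cross.apply ⟨α, β, ι 4, ι 5, ι 6, ι 7⟩ F
        [(ι 0, ι 4, n₁), (ι 5, ι 1, n₂), (ι 2, ι 6, n₃), (ι 7, ι 3, n₄)] =
      α * F [(ι 0, ι 3, n₁ + n₄), (ι 2, ι 1, n₃ + n₂)] +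
        β * F [(ι 0, ι 2, n₁ - n₃), (ι 1, ι 3, n₄ - n₂)] := by
  have hN4 := hN 4 (by decide)
  have hN5 := hN 5 (by decide)
  have hN6 := hN 6 (by decide)
  have hN7 := hN 7 (by decide)
  -- The oriented smoothing continues each strand in its direction, so weights are added (`m1`,
  -- `m2`). The other one turns back, so one of the two arcs is read against its direction and its
  -- weight is subtracted (`m3`, `m4`).
  have m1 := hF.merge (ι 0) (ι 4) (ι 7) (ι 3) n₁ n₄ [(ι 2, ι 6, n₃), (ι 6, ι 5, 0), (ι 5, ι 1, n₂)]
    (hι.ne (by decide)) hN4 hN7 (hι.ne (by decide)) (hι.ne (by decide)) (hι.ne (by decide))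
    (hι.ne (by decide)) (by simp [hι.eq_iff]) (by simp [hι.eq_iff])
  have m2 := hF.merge (ι 2) (ι 6) (ι 5) (ι 1) n₃ n₂ [(ι 0, ι 3, n₁ + n₄)]
    (hι.ne (by decide)) hN6 hN5 (hι.ne (by decide)) (hι.ne (by decide)) (hι.ne (by decide))
    (hι.ne (by decide)) (by simp [hι.eq_iff]) (by simp [hι.eq_iff])
  have m3 := hF.merge (ι 0) (ι 4) (ι 6) (ι 2) n₁ (-n₃) [(ι 1, ι 5, -n₂), (ι 5, ι 7, 0), (ι 7, ι 3, n₄)]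
    (hι.ne (by decide)) hN4 hN6 (hι.ne (by decide)) (hι.ne (by decide)) (hι.ne (by decide))
    (hι.ne (by decide)) (by simp [hι.eq_iff]) (by simp [hι.eq_iff])
  have m4 := hF.merge (ι 1) (ι 5) (ι 7) (ι 3) (-n₂) n₄ [(ι 0, ι 2, n₁ + -n₃)]
    (hι.ne (by decide)) hN5 hN7 (hι.ne (by decide)) (hι.ne (by decide)) (hι.ne (by decide))
    (hι.ne (by decide)) (by simp [hι.eq_iff]) (by simp [hι.eq_iff])
  simp only [Cross.apply]
  congr 2
  · conv_rhs => rw [hF.swap, ← m2]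
    refine Eq.trans (hF.perm ?_) (m1.trans (hF.perm ?_))
    · refine List.Perm.trans (l₂ := [(ι 0, ι 4, n₁), (ι 4, ι 7, 0), (ι 6, ι 5, 0), (ι 5, ι 1, n₂),
        (ι 2, ι 6, n₃), (ι 7, ι 3, n₄)]) ?_ ?_
      · exact ((List.Perm.swap _ _ _).cons _).trans (List.Perm.swap _ _ _)
      · refine List.Perm.cons _ (List.Perm.cons _ ?_)
        have : [(ι 6, ι 5, (0 : ℤ)), (ι 5, ι 1, n₂), (ι 2, ι 6, n₃), (ι 7, ι 3, n₄)].Perm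
            [(ι 2, ι 6, n₃), (ι 7, ι 3, n₄), (ι 6, ι 5, 0), (ι 5, ι 1, n₂)] :=
          List.perm_append_comm (l₁ := [_, _]) (l₂ := [_, _])
        exact this.trans (List.Perm.swap _ _ _)
    · exact List.perm_append_comm (l₁ := [_]) (l₂ := [_, _, _])
  · conv_rhs => rw [hF.swap]
    have e1 : n₁ - n₃ = n₁ + -n₃ := sub_eq_add_neg _ _
    have e2 : n₄ - n₂ = -n₂ + n₄ := by ring
    rw [e1, e2, ← m4]
    have q₁ : F [(ι 5, ι 7, 0), (ι 4, ι 6, 0), (ι 0, ι 4, n₁), (ι 5, ι 1, n₂), (ι 2, ι 6, n₃),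
        (ι 7, ι 3, n₄)] = F [(ι 5, ι 1, n₂), (ι 2, ι 6, n₃), (ι 0, ι 4, n₁), (ι 4, ι 6, 0),
        (ι 5, ι 7, 0), (ι 7, ι 3, n₄)] :=
      hF.perm (Multiset.coe_eq_coe.1 (by
        simp only [← Multiset.cons_coe, ← Multiset.singleton_add]; abel))
    have q₂ : F [(ι 1, ι 5, -n₂), (ι 2, ι 6, n₃), (ι 0, ι 4, n₁), (ι 4, ι 6, 0),
        (ι 5, ι 7, 0), (ι 7, ι 3, n₄)] = F [(ι 2, ι 6, n₃), (ι 0, ι 4, n₁), (ι 4, ι 6, 0),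
        (ι 1, ι 5, -n₂), (ι 5, ι 7, 0), (ι 7, ι 3, n₄)] :=
      hF.perm (Multiset.coe_eq_coe.1 (by
        simp only [← Multiset.cons_coe, ← Multiset.singleton_add]; abel))
    have q₃ : F [(ι 6, ι 2, -n₃), (ι 0, ι 4, n₁), (ι 4, ι 6, 0),
        (ι 1, ι 5, -n₂), (ι 5, ι 7, 0), (ι 7, ι 3, n₄)] = F [(ι 0, ι 4, n₁), (ι 4, ι 6, 0),
        (ι 6, ι 2, -n₃), (ι 1, ι 5, -n₂), (ι 5, ι 7, 0), (ι 7, ι 3, n₄)] :=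
      hF.perm (Multiset.coe_eq_coe.1 (by
        simp only [← Multiset.cons_coe, ← Multiset.singleton_add]; abel))
    rw [hF.swap, q₁, hF.flip, q₂, hF.flip, q₃, m3]
    exact hF.perm (List.perm_append_comm (l₁ := [_]) (l₂ := [_, _, _]))

end Local

/-! ### Cutting out the holes of a template -/

section Templates

variable {α : Type} {k : ℕ}

/-- The holes of a word with holes. -/
def wordHoles (w : List (α ⊕ Fin k)) : List (Fin k) := w.filterMap Sum.getRight?

/-- The letters of a word with holes. -/
def wordLetters (w : List (α ⊕ Fin k)) : List α := w.filterMap Sum.getLeft?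

/-- The holes of a template. -/
def holes (T : List (List (α ⊕ Fin k))) : List (Fin k) := wordHoles T.flatten

/-- The letters of a template. -/
def letters (T : List (List (α ⊕ Fin k))) : List α := wordLetters T.flatten

theorem mem_wordHoles {w : List (α ⊕ Fin k)} {i : Fin k} : i ∈ wordHoles w ↔ Sum.inr i ∈ w := by
  simp [wordHoles, List.mem_filterMap]

theorem mem_wordLetters {w : List (α ⊕ Fin k)} {l : α} : l ∈ wordLetters w ↔ Sum.inl l ∈ w := by
  simp [wordLetters, List.mem_filterMap]

theorem wordHoles_append (w w' : List (α ⊕ Fin k)) :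
    wordHoles (w ++ w') = wordHoles w ++ wordHoles w' := List.filterMap_append

theorem wordLetters_append (w w' : List (α ⊕ Fin k)) :
    wordLetters (w ++ w') = wordLetters w ++ wordLetters w' := List.filterMap_append

theorem holes_cons (w : List (α ⊕ Fin k)) (T : List (List (α ⊕ Fin k))) :
    holes (w :: T) = wordHoles w ++ holes T := by
  simp [holes, wordHoles_append]

theorem letters_cons (w : List (α ⊕ Fin k)) (T : List (List (α ⊕ Fin k))) :
    letters (w :: T) = wordLetters w ++ letters T := by
  simp [letters, wordLetters_append]

/-- Put words into the holes of a word. -/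
def fillWord (g : Fin k → List α) (w : List (α ⊕ Fin k)) : List α :=
  w.flatMap (Sum.elim (fun t => [t]) g)

theorem fillWord_congr {g g' : Fin k → List α} {w : List (α ⊕ Fin k)}
    (h : ∀ i ∈ wordHoles w, g i = g' i) : fillWord g w = fillWord g' w := by
  apply List.flatMap_congr
  rintro (t | i) ht
  · rfl
  · exact h i (mem_wordHoles.2 ht)

theorem mem_holes_of_mem {T : List (List (α ⊕ Fin k))} {w : List (α ⊕ Fin k)} (hw : w ∈ T)
    {i : Fin k} (hi : i ∈ wordHoles w) : i ∈ holes T :=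
  mem_wordHoles.2 (List.mem_flatten_of_mem hw (mem_wordHoles.1 hi))

theorem fillWord_perm (g : Fin k → List α) (w : List (α ⊕ Fin k)) :
    (fillWord g w).Perm (wordLetters w ++ (wordHoles w).flatMap g) := by
  induction w with
  | nil => exact List.Perm.nil
  | cons t w ih =>
    rcases t with t | i
    · exact ih.cons t
    · have e1 : fillWord g (Sum.inr i :: w) = g i ++ fillWord g w := rfl
      have e2 : wordLetters (Sum.inr i :: w) = wordLetters w := rfl
      have e3 : wordHoles (Sum.inr i :: w) = i :: wordHoles w := rfl
      rw [e1, e2, e3, List.flatMap_cons]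
      refine (ih.append_left _).trans ?_
      rw [← List.append_assoc, ← List.append_assoc]
      exact List.perm_append_comm.append_right _

theorem flatten_map_fillWord (g : Fin k → List α) (T : List (List (α ⊕ Fin k))) :
    (T.map (fillWord g)).flatten = fillWord g T.flatten := by
  simp only [fillWord, List.flatMap, List.map_flatten, List.flatten_flatten, List.map_map]
  rfl

end Templates

/-! ### Separating the contents of the holes from their surroundings -/

section Extract

variable {R : Type} [CommRing R] {f : ℕ → R} {k : ℕ}

/-- The word does not meet the points of the hole `i`. -/
def NoHole (i : ℕ) (w : List (Tok Pt)) : Prop := ∀ j, Pt.hole i j ∉ tokPts w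

theorem mem_tokPts_flatMap {α : Type*} {g : α → List (Tok Pt)} {w : List α} {p : Pt} :
    p ∈ tokPts (w.flatMap g) ↔ ∃ t ∈ w, p ∈ tokPts (g t) := by
  induction w with
  | nil => simp
  | cons t w ih => simp [ih]

/-- The strand is cut at both ends of `X`. The points 0 and 1 of the hole belong to the surroundings
and 2 and 3 to the contents; bonds of weight 0 connect them, as `concat` requires. -/
theorem Lawful.loopAt_extract {F : List (Bond Pt) → R} {N : Set Pt} (hF : Lawful f F N) (m i : ℕ)
    (U X V : List (Tok Pt)) (S : List (Bond Pt)) (hN : ∀ j, Pt.hole i j ∉ N) (hU : NoHole i U)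
    (hX : NoHole i X) (hV : NoHole i V) (hS : ∀ j, Pt.hole i j ∉ ends S) :
    F (loopAt m (U ++ (X ++ V)) ++ S) =
      F (arcs (.hole i 2) 0 X (.hole i 3) ++ ((.hole i 0, .hole i 2, 0) ::
        (.hole i 3, .hole i 1, 0) ::
          (loopAt m (U ++ .pass (.hole i 0) (.hole i 1) :: V) ++ S))) := by
  set C : List (Bond Pt) := (.base m false, .base m true, 0) :: S with hC
  have hCe : ∀ j, Pt.hole i j ∉ ends C := fun j => by simp [hC, hS]
  have hXV : NoHole i (X ++ V) := fun j => by
    rw [tokPts_append, List.mem_append, not_or]; exact ⟨hX j, hV j⟩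
  have e1 := hF.concat (x := .base m true) (y := .hole i 0) (z := .hole i 2) (w := .base m false) 0
    U (X ++ V) C (by simp) (hN _) (hN _) (by simp) (by simp) (by simp) (by simp) (hU _) (hU _)
    (hXV _) (hXV _) (hCe _) (hCe _)
  set D : List (Bond Pt) := arcs (.base m true) 0 U (.hole i 0) ++ [(.hole i 0, .hole i 2, 0)]
    with hD
  have hDe : ∀ j, j ≠ 0 → j ≠ 2 → Pt.hole i j ∉ ends D := fun j h1 h2 => by
    have := hU j
    simp [hD, mem_ends_arcs, h1, h2, this]
  have e2 := (hF.prepend D).concat (x := .hole i 2) (y := .hole i 3) (z := .hole i 1)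
    (w := .base m false) 0 X V C (by simp)
    (by rintro (h | h); exacts [hN _ h, hDe 3 (by simp) (by simp) h])
    (by rintro (h | h); exacts [hN _ h, hDe 1 (by simp) (by simp) h])
    (by simp) (by simp) (by simp) (by simp) (hX _) (hX _) (hV _) (hV _) (hCe _) (hCe _)
  have e0 : loopAt m (U ++ (X ++ V)) ++ S =
      arcs (.base m true) 0 (U ++ (X ++ V)) (.base m false) ++ C := by
    simp [loopAt, hC]
  rw [e0, ← e1]
  have e3 : arcs (.base m true) 0 U (.hole i 0) ++ (Pt.hole i 0, Pt.hole i 2, (0 : ℤ)) ::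
      (arcs (.hole i 2) 0 (X ++ V) (.base m false) ++ C) =
      D ++ (arcs (.hole i 2) 0 (X ++ V) (.base m false) ++ C) := by
    simp [hD]
  rw [e3, ← e2]
  apply hF.perm
  apply Multiset.coe_eq_coe.1
  simp only [hD, hC, loopAt, arcs_append_pass, ← Multiset.coe_add, ← Multiset.cons_coe,
    ← Multiset.singleton_add, Multiset.coe_nil, add_zero]
  abel

/-- Put words into the holes of a template. -/
def fillT (T : List (List (Tok Pt ⊕ Fin k))) (g : Fin k → List (Tok Pt)) : List (List (Tok Pt)) :=
  T.map (fillWord g)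

/-- The word that passes through the hole. -/
def holeTok (i : Fin k) : List (Tok Pt) := [.pass (.hole i 0) (.hole i 1)]

theorem noHole_fillWord {i : Fin k} {g : Fin k → List (Tok Pt)} {w : List (Tok Pt ⊕ Fin k)}
    (hT : ∀ t, Sum.inl t ∈ w → NoHole i [t]) (hg : ∀ j ∈ wordHoles w, NoHole i (g j)) :
    NoHole i (fillWord g w) := by
  intro j hj
  obtain ⟨t | i', ht, hp⟩ := mem_tokPts_flatMap.1 hj
  · exact hT t ht j hp
  · exact hg i' (mem_wordHoles.2 ht) j hp

/-- The hole occurs once, so only one component has to be cut; the components before it are absorbed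
into the function. -/
theorem Lawful.extract_one {i : Fin k} (g : Fin k → List (Tok Pt))
    (T : List (List (Tok Pt ⊕ Fin k))) (hnd : (holes T).Nodup) (hi : i ∈ holes T)
    (hT : ∀ t, Sum.inl t ∈ T.flatten → NoHole i [t]) (hg : ∀ j, NoHole i (g j))
    {F : List (Bond Pt) → R} {N : Set Pt} (hF : Lawful f F N)
    (hN : ∀ j, Pt.hole i j ∉ N) (m : ℕ) :
    F (sys m (fillT T g)) = F (arcs (.hole i 2) 0 (g i) (.hole i 3) ++
      ((.hole i 0, .hole i 2, 0) :: (.hole i 3, .hole i 1, 0) ::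
        sys m (fillT T (Function.update g i (holeTok i))))) := by
  induction T generalizing F N m with
  | nil => simp [holes, wordHoles] at hi
  | cons w T ih =>
    rw [holes_cons, List.nodup_append] at hnd
    have hTw : ∀ t, Sum.inl t ∈ w → NoHole i [t] := fun t ht => hT t (by simp [ht])
    have hTT : ∀ t, Sum.inl t ∈ T.flatten → NoHole i [t] := fun t ht => hT t (by
      rw [List.flatten_cons, List.mem_append]; exact Or.inr ht)
    have hne : ∀ j, j ≠ i → Function.update g i (holeTok i) j = g j := fun j hj =>
      Function.update_of_ne hj _ _
    by_cases hiw : i ∈ wordHoles w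
    · have hiT : i ∉ holes T := fun h => hnd.2.2 i hiw i h rfl
      obtain ⟨u, v, rfl⟩ := List.append_of_mem (mem_wordHoles.1 hiw)
      have hwh : wordHoles (u ++ Sum.inr i :: v) = wordHoles u ++ i :: wordHoles v := by
        rw [wordHoles_append]; rfl
      rw [hwh] at hnd
      have hnd1 := hnd.1
      rw [List.nodup_append] at hnd1
      have hiu : i ∉ wordHoles u := fun h => hnd1.2.2 i h i (by simp) rfl
      have hiv : i ∉ wordHoles v := (List.nodup_cons.1 hnd1.2.1).1
      have eu : fillWord (Function.update g i (holeTok i)) u = fillWord g u :=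
        fillWord_congr fun j hj => hne j fun e => hiu (e ▸ hj)
      have ev : fillWord (Function.update g i (holeTok i)) v = fillWord g v :=
        fillWord_congr fun j hj => hne j fun e => hiv (e ▸ hj)
      have eT : fillT T (Function.update g i (holeTok i)) = fillT T g := by
        apply List.map_congr_left
        intro w hw
        exact fillWord_congr fun j hj => hne j fun e => hiT (e ▸ mem_holes_of_mem hw hj)
      have e1 : ∀ g : Fin k → List (Tok Pt), fillT ((u ++ Sum.inr i :: v) :: T) g =
          (fillWord g u ++ (g i ++ fillWord g v)) :: fillT T g := by
        intro g; simp [fillT, fillWord]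
      rw [e1, e1, eu, ev, eT, Function.update_self, sys_cons, sys_cons]
      refine hF.loopAt_extract m i _ _ _ _ hN ?_ (hg i) ?_ ?_
      · exact noHole_fillWord (fun t ht => hTw t (by simp [ht])) fun j _ => hg j
      · exact noHole_fillWord (fun t ht => hTw t (by simp [ht])) fun j _ => hg j
      · intro j hj
        rcases mem_ends_sys hj with ⟨_, _, _, _, h⟩ | ⟨w', hw', h⟩
        · cases h
        · obtain ⟨w'', hw'', rfl⟩ := List.mem_map.1 hw'
          exact noHole_fillWord (fun t ht => hTT t (List.mem_flatten_of_mem hw'' ht))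
            (fun j _ => hg j) j h
    · have hiT : i ∈ holes T := by
        rw [holes_cons, List.mem_append] at hi
        exact hi.resolve_left hiw
      have ew : fillWord (Function.update g i (holeTok i)) w = fillWord g w :=
        fillWord_congr fun j hj => hne j fun e => hiw (e ▸ hj)
      have e1 : ∀ g : Fin k → List (Tok Pt), fillT (w :: T) g = fillWord g w :: fillT T g :=
        fun g => rfl
      have hw : NoHole i (fillWord g w) := noHole_fillWord hTw fun j _ => hg j
      have := ih hnd.2.1 hiT hTT (hF.prepend (loopAt m (fillWord g w)))
        (by
          rintro j (h | h)
          · exact hN j h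
          · rw [Set.mem_ofPred_eq, mem_ends_loopAt] at h
            rcases h with h | h | h
            · cases h
            · cases h
            · exact hw j h) (m + 1)
      rw [e1, e1, ew, sys_cons, sys_cons]
      refine Eq.trans this (hF.perm ?_)
      apply Multiset.coe_eq_coe.1
      simp only [← Multiset.coe_add, ← Multiset.cons_coe, ← Multiset.singleton_add]
      abel

/-- The arcs through the holes. -/
def holeArcs (hs : List (Fin k)) (g : Fin k → List (Tok Pt)) : List (Bond Pt) :=
  hs.flatMap fun i : Fin k => arcs (.hole i 2) 0 (g i) (.hole i 3)

/-- The part of a system outside the holes. -/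
def frame (T : List (List (Tok Pt ⊕ Fin k))) (hs : List (Fin k)) : List (Bond Pt) :=
  (hs.flatMap fun i : Fin k => [(.hole i 0, .hole i 2, 0), (.hole i 3, .hole i 1, 0)]) ++
    sys 0 (fillT T holeTok)

theorem Lawful.extract {T : List (List (Tok Pt ⊕ Fin k))} {hs : List (Fin k)}
    (g : Fin k → List (Tok Pt)) (hperm : hs.Perm (holes T)) (hnd : hs.Nodup)
    (hT : ∀ i : Fin k, ∀ t, Sum.inl t ∈ T.flatten → NoHole i [t])
    (hg : ∀ i j : Fin k, NoHole i (g j)) {F : List (Bond Pt) → R} {N : Set Pt} (hF : Lawful f F N)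
    (hN : ∀ i j, Pt.hole i j ∉ N) :
    F (sys 0 (fillT T g)) = F (holeArcs hs g ++ frame T hs) := by
  -- The function is generalized because the arcs of the holes already extracted become part of its
  -- surroundings.
  have key : ∀ (hs : List (Fin k)) (g : Fin k → List (Tok Pt)) (F : List (Bond Pt) → R) (N : Set Pt),
      hs.Nodup → (∀ i ∈ hs, i ∈ holes T) → (∀ i ∈ hs, ∀ j, NoHole i (g j)) → Lawful f F N →
      (∀ i ∈ hs, ∀ j, Pt.hole i j ∉ N) →
      F (sys 0 (fillT T g)) = F (holeArcs hs g ++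
        ((hs.flatMap fun i : Fin k => [(Pt.hole i 0, Pt.hole i 2, (0 : ℤ)), (Pt.hole i 3, Pt.hole i 1, 0)]) ++
          sys 0 (fillT T fun i => if i ∈ hs then holeTok i else g i))) := by
    have hTnd := hperm.nodup_iff.1 hnd
    intro hs
    induction hs with
    | nil => intro g F N _ _ _ _ _; simp [holeArcs]
    | cons i hs ih =>
      intro g F N hnd hsub hg hF hN
      rw [List.nodup_cons] at hnd
      rw [hF.extract_one g T hTnd (hsub i List.mem_cons_self) (hT i)
        (hg i List.mem_cons_self) (hN i List.mem_cons_self) 0]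
      set D : List (Bond Pt) := arcs (.hole i 2) 0 (g i) (.hole i 3) ++
        [(.hole i 0, .hole i 2, 0), (.hole i 3, .hole i 1, 0)] with hD
      have hne : ∀ i' ∈ hs, (i' : ℕ) ≠ i := fun i' hi' e => hnd.1 (Fin.ext e ▸ hi')
      have h2 := ih (Function.update g i (holeTok i)) (fun B => F (D ++ B)) _ hnd.2
        (fun i' hi' => hsub i' (List.mem_cons_of_mem _ hi'))
        (fun i' hi' j => by
          by_cases hj : j = i
          · subst hj
            intro n
            have := hne i' hi'
            simp [holeTok, this]
          · rw [Function.update_of_ne hj]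
            exact hg i' (List.mem_cons_of_mem _ hi') j)
        (hF.prepend D)
        (fun i' hi' j => by
          rintro (h | h)
          · exact hN i' (List.mem_cons_of_mem _ hi') j h
          · have h1 := hg i' (List.mem_cons_of_mem _ hi') i j
            have := hne i' hi'
            simp [hD, mem_ends_arcs, this, h1] at h)
      have e1 : arcs (.hole i 2) 0 (g i) (.hole i 3) ++
          ((Pt.hole i 0, Pt.hole i 2, (0 : ℤ)) :: (Pt.hole i 3, Pt.hole i 1, 0) ::
            sys 0 (fillT T (Function.update g i (holeTok i)))) =
          D ++ sys 0 (fillT T (Function.update g i (holeTok i))) := by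
        simp [hD]
      rw [e1, h2]
      have e2 : holeArcs hs (Function.update g i (holeTok i)) = holeArcs hs g := by
        apply List.flatMap_congr
        intro j hj
        rw [Function.update_of_ne (fun e : j = i => hnd.1 (e ▸ hj))]
      have e3 : (fun j => if j ∈ hs then holeTok j else Function.update g i (holeTok i) j) =
          fun j => if j ∈ i :: hs then holeTok j else g j := by
        funext j
        by_cases hj : j = i
        · subst hj; simp
        · simp [hj]
      rw [e2, e3]
      apply hF.perm
      apply Multiset.coe_eq_coe.1
      simp only [hD, holeArcs, List.flatMap_cons, ← Multiset.coe_add, ← Multiset.cons_coe,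
        ← Multiset.singleton_add, Multiset.coe_nil, add_zero]
      abel
  rw [key hs g F N hnd (fun i hi => hperm.mem_iff.1 hi) (fun i _ => hg i) hF fun i _ => hN i]
  have : fillT T (fun i => if i ∈ hs then holeTok i else g i) = fillT T holeTok := by
    apply List.map_congr_left
    intro w hw
    exact fillWord_congr fun j hj => if_pos (hperm.mem_iff.2 (mem_holes_of_mem hw hj))
  rw [this, frame]

theorem mem_ends_frame {T : List (List (Tok Pt ⊕ Fin k))} {hs : List (Fin k)} {p : Pt}
    (h : p ∈ ends (frame T hs)) : (∃ i b, p = .base i b) ∨ (∃ i j, p = .hole i j) ∨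
      ∃ t, Sum.inl t ∈ T.flatten ∧ p ∈ tokPts [t] := by
  rw [frame, ends_append, List.mem_append] at h
  rcases h with h | h
  · obtain ⟨y, n, h⟩ := mem_ends.1 h
    simp only [List.mem_flatMap, List.mem_cons, List.not_mem_nil, or_false, Prod.mk.injEq] at h
    right; left
    rcases h with ⟨i, -, ⟨rfl, -⟩ | ⟨rfl, -⟩⟩ | ⟨i, -, ⟨-, rfl, -⟩ | ⟨-, rfl, -⟩⟩ <;>
      exact ⟨_, _, rfl⟩
  · rcases mem_ends_sys h with ⟨i, b, -, -, h⟩ | ⟨w, hw, hp⟩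
    · exact Or.inl ⟨i, b, h⟩
    · obtain ⟨w', hw', rfl⟩ := List.mem_map.1 hw
      obtain ⟨t | i, ht, hp⟩ := mem_tokPts_flatMap.1 hp
      · exact Or.inr (Or.inr ⟨t, List.mem_flatten_of_mem hw' ht, hp⟩)
      · simp only [Sum.elim_inr, holeTok, tokPts_pass, tokPts_nil, List.mem_cons,
          List.not_mem_nil, or_false] at hp
        right; left
        rcases hp with rfl | rfl <;> exact ⟨_, _, rfl⟩

end Extract

/-! ### Reading letters as tokens -/

section Letters

variable {R : Type} [CommRing R] {f : ℕ → R} {k : ℕ}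

/-- The system of closed strands of a code, when the letters are read as words of tokens. -/
def codeSys (τ : Letter → List (Tok Pt)) (G : Code) : List (Bond Pt) :=
  sys 0 (G.map fun w => w.flatMap τ)

/-- The points of the tokens of a letter belong to its crossing. -/
def Labelled (τ : Letter → List (Tok Pt)) : Prop :=
  ∀ l, ∀ p ∈ tokPts (τ l), ∃ o b, p = .cr l.label o b

/-- The template of tokens that belongs to a template of letters, with weights around the holes. -/
def tokTemplate (τ : Letter → List (Tok Pt)) (u v : Fin k → ℤ) (T : Template k) :
    List (List (Tok Pt ⊕ Fin k)) :=
  T.map fun w => w.flatMap (Sum.elim (fun l => (τ l).map Sum.inl)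
    fun i => [Sum.inl (.wt (u i)), Sum.inr i, Sum.inl (.wt (v i))])

theorem fill_eq (T : Template k) (g : Fin k → List Letter) : T.fill g = T.map (fillWord g) := rfl

theorem fill_flatten_perm (T : Template k) (g : Fin k → List Letter) :
    (T.fill g).flatten.Perm (letters T ++ (holes T).flatMap g) := by
  rw [fill_eq, flatten_map_fillWord]
  exact fillWord_perm g _

theorem holes_tokTemplate (τ : Letter → List (Tok Pt)) (u v : Fin k → ℤ) (T : Template k) :
    holes (tokTemplate τ u v T) = holes T := by
  have key : ∀ w : List (Letter ⊕ Fin k), wordHoles (w.flatMap (Sum.elim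
      (fun l => (τ l).map Sum.inl) fun i => [Sum.inl (Tok.wt (u i)), Sum.inr i, Sum.inl (.wt (v i))]))
      = wordHoles w := by
    intro w
    induction w with
    | nil => rfl
    | cons t w ih =>
      rw [List.flatMap_cons, wordHoles_append, ih]
      rcases t with l | i
      · have h1 : wordHoles (k := k) ((τ l).map (Sum.inl (α := Tok Pt) (β := Fin k))) = [] := by
          rw [wordHoles, List.filterMap_map, List.filterMap_eq_nil_iff]
          intro _ _; rfl
        rw [Sum.elim_inl, h1]
        rfl
      · rfl
  induction T with
  | nil => rfl
  | cons w T ih =>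
    rw [holes_cons, ← ih, ← key w]
    exact holes_cons _ _

theorem mem_tokTemplate {τ : Letter → List (Tok Pt)} {u v : Fin k → ℤ} {T : Template k} {t : Tok Pt}
    (h : Sum.inl t ∈ (tokTemplate τ u v T).flatten) :
    (∃ n, t = .wt n) ∨ ∃ l ∈ letters T, t ∈ τ l := by
  obtain ⟨w', hw', ht⟩ := List.mem_flatten.1 h
  obtain ⟨w, hw, rfl⟩ := List.mem_map.1 hw'
  obtain ⟨l | i, hl, ht⟩ := List.mem_flatMap.1 ht
  · right
    refine ⟨l, mem_wordLetters.2 (List.mem_flatten_of_mem hw hl), ?_⟩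
    simpa using ht
  · left
    simp only [Sum.elim_inr, List.mem_cons, List.not_mem_nil, or_false] at ht
    rcases ht with h | h | h
    · exact ⟨_, Sum.inl_injective h⟩
    · cases h
    · exact ⟨_, Sum.inl_injective h⟩

theorem mem_tokPts_of_mem {t : Tok Pt} {w : List (Tok Pt)} (h : t ∈ w) {p : Pt}
    (hp : p ∈ tokPts [t]) : p ∈ tokPts w := by
  obtain ⟨u, v, rfl⟩ := List.append_of_mem h
  have : u ++ t :: v = u ++ ([t] ++ v) := by simp
  rw [this, tokPts_append, tokPts_append]
  simp [hp]

theorem tokTemplate_congr {τ τ' : Letter → List (Tok Pt)} {u v : Fin k → ℤ} {T : Template k}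
    (h : ∀ l ∈ letters T, τ l = τ' l) : tokTemplate τ u v T = tokTemplate τ' u v T := by
  apply List.map_congr_left
  intro w hw
  apply List.flatMap_congr
  rintro (l | i) hl
  · simp only [Sum.elim_inl]
    rw [h l (mem_wordLetters.2 (List.mem_flatten_of_mem hw hl))]
  · rfl

/-- The contents of a hole matter only up to `TokEq`. The weights `u` and `v` at its two ends are
assigned to the surroundings, so that two sides of a move that agree in these weights have the same
frame. -/
theorem codeSys_fill {τ : Letter → List (Tok Pt)} {u v : Fin k → ℤ} {T : Template k}
    {g : Fin k → List Letter} {X : Fin k → List (Tok Pt)}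
    (h : ∀ i ∈ holes T, TokEq ((g i).flatMap τ) (.wt (u i) :: (X i ++ [.wt (v i)]))) :
    codeSys τ (T.fill g) = sys 0 (fillT (tokTemplate τ u v T) X) := by
  unfold codeSys fillT tokTemplate
  rw [fill_eq, List.map_map, List.map_map]
  refine sys_congr 0 T _ _ fun w hw => ?_
  simp only [Function.comp, fillWord, List.flatMap_assoc]
  refine TokEq.flatMap w ?_
  rintro (l | i) hl
  · simp only [Sum.elim_inl, List.flatMap_cons, List.flatMap_nil, List.append_nil,
      List.flatMap_map]
    rw [List.flatMap_singleton']
    exact TokEq.refl _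
  · simp only [Sum.elim_inr, List.flatMap_cons, List.flatMap_nil, List.append_nil, Sum.elim_inl]
    exact h i (mem_holes_of_mem hw (mem_wordHoles.2 hl))

theorem codeSys_fill_congr {τ τ' : Letter → List (Tok Pt)} {T : Template k}
    {g g' : Fin k → List Letter} (h : ∀ l ∈ letters T, τ l = τ' l)
    (h' : ∀ i ∈ holes T, TokEq ((g i).flatMap τ) ((g' i).flatMap τ')) :
    codeSys τ (T.fill g) = codeSys τ' (T.fill g') := by
  unfold codeSys
  rw [fill_eq, fill_eq, List.map_map, List.map_map]
  refine sys_congr 0 T _ _ fun w hw => ?_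
  simp only [Function.comp, fillWord, List.flatMap_assoc]
  refine TokEq.flatMap w ?_
  rintro (l | i) hl
  · simp only [Sum.elim_inl, List.flatMap_cons, List.flatMap_nil, List.append_nil]
    rw [h l (mem_wordLetters.2 (List.mem_flatten_of_mem hw hl))]
    exact TokEq.refl _
  · exact h' i (mem_holes_of_mem hw (mem_wordHoles.2 hl))

/-- The part of the system of a code outside the holes of a template. -/
def codeFrame (τ : Letter → List (Tok Pt)) (u v : Fin k → ℤ) (T : Template k) (hs : List (Fin k)) :
    List (Bond Pt) :=
  frame (tokTemplate τ u v T) hs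

theorem mem_ends_codeFrame {τ : Letter → List (Tok Pt)} (hτ : Labelled τ) {u v : Fin k → ℤ}
    {T : Template k} {hs : List (Fin k)} {c : ℕ} {o b : Bool} (hc : ∀ l ∈ letters T, l.label ≠ c) :
    Pt.cr c o b ∉ ends (codeFrame τ u v T hs) := by
  intro h
  rcases mem_ends_frame h with ⟨_, _, h⟩ | ⟨_, _, h⟩ | ⟨t, ht, hp⟩
  · cases h
  · cases h
  · rcases mem_tokTemplate ht with ⟨n, rfl⟩ | ⟨l, hl, ht⟩
    · simp at hp
    · obtain ⟨o', b', h⟩ := hτ l _ (mem_tokPts_of_mem ht hp)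
      cases h
      exact hc l hl rfl

theorem Lawful.codeSys_extract {F : List (Bond Pt) → R} {N : Set Pt} (hF : Lawful f F N)
    (hN : ∀ i j, Pt.hole i j ∉ N) {τ : Letter → List (Tok Pt)} (hτ : Labelled τ)
    {u v : Fin k → ℤ} {T : Template k} {hs : List (Fin k)} (hperm : hs.Perm (holes T))
    (hnd : hs.Nodup) {g : Fin k → List Letter} {X : Fin k → List (Tok Pt)}
    (hX : ∀ i j : Fin k, NoHole i (X j))
    (h : ∀ i ∈ holes T, TokEq ((g i).flatMap τ) (.wt (u i) :: (X i ++ [.wt (v i)]))) :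
    F (codeSys τ (T.fill g)) = F (holeArcs hs X ++ codeFrame τ u v T hs) := by
  rw [codeSys_fill h]
  refine hF.extract X (hperm.trans (by rw [holes_tokTemplate])) hnd (fun i t ht j hj => ?_) hX hN
  rcases mem_tokTemplate ht with ⟨n, rfl⟩ | ⟨l, hl, ht⟩
  · simp at hj
  · obtain ⟨o', b', h⟩ := hτ l _ (mem_tokPts_of_mem ht hj)
    cases h

end Letters

/-! ### Local moves of codes -/

section Moves

variable {R : Type} [CommRing R] {f : ℕ → R} {A : ℤˣ → R} {k : ℕ}

/-- The sign of a crossing after the over-strand (`x`) and the under-strand (`y`) are reversed. -/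
def revSign (s : ℤˣ) (x y : Bool) : ℤˣ := if x = y then s else -s

/-- The crossing `c` of sign `s`, with its over-strand (`x`) and its under-strand (`y`) reversed. -/
def crossAt (A : ℤˣ → R) (c : ℕ) (s : ℤˣ) (x y : Bool) : Cross Pt R :=
  ⟨A (revSign s x y), A (-revSign s x y), .cr c true x, .cr c true !x, .cr c false y,
    .cr c false !y⟩

/-- The passage through the crossing `c` as the over-strand or as the under-strand. -/
def passTok (c : ℕ) (o : Bool) : Tok Pt := .pass (.cr c o false) (.cr c o true)

/-- The sum over all states of the crossings with the given names and signs. -/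
noncomputable def crossingSum (A : ℤˣ → R) (f : ℕ → R) (Cs : List (ℕ × ℤˣ)) :
    List (Bond Pt) → R :=
  stateSum f (Cs.map fun x => crossAt A x.1 x.2 false false)

/-- The ends of the crossings with the given names. -/
def crossingPts (Cs : List (ℕ × ℤˣ)) : Set Pt := {p | ∃ x ∈ Cs, ∃ o b, p = .cr x.1 o b}

theorem lawful_crossingSum (A : ℤˣ → R) (f : ℕ → R) (Cs : List (ℕ × ℤˣ)) :
    Lawful f (crossingSum A f Cs) (crossingPts Cs) := by
  refine (lawful_stateSum f _).mono ?_
  rintro p ⟨y, hy, hp⟩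
  obtain ⟨x, hx, rfl⟩ := List.mem_map.1 hy
  refine ⟨x, hx, ?_⟩
  simp only [crossAt, Cross.pts, Set.mem_insert_iff, Set.mem_singleton_iff] at hp
  rcases hp with rfl | rfl | rfl | rfl <;> exact ⟨_, _, rfl⟩

theorem crossingSum_perm (A : ℤˣ → R) (f : ℕ → R) {Cs Cs' : List (ℕ × ℤˣ)} (h : Cs.Perm Cs') :
    crossingSum A f Cs = crossingSum A f Cs' := stateSum_perm f (h.map _)

theorem crossingSum_cons (A : ℤˣ → R) (f : ℕ → R) (c : ℕ) (s : ℤˣ) (Cs : List (ℕ × ℤˣ)) :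
    crossingSum A f ((c, s) :: Cs) =
      (crossAt A c s false false).apply (crossingSum A f Cs) := rfl

variable {F : List (Bond Pt) → R} {N : Set Pt}

/-- Both strands of a crossing may be read in either direction. Reversing exactly one of them
changes the sign of the crossing, reversing both does not. -/
theorem Lawful.crossAt_apply (hF : Lawful f F N) (A : ℤˣ → R) (c : ℕ) (s : ℤˣ) (x y : Bool) :
    (crossAt A c s false false).apply F = (crossAt A c s x y).apply F := by
  funext B
  have h1 : (crossAt A c s true false) = (crossAt A c s false false).flipOver := by
    simp [crossAt, Cross.flipOver, revSign]
  have h2 : (crossAt A c s false true) = (crossAt A c s false false).flipUnder := by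
    simp [crossAt, Cross.flipUnder, revSign]
  have h3 : (crossAt A c s true true) = (crossAt A c s true false).flipUnder := by
    simp [crossAt, Cross.flipUnder, revSign]
  cases x <;> cases y
  · rfl
  · rw [h2, Cross.apply_flipUnder hF]
  · rw [h1, Cross.apply_flipOver hF]
  · rw [h3, Cross.apply_flipUnder hF, h1, Cross.apply_flipOver hF]

/-- A strand through two crossings, read in either direction. -/
theorem Lawful.strand (hF : Lawful f F N) (x : Bool) (i c d : ℕ) (o o' : Bool)
    (C : List (Bond Pt)) :
    F (arcs (.hole i 2) 0 (cond x [passTok d o', passTok c o] [passTok c o, passTok d o'])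
        (.hole i 3) ++ C) =
      F ((.hole i (cond x 3 2), .cr c o x, 0) :: (.cr c o !x, .cr d o' x, 0) ::
        (.cr d o' !x, .hole i (cond x 2 3), 0) :: C) := by
  cases x
  · rfl
  · simp only [cond_true, passTok, arcs_pass, arcs_nil, List.cons_append, List.nil_append,
      Bool.not_true]
    have e : ∀ a b c : Bond Pt, F (a :: b :: c :: C) = F (c :: b :: a :: C) := fun a b c =>
      hF.perm (Multiset.coe_eq_coe.1 (by
        simp only [← Multiset.cons_coe, ← Multiset.singleton_add]; abel))
    rw [hF.flip_zero, hF.swap, hF.flip_zero, hF.swap, e, hF.flip_zero]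

theorem triangle_injective {c d e : ℕ} (hcd : c ≠ d) (hce : c ≠ e) (hde : d ≠ e) (x y z : Bool) :
    Function.Injective (![.hole 0 (cond x 3 2), .hole 0 (cond x 2 3), .hole 1 (cond y 3 2),
      .hole 1 (cond y 2 3), .hole 2 (cond z 3 2), .hole 2 (cond z 2 3), .cr c true x,
      .cr c true !x, .cr c false y, .cr c false !y, .cr d true x, .cr d true !x, .cr d false z,
      .cr d false !z, .cr e true y, .cr e true !y, .cr e false z, .cr e false !z] :
      Fin 18 → Pt) := by
  rw [← List.nodup_ofFn]
  cases x <;> cases y <;> cases z <;> simp [hcd, hce, hde]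

theorem bigon_injective {c d : ℕ} (hcd : c ≠ d) (y : Bool) :
    Function.Injective (![.hole 0 2, .hole 0 3, .hole 1 (cond y 3 2), .hole 1 (cond y 2 3),
      .cr c true false, .cr c true true, .cr c false y, .cr c false !y, .cr d true false,
      .cr d true true, .cr d false y, .cr d false !y] : Fin 12 → Pt) := by
  rw [← List.nodup_ofFn]
  cases y <;> simp [hcd]

/-- Each strand is read in the direction in which it meets its crossings in the standard order. By
`h₁` and `h₂` all three crossings then have one common sign, so a single computation, `triangle`,
covers all oriented third moves. -/
theorem Lawful.triangle_strands (hF : Lawful f F N) (hA : A 1 * A (-1) = 1)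
    (h0 : f 0 = -A 1 ^ 2 - A (-1) ^ 2) {c d e : ℕ} (hcd : c ≠ d) (hce : c ≠ e) (hde : d ≠ e)
    (hc : ∀ o b, Pt.cr c o b ∉ N) (hd : ∀ o b, Pt.cr d o b ∉ N) (he : ∀ o b, Pt.cr e o b ∉ N)
    {a b s : ℤˣ} {x y z : Bool} (h₁ : revSign a x y = revSign b x z)
    (h₂ : revSign b x z = revSign s y z) (w₁ w₂ w₃ w₁' w₂' w₃' : List (Tok Pt))
    (e₁ : w₁ = cond x [passTok d true, passTok c true] [passTok c true, passTok d true])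
    (e₂ : w₂ = cond y [passTok e true, passTok c false] [passTok c false, passTok e true])
    (e₃ : w₃ = cond z [passTok e false, passTok d false] [passTok d false, passTok e false])
    (e₁' : w₁' = cond x [passTok c true, passTok d true] [passTok d true, passTok c true])
    (e₂' : w₂' = cond y [passTok c false, passTok e true] [passTok e true, passTok c false])
    (e₃' : w₃' = cond z [passTok d false, passTok e false] [passTok e false, passTok d false]) :
    (crossAt A c a false false).apply ((crossAt A d b false false).apply
        ((crossAt A e s false false).apply F))
      (arcs (.hole 0 2) 0 w₁ (.hole 0 3) ++ (arcs (.hole 1 2) 0 w₂ (.hole 1 3) ++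
        (arcs (.hole 2 2) 0 w₃ (.hole 2 3) ++ []))) =
    (crossAt A c a false false).apply ((crossAt A d b false false).apply
        ((crossAt A e s false false).apply F))
      (arcs (.hole 0 2) 0 w₁' (.hole 0 3) ++ (arcs (.hole 1 2) 0 w₂' (.hole 1 3) ++
        (arcs (.hole 2 2) 0 w₃' (.hole 2 3) ++ []))) := by
  subst e₁ e₂ e₃ e₁' e₂' e₃'
  have l1 := hF.cross (crossAt A e s y z)
  have l2 := l1.cross (crossAt A d b x z)
  rw [hF.crossAt_apply A e s y z, l1.crossAt_apply A d b x z, l2.crossAt_apply A c a x y]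
  set G := (crossAt A c a x y).apply ((crossAt A d b x z).apply ((crossAt A e s y z).apply F))
    with hG
  have l3 : Lawful f G _ := l2.cross (crossAt A c a x y)
  -- Both sides have strands of the same shape, differing only in which crossing comes first; one
  -- statement straightens all three.
  have key : ∀ (c c' d d' e e' : ℕ) (o₁ o₂ o₃ o₄ o₅ o₆ : Bool),
      G (arcs (.hole 0 2) 0 (cond x [passTok c' o₂, passTok c o₁] [passTok c o₁, passTok c' o₂])
          (.hole 0 3) ++
        (arcs (.hole 1 2) 0 (cond y [passTok d' o₄, passTok d o₃] [passTok d o₃, passTok d' o₄])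
          (.hole 1 3) ++
        (arcs (.hole 2 2) 0 (cond z [passTok e' o₆, passTok e o₅] [passTok e o₅, passTok e' o₆])
          (.hole 2 3) ++ []))) =
      G [(.hole 0 (cond x 3 2), .cr c o₁ x, 0), (.cr c o₁ !x, .cr c' o₂ x, 0),
        (.cr c' o₂ !x, .hole 0 (cond x 2 3), 0),
        (.hole 1 (cond y 3 2), .cr d o₃ y, 0), (.cr d o₃ !y, .cr d' o₄ y, 0),
        (.cr d' o₄ !y, .hole 1 (cond y 2 3), 0),
        (.hole 2 (cond z 3 2), .cr e o₅ z, 0), (.cr e o₅ !z, .cr e' o₆ z, 0),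
        (.cr e' o₆ !z, .hole 2 (cond z 2 3), 0)] := by
    intro c c' d d' e e' o₁ o₂ o₃ o₄ o₅ o₆
    exact (l3.strand x 0 c c' o₁ o₂ _).trans (((l3.prepend [_, _, _]).strand y 1 d d' o₃ o₄ _).trans
      ((l3.prepend [_, _, _, _, _, _]).strand z 2 e e' o₅ o₆ []))
  rw [key, key]
  set σ := revSign a x y with hσ
  have hα : A σ * A (-σ) = 1 := by
    rcases Int.units_eq_one_or σ with h | h <;> rw [h]
    · exact hA
    · rw [neg_neg, mul_comm]; exact hA
  have hβ : f 0 = -A σ ^ 2 - A (-σ) ^ 2 := by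
    rcases Int.units_eq_one_or σ with h | h <;> rw [h, h0]
    rw [neg_neg]; ring
  have := hF.triangle hα hβ _ (triangle_injective hcd hce hde x y z) (by
    intro q hq
    fin_cases q
    all_goals first
      | exact hc _ _
      | exact hd _ _
      | exact he _ _
      | exact absurd hq (by decide))
  have c1 : crossAt A d b x z = ⟨A σ, A (-σ), .cr d true x, .cr d true !x, .cr d false z,
    .cr d false !z⟩ := by simp only [crossAt, h₁]
  have c2 : crossAt A e s y z = ⟨A σ, A (-σ), .cr e true y, .cr e true !y, .cr e false z,
    .cr e false !z⟩ := by simp only [crossAt, h₁, h₂]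
  have c3 : crossAt A c a x y = ⟨A σ, A (-σ), .cr c true x, .cr c true !x, .cr c false y,
    .cr c false !y⟩ := rfl
  rw [hG, c1, c2, c3]
  exact this

end Moves

/-! ### Reidemeister moves and slides in whole codes -/

section CodeMoves

variable {R : Type} [CommRing R] {f : ℕ → R} {A : ℤˣ → R} {k : ℕ}

/-- The name `c` is used neither by the given crossings nor by the letters of the template. -/
def FreshIn (c : ℕ) (Cs : List (ℕ × ℤˣ)) (T : Template k) : Prop :=
  (∀ x ∈ Cs, x.1 ≠ c) ∧ ∀ l ∈ letters T, l.label ≠ c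

theorem crossingSum_codeSys (A : ℤˣ → R) (f : ℕ → R) (Cs : List (ℕ × ℤˣ))
    {τ : Letter → List (Tok Pt)} (hτ : Labelled τ)
    {u v : Fin k → ℤ} {T : Template k} {hs : List (Fin k)} (hperm : hs.Perm (holes T))
    (hnd : hs.Nodup) {g : Fin k → List Letter} {X : Fin k → List (Tok Pt)}
    (hX : ∀ i j : Fin k, NoHole i (X j))
    (h : ∀ i ∈ holes T, TokEq ((g i).flatMap τ) (.wt (u i) :: (X i ++ [.wt (v i)]))) :
    crossingSum A f Cs (codeSys τ (T.fill g)) =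
      crossingSum A f Cs (holeArcs hs X ++ codeFrame τ u v T hs) := by
  refine (lawful_crossingSum A f Cs).codeSys_extract ?_ hτ hperm hnd hX h
  rintro i j ⟨x, _, o, b, h⟩
  cases h

theorem lawful_context (A : ℤˣ → R) (f : ℕ → R) (Cs : List (ℕ × ℤˣ)) (C : List (Bond Pt)) :
    Lawful f (fun B => crossingSum A f Cs (B ++ C)) (crossingPts Cs ∪ {x | x ∈ ends C}) :=
  (lawful_crossingSum A f Cs).append C

theorem FreshIn.notMem {c : ℕ} {Cs : List (ℕ × ℤˣ)} {T : Template k} (h : FreshIn c Cs T)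
    {τ : Letter → List (Tok Pt)} (hτ : Labelled τ) {u v : Fin k → ℤ} {hs : List (Fin k)}
    (o b : Bool) :
    Pt.cr c o b ∉ crossingPts Cs ∪ {x | x ∈ ends (codeFrame τ u v T hs)} := by
  rintro (⟨x, hx, o', b', e⟩ | h')
  · cases e
    exact h.1 x hx rfl
  · exact mem_ends_codeFrame hτ h.2 h'

theorem noHole_passTok (i c : ℕ) (o : Bool) (w : List (Tok Pt)) (h : NoHole i w) :
    NoHole i (passTok c o :: w) := by
  intro j
  have := h j
  simp [passTok, this]

theorem noHole_nil (i : ℕ) : NoHole i [] := fun j => by simp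

theorem noHole_wt {i : ℕ} {n : ℤ} {w : List (Tok Pt)} (h : NoHole i w) : NoHole i (.wt n :: w) := h

/-- The relations are symmetric in the two coefficients, so they hold with either sign in the first
place. -/
theorem coeff_rev {A : ℤˣ → R} {f : ℕ → R} (hA : A 1 * A (-1) = 1)
    (h0 : f 0 = -A 1 ^ 2 - A (-1) ^ 2) (σ : ℤˣ) :
    A σ * A (-σ) = 1 ∧ f 0 = -A σ ^ 2 - A (-σ) ^ 2 := by
  rcases Int.units_eq_one_or σ with h | h <;> rw [h]
  · exact ⟨hA, h0⟩
  · rw [neg_neg, mul_comm]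
    exact ⟨hA, by rw [h0]; ring⟩

/-- The third Reidemeister move. -/
theorem crossingSum_triangle (hA : A 1 * A (-1) = 1)
    (h0 : f 0 = -A 1 ^ 2 - A (-1) ^ 2) {c d e : ℕ} (hcd : c ≠ d) (hce : c ≠ e) (hde : d ≠ e)
    {a b s : ℤˣ} {x y z : Bool} (h₁ : revSign a x y = revSign b x z)
    (h₂ : revSign b x z = revSign s y z) (Cs : List (ℕ × ℤˣ)) (T : Template 3)
    (hT : [0, 1, 2].Perm (holes T)) (hc : FreshIn c Cs T) (hd : FreshIn d Cs T)
    (he : FreshIn e Cs T) {τ τ' : Letter → List (Tok Pt)} (hτ : Labelled τ) (hτ' : Labelled τ')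
    (hττ' : ∀ l ∈ letters T, τ l = τ' l) (u v : Fin 3 → ℤ) (g g' : Fin 3 → List Letter)
    (hg : ∀ i, TokEq ((g i).flatMap τ) (.wt (u i) :: (![
      cond x [passTok d true, passTok c true] [passTok c true, passTok d true],
      cond y [passTok e true, passTok c false] [passTok c false, passTok e true],
      cond z [passTok e false, passTok d false] [passTok d false, passTok e false]] i ++
        [.wt (v i)])))
    (hg' : ∀ i, TokEq ((g' i).flatMap τ') (.wt (u i) :: (![
      cond x [passTok c true, passTok d true] [passTok d true, passTok c true],
      cond y [passTok c false, passTok e true] [passTok e true, passTok c false],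
      cond z [passTok d false, passTok e false] [passTok e false, passTok d false]] i ++
        [.wt (v i)]))) :
    crossingSum A f ((c, a) :: (d, b) :: (e, s) :: Cs) (codeSys τ (T.fill g)) =
      crossingSum A f ((c, a) :: (d, b) :: (e, s) :: Cs) (codeSys τ' (T.fill g')) := by
  rw [crossingSum_codeSys A f _ hτ hT (by decide) ?_ fun i _ => hg i,
    crossingSum_codeSys A f _ hτ' hT (by decide) ?_ fun i _ => hg' i]
  · have e : codeFrame τ' u v T [0, 1, 2] = codeFrame τ u v T [0, 1, 2] := by
      rw [codeFrame, codeFrame, tokTemplate_congr hττ']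
    rw [e]
    exact (lawful_context A f Cs (codeFrame τ u v T [0, 1, 2])).triangle_strands hA h0 hcd hce hde
      (hc.notMem hτ) (hd.notMem hτ) (he.notMem hτ) h₁ h₂ _ _ _ _ _ _ rfl rfl rfl rfl rfl rfl
  all_goals
    intro i j
    fin_cases j <;> cases x <;> cases y <;> cases z <;>
      exact noHole_passTok _ _ _ _ (noHole_passTok _ _ _ _ (noHole_nil _))

/-- The second Reidemeister move. -/
theorem crossingSum_bigon (hA : A 1 * A (-1) = 1)
    (h0 : f 0 = -A 1 ^ 2 - A (-1) ^ 2) {c d : ℕ} (hcd : c ≠ d) (s : ℤˣ) (y : Bool)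
    (Cs : List (ℕ × ℤˣ)) (T : Template 2) (hT : [0, 1].Perm (holes T)) (hc : FreshIn c Cs T)
    (hd : FreshIn d Cs T) {τ τ' : Letter → List (Tok Pt)} (hτ : Labelled τ) (hτ' : Labelled τ')
    (hττ' : ∀ l ∈ letters T, τ l = τ' l) (u v : Fin 2 → ℤ) (g g' : Fin 2 → List Letter)
    (hg : ∀ i, TokEq ((g i).flatMap τ) (.wt (u i) :: (![[passTok c true, passTok d true],
      cond y [passTok d false, passTok c false] [passTok c false, passTok d false]] i ++
        [.wt (v i)])))
    (hg' : ∀ i, TokEq ((g' i).flatMap τ') [.wt (u i), .wt (v i)]) :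
    crossingSum A f ((c, s) :: (d, -s) :: Cs) (codeSys τ (T.fill g)) =
      crossingSum A f Cs (codeSys τ' (T.fill g')) := by
  rw [crossingSum_codeSys A f _ hτ hT (by decide) ?_ fun i _ => hg i,
    crossingSum_codeSys A f _ hτ' hT (by decide) (X := fun _ => []) ?_ fun i _ => hg' i]
  · have e : codeFrame τ' u v T [0, 1] = codeFrame τ u v T [0, 1] := by
      rw [codeFrame, codeFrame, tokTemplate_congr hττ']
    rw [e]
    have hF := lawful_context A f Cs (codeFrame τ u v T [0, 1])
    set F := fun B => crossingSum A f Cs (B ++ codeFrame τ u v T [0, 1]) with hFdef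
    change (crossAt A c s false false).apply ((crossAt A d (-s) false false).apply F)
      (arcs (.hole 0 2) 0 [passTok c true, passTok d true] (.hole 0 3) ++
        (arcs (.hole 1 2) 0 (cond y [passTok d false, passTok c false]
          [passTok c false, passTok d false]) (.hole 1 3) ++ [])) =
      F [(.hole 0 2, .hole 0 3, 0), (.hole 1 2, .hole 1 3, 0)]
    -- If `y` holds, the under-strand is reversed at both crossings, so that the antiparallel case
    -- becomes the parallel one. The crossings keep opposite signs.
    have l1 := hF.cross (crossAt A d (-s) false y)
    rw [hF.crossAt_apply A d (-s) false y, l1.crossAt_apply A c s false y]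
    have l2 := l1.cross (crossAt A c s false y)
    rw [((l2.prepend (arcs (.hole 0 2) 0 [passTok c true, passTok d true] (.hole 0 3))).strand y 1 c d
      false false [])]
    obtain ⟨hα, hβ⟩ := coeff_rev hA h0 (revSign s false y)
    have c1 : crossAt A c s false y = ⟨A (revSign s false y), A (-revSign s false y),
      .cr c true false, .cr c true true, .cr c false y, .cr c false !y⟩ := rfl
    have c2 : crossAt A d (-s) false y = ⟨A (-revSign s false y), A (revSign s false y),
      .cr d true false, .cr d true true, .cr d false y, .cr d false !y⟩ := by
      have : revSign (-s) false y = -revSign s false y := by cases y <;> rfl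
      simp only [crossAt, this, neg_neg, Bool.not_false]
    rw [c1, c2]
    refine (hF.bigon hα hβ _ (bigon_injective hcd y) ?_).trans ?_
    · intro q hq
      fin_cases q
      all_goals first
        | exact hc.notMem hτ _ _
        | exact hd.notMem hτ _ _
        | exact absurd hq (by decide)
    · change F [(.hole 0 2, .hole 0 3, 0), (.hole 1 (cond y 3 2), .hole 1 (cond y 2 3), 0)] = _
      cases y
      · rfl
      · simp only [cond_true]
        rw [hF.swap, hF.flip_zero, hF.swap]
  · intro i j; exact noHole_nil _
  · intro i j
    fin_cases j <;> cases y <;>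
      exact noHole_passTok _ _ _ _ (noHole_passTok _ _ _ _ (noHole_nil _))

/-- The first Reidemeister move. -/
theorem crossingSum_curl (hA : A 1 * A (-1) = 1)
    (h0 : f 0 = -A 1 ^ 2 - A (-1) ^ 2) {c : ℕ} (s : ℤˣ) (y : Bool)
    (Cs : List (ℕ × ℤˣ)) (T : Template 1) (hT : [0].Perm (holes T)) (hc : FreshIn c Cs T)
    {τ τ' : Letter → List (Tok Pt)} (hτ : Labelled τ) (hτ' : Labelled τ')
    (hττ' : ∀ l ∈ letters T, τ l = τ' l) (g g' : Fin 1 → List Letter) (u v : Fin 1 → ℤ)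
    (hg : ∀ i, TokEq ((g i).flatMap τ) (.wt (u i) :: (
      cond y [passTok c false, passTok c true] [passTok c true, passTok c false] ++
        [.wt (v i)])))
    (hg' : ∀ i, TokEq ((g' i).flatMap τ') [.wt (u i), .wt (v i)]) :
    crossingSum A f ((c, s) :: Cs) (codeSys τ (T.fill g)) =
      -A s ^ 3 * crossingSum A f Cs (codeSys τ' (T.fill g')) := by
  rw [crossingSum_codeSys A f _ hτ hT (by decide)
      (X := fun _ => cond y [passTok c false, passTok c true] [passTok c true, passTok c false])
      ?_ fun i _ => hg i,
    crossingSum_codeSys A f _ hτ' hT (by decide) (X := fun _ => []) ?_ fun i _ => hg' i]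
  · have e : codeFrame τ' u v T [0] = codeFrame τ u v T [0] := by
      rw [codeFrame, codeFrame, tokTemplate_congr hττ']
    rw [e]
    have hF := lawful_context A f Cs (codeFrame τ u v T [0])
    set F := fun B => crossingSum A f Cs (B ++ codeFrame τ u v T [0]) with hFdef
    obtain ⟨hα, hβ⟩ := coeff_rev hA h0 s
    have hι : Function.Injective (![.hole 0 2, .hole 0 3, .cr c true false, .cr c true true,
        .cr c false false, .cr c false true] : Fin 6 → Pt) := by
      rw [← List.nodup_ofFn]
      simp
    obtain ⟨h1, h2⟩ := hF.curl hα hβ _ hι (by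
      intro q hq
      fin_cases q
      all_goals first
        | exact hc.notMem hτ _ _
        | exact absurd hq (by decide))
    cases y
    · exact h1
    · exact h2
  · intro i j; exact noHole_nil _
  · intro i j
    cases y <;> exact noHole_passTok _ _ _ _ (noHole_passTok _ _ _ _ (noHole_nil _))

/-- Only certain sums of the weights on the four arcs at a crossing matter. -/
theorem crossingSum_slide {c : ℕ} (s : ℤˣ) (Cs : List (ℕ × ℤˣ)) (T : Template k) {i j : Fin k}
    (hij : i ≠ j) (hT : [i, j].Perm (holes T)) (hc : FreshIn c Cs T)
    {τ τ' : Letter → List (Tok Pt)} (hτ : Labelled τ) (hτ' : Labelled τ')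
    (hττ' : ∀ l ∈ letters T, τ l = τ' l) (g g' : Fin k → List Letter)
    {n₁ n₂ n₃ n₄ n₁' n₂' n₃' n₄' : ℤ}
    (hi : TokEq ((g i).flatMap τ) [.wt n₁, passTok c true, .wt n₂])
    (hj : TokEq ((g j).flatMap τ) [.wt n₃, passTok c false, .wt n₄])
    (hi' : TokEq ((g' i).flatMap τ') [.wt n₁', passTok c true, .wt n₂'])
    (hj' : TokEq ((g' j).flatMap τ') [.wt n₃', passTok c false, .wt n₄'])
    (e₁ : n₁ + n₄ = n₁' + n₄') (e₂ : n₃ + n₂ = n₃' + n₂') (e₃ : n₁ - n₃ = n₁' - n₃') :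
    crossingSum A f ((c, s) :: Cs) (codeSys τ (T.fill g)) =
      crossingSum A f ((c, s) :: Cs) (codeSys τ' (T.fill g')) := by
  have hwt : ∀ w : List (Tok Pt), TokEq w (.wt 0 :: (w ++ [.wt 0])) := by
    intro w x n y
    have h1 : TokEq (w ++ [.wt 0]) w := by
      have : TokEq [.wt 0] ([] : List (Tok Pt)) := fun x n y => by simp
      simpa using this.prepend w
    simpa using (h1 x n y).symm
  -- Expanding the crossing leaves two terms, which see the weights only through `n₁ + n₄`, `n₃ +
  -- n₂`, `n₁ - n₃` and `n₄ - n₂`.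
  have key : ∀ (τ : Letter → List (Tok Pt)) (hτ : Labelled τ) (g : Fin k → List Letter)
      (n₁ n₂ n₃ n₄ : ℤ) (_ : TokEq ((g i).flatMap τ) [.wt n₁, passTok c true, .wt n₂])
      (_ : TokEq ((g j).flatMap τ) [.wt n₃, passTok c false, .wt n₄]),
      crossingSum A f ((c, s) :: Cs) (codeSys τ (T.fill g)) =
        A s * crossingSum A f Cs ([(.hole i 2, .hole j 3, n₁ + n₄),
          (.hole j 2, .hole i 3, n₃ + n₂)] ++ codeFrame τ (fun _ => 0) (fun _ => 0) T [i, j]) +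
        A (-s) * crossingSum A f Cs ([(.hole i 2, .hole j 2, n₁ - n₃),
          (.hole i 3, .hole j 3, n₄ - n₂)] ++ codeFrame τ (fun _ => 0) (fun _ => 0) T [i, j]) := by
    intro τ hτ g n₁ n₂ n₃ n₄ hi hj
    have hT2 : ∀ l ∈ holes T, l = i ∨ l = j := fun l hl => by simpa using hT.mem_iff.2 hl
    rw [crossingSum_codeSys A f _ hτ hT (by simpa using hij)
      (X := fun l => if l = i then [.wt n₁, passTok c true, .wt n₂] else
        [.wt n₃, passTok c false, .wt n₄]) (u := fun _ => 0) (v := fun _ => 0) ?_ ?_]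
    · have hF := lawful_context A f Cs (codeFrame τ (fun _ => 0) (fun _ => 0) T [i, j])
      have hij' : (i : ℕ) ≠ j := fun e => hij (Fin.ext e)
      have hι : Function.Injective (![.hole i 2, .hole i 3, .hole j 2, .hole j 3, .cr c true false,
          .cr c true true, .cr c false false, .cr c false true] : Fin 8 → Pt) := by
        rw [← List.nodup_ofFn]
        simp [hij']
      have := hF.crossing (A s) (A (-s)) _ hι (by
        intro q hq
        fin_cases q
        all_goals first
          | exact hc.notMem hτ _ _
          | exact absurd hq (by decide)) n₁ n₂ n₃ n₄
      refine Eq.trans ?_ this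
      simp only [holeArcs, List.flatMap_cons, List.flatMap_nil, if_true, if_neg hij.symm, passTok,
        arcs_wt, arcs_pass, arcs_nil, zero_add]
      rfl
    · intro l m
      split_ifs <;> exact noHole_wt (noHole_passTok _ _ _ _ (noHole_wt (noHole_nil _)))
    · intro l hl
      rcases hT2 l hl with rfl | rfl
      · rw [if_pos rfl]; exact hi.trans (hwt _)
      · rw [if_neg hij.symm]; exact hj.trans (hwt _)
  have e : codeFrame τ' (fun _ => 0) (fun _ => 0) T [i, j] =
      codeFrame τ (fun _ => 0) (fun _ => 0) T [i, j] := by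
    rw [codeFrame, codeFrame, tokTemplate_congr hττ']
  -- The fourth combination is the first minus the second minus the third.
  have e₄ : n₄ - n₂ = n₄' - n₂' := by linarith
  rw [key τ hτ g _ _ _ _ hi hj, key τ' hτ' g' _ _ _ _ hi' hj', e, e₁, e₂, e₃, e₄]

end CodeMoves

/-! ### Reading strands by positions -/

section After

variable {P : Type}

/-- The point at which one leaves the last crossing of a word, when one starts at the given point. -/
def after : P → List (Tok P) → P
  | x, [] => x
  | x, .wt _ :: w => after x w
  | _, .pass _ b :: w => after b w

theorem after_append (x : P) (u v : List (Tok P)) : after x (u ++ v) = after (after x u) v := by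
  induction u generalizing x with
  | nil => rfl
  | cons t u ih => cases t <;> exact ih _

/-- The weight of a token. -/
def Tok.weight : Tok P → ℤ
  | .wt n => n
  | .pass _ _ => 0

theorem last_mem_arcs (x : P) (m : ℤ) (w : List (Tok P)) (y : P) :
    ∃ n, (after x w, y, n) ∈ arcs x m w y := by
  induction w generalizing x m with
  | nil => exact ⟨m, by simp [after]⟩
  | cons t w ih =>
    cases t with
    | wt k => exact ih x (m + k)
    | pass a b =>
      obtain ⟨n, hn⟩ := ih b 0
      exact ⟨n, List.mem_cons_of_mem _ hn⟩

theorem pass_mem_arcs (x : P) (m : ℤ) (u : List (Tok P)) (a b : P) (v : List (Tok P)) (y : P) :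
    ∃ n, (after x u, a, n) ∈ arcs x m (u ++ .pass a b :: v) y := by
  obtain ⟨n, hn⟩ := last_mem_arcs x m u a
  exact ⟨n, by rw [arcs_append_pass]; exact List.mem_append_left _ hn⟩

theorem mem_arcs {x y p q : P} {m n : ℤ} {w : List (Tok P)} (h : (p, q, n) ∈ arcs x m w y) :
    (p = after x w ∧ q = y) ∨
      ∃ u v a b, w = u ++ .pass a b :: v ∧ p = after x u ∧ q = a := by
  induction w generalizing x m with
  | nil =>
    simp only [arcs_nil, List.mem_singleton, Prod.mk.injEq] at h
    exact Or.inl ⟨h.1, h.2.1⟩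
  | cons t w ih =>
    cases t with
    | wt k =>
      rcases ih h with h | ⟨u, v, a, b, rfl, h, h'⟩
      · exact Or.inl h
      · exact Or.inr ⟨.wt k :: u, v, a, b, rfl, h, h'⟩
    | pass a b =>
      rw [arcs_pass, List.mem_cons] at h
      rcases h with h | h
      · simp only [Prod.mk.injEq] at h
        exact Or.inr ⟨[], w, a, b, rfl, h.1, h.2.1⟩
      · rcases ih h with h | ⟨u, v, a', b', rfl, h, h'⟩
        · exact Or.inl h
        · exact Or.inr ⟨.pass a b :: u, v, a', b', rfl, h, h'⟩

theorem mem_arcs_map {α : Type} {g : α → Tok P} {x y p q : P} {m n : ℤ} {w : List α}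
    (h : (p, q, n) ∈ arcs x m (w.map g) y) :
    (p = after x (w.map g) ∧ q = y) ∨
      ∃ (j : Fin w.length) (a b : P), g (w.get j) = .pass a b ∧
        p = after x ((w.take j).map g) ∧ q = a := by
  rcases mem_arcs h with h | ⟨u, v, a, b, e, h₁⟩
  · exact Or.inl h
  · obtain ⟨w₁, w₂, rfl, rfl, e'⟩ := List.map_eq_append_iff.1 e
    obtain ⟨l, w₃, rfl, e'', rfl⟩ := List.map_eq_cons_iff.1 e'
    refine Or.inr ⟨⟨w₁.length, by simp⟩, a, b, ?_, ?_⟩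
    · simpa using e''
    · simpa using h₁

theorem pass_mem_arcs_map {α : Type} {g : α → Tok P} (x : P) (m : ℤ) (w : List α)
    (j : Fin w.length) {a b : P} (h : g (w.get j) = .pass a b) (y : P) :
    ∃ n, (after x ((w.take j).map g), a, n) ∈ arcs x m (w.map g) y := by
  have e : w.map g = (w.take j).map g ++ .pass a b :: (w.drop (j + 1)).map g := by
    rw [← h, ← List.map_cons, ← List.map_append, List.get_eq_getElem, ← List.drop_eq_getElem_cons,
      List.take_append_drop]
  rw [e]
  exact pass_mem_arcs _ _ _ _ _ _ _

-- A weight is attributed to the point at which its arc starts, that is, to the exit of the last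
-- passage before it. Passages weigh 0, so the sum may run over all positions.
open Classical in
theorem total_arcs {α : Type} (g : α → Tok P) (x : P) (m : ℤ) (w : List α) (y : P) (ε : P → ℤˣ)
    (C : Set P) :
    total (arcs x m (w.map g) y) ε C = (if x ∈ C then (ε x : ℤ) * m else 0) +
      ∑ j : Fin w.length, if after x ((w.take j).map g) ∈ C then
        (ε (after x ((w.take j).map g)) : ℤ) * (g (w.get j)).weight else 0 := by
  induction w generalizing x m with
  | nil => simp [total]
  | cons t w ih =>
    refine Eq.trans ?_ (congrArg _ (Fin.sum_univ_succ (n := w.length) _).symm)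
    simp only [Fin.val_zero, List.take_zero, List.map_nil, after, List.get_cons_zero,
        Fin.val_succ, List.take_succ_cons, List.get_cons_succ', List.map_cons]
    rcases g t with k | ⟨a, b⟩
    · have e : (Tok.wt k : Tok P).weight = k := rfl
      rw [arcs_wt, ih, e]
      split_ifs
      · rw [mul_add, add_assoc]
        rfl
      · simp only [zero_add]
        rfl
    · have e : (Tok.pass a b).weight = 0 := rfl
      rw [arcs_pass, total_cons, ih, e]
      simp only [mul_zero, ite_self, zero_add]
      rfl

end After

section SysPositions

variable {α : Type}

theorem mem_sys {m : ℕ} {G : List α} {g : α → List (Tok Pt)} {b : Bond Pt} :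
    b ∈ sys m (G.map g) ↔ ∃ i : Fin G.length, b ∈ loopAt (m + i) (g (G.get i)) := by
  induction G generalizing m with
  | nil => simp
  | cons w G ih =>
    have e : ∀ i : ℕ, m + 1 + i = m + (i + 1) := fun i => by ring
    rw [List.map_cons, sys_cons, List.mem_append, ih]
    refine Iff.trans ?_ (Fin.exists_fin_succ (n := G.length)).symm
    simp only [Fin.val_zero, add_zero, List.get_cons_zero, Fin.val_succ, List.get_cons_succ', e]

theorem total_sys (m : ℕ) (G : List α) (g : α → List (Tok Pt)) (ε : Pt → ℤˣ) (C : Set Pt) :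
    total (sys m (G.map g)) ε C = ∑ i : Fin G.length, total (loopAt (m + i) (g (G.get i))) ε C := by
  induction G generalizing m with
  | nil => simp [total]
  | cons w G ih =>
    have e : ∀ i : ℕ, m + 1 + i = m + (i + 1) := fun i => by ring
    rw [List.map_cons, sys_cons, total_append, ih]
    refine Eq.trans ?_ (Fin.sum_univ_succ (n := G.length) _).symm
    simp only [Fin.val_zero, add_zero, List.get_cons_zero, Fin.val_succ, List.get_cons_succ', e]

end SysPositions

/-! ### Matchings -/

section Matching

variable {P : Type}

theorem bip_cons {x y : P} {n : ℤ} {B : List (Bond P)} {ε : P → ℤˣ} :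
    Bip ((x, y, n) :: B) ε ↔ ε y = -ε x ∧ Bip B ε := by
  constructor
  · intro h
    exact ⟨h x y n List.mem_cons_self, fun a b m hm => h a b m (List.mem_cons_of_mem _ hm)⟩
  · rintro ⟨h, h'⟩ a b m hm
    rcases List.mem_cons.1 hm with hm | hm
    · cases hm
      exact h
    · exact h' a b m hm

theorem bip_append {B B' : List (Bond P)} {ε : P → ℤˣ} :
    Bip (B ++ B') ε ↔ Bip B ε ∧ Bip B' ε := by
  constructor
  · intro h
    exact ⟨fun a b m hm => h a b m (List.mem_append_left _ hm),
      fun a b m hm => h a b m (List.mem_append_right _ hm)⟩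
  · rintro ⟨h, h'⟩ a b m hm
    rcases List.mem_append.1 hm with hm | hm
    · exact h a b m hm
    · exact h' a b m hm

theorem exists_bond_first {x : P} {B : List (Bond P)} (hx : x ∈ ends B) :
    ∃ x' n B', (ends B).Perm (x :: x' :: ends B') ∧
      ∀ ε, Bip B ε ↔ Bip ((x, x', n) :: B') ε := by
  obtain ⟨y, n, hy | hy⟩ := mem_ends.1 hx
  · obtain ⟨U, V, rfl⟩ := List.append_of_mem hy
    exact ⟨y, n, U ++ V, ends_perm List.perm_middle,
      fun ε => ⟨Bip.perm List.perm_middle, Bip.perm List.perm_middle.symm⟩⟩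
  · obtain ⟨U, V, rfl⟩ := List.append_of_mem hy
    refine ⟨y, n, U ++ V, (ends_perm List.perm_middle).trans (List.Perm.swap _ _ _), fun ε => ?_⟩
    have : Bip (U ++ (y, x, n) :: V) ε ↔ Bip ((y, x, n) :: (U ++ V)) ε :=
      ⟨Bip.perm List.perm_middle, Bip.perm List.perm_middle.symm⟩
    rw [this, bip_cons, bip_cons, ← neg_eq_iff_eq_neg, eq_comm]

/-- Every point lies on one bond only, so the sign at one end can be adjusted freely. -/
theorem exists_bip_matching (B : List (Bond P)) (hB : (ends B).Nodup) : ∃ ε, Bip B ε := by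
  classical
  induction B with
  | nil => exact ⟨fun _ => 1, fun x y n h => by simp at h⟩
  | cons b B ih =>
    obtain ⟨x, y, n⟩ := b
    rw [ends_cons, List.nodup_cons, List.nodup_cons, List.mem_cons, not_or] at hB
    obtain ⟨ε, hε⟩ := ih hB.2.2
    refine ⟨Function.update ε x (-ε y), bip_cons.2 ⟨?_, hε.update hB.1.2 _⟩⟩
    rw [Function.update_self, Function.update_of_ne (Ne.symm hB.1.1), neg_neg]

/-- The union of two matchings is bipartite. -/
theorem exists_bip_matchings (J B : List (Bond P)) (hJ : (ends J).Nodup) (hB : (ends B).Nodup)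
    (h : ∀ x ∈ ends J, x ∈ ends B) : ∃ ε, Bip (J ++ B) ε := by
  classical
  induction J generalizing B with
  | nil => exact exists_bip_matching B hB
  | cons j J ih =>
    obtain ⟨x, y, k⟩ := j
    rw [ends_cons, List.nodup_cons, List.nodup_cons, List.mem_cons, not_or] at hJ
    obtain ⟨⟨hxy, hxJ⟩, hyJ, hJ⟩ := hJ
    obtain ⟨x', n, B₁, hp₁, hε₁⟩ := exists_bond_first (h x (by simp))
    have hB₁ := hp₁.nodup_iff.1 hB
    by_cases hyx : y = x'
    -- Here the first bond of `J` has the same two ends as a bond of `B`, and the sign condition for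
    -- `B` already implies the one for it.
    · subst hyx
      obtain ⟨ε, hε⟩ := ih B hJ hB fun z hz => h z (by simp [hz])
      refine ⟨ε, bip_cons.2 ⟨?_, hε⟩⟩
      exact (bip_cons.1 ((hε₁ ε).1 (bip_append.1 hε).2)).1
    · have hy : y ∈ ends B₁ := by
        have := hp₁.mem_iff.1 (h y (by simp))
        simpa [Ne.symm hxy, hyx] using this
      obtain ⟨y', m, B₂, hp₂, hε₂⟩ := exists_bond_first hy
      have hp : (ends B).Perm (x :: x' :: y :: y' :: ends B₂) := hp₁.trans ((hp₂.cons x').cons x)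
      have hnd := hp.nodup_iff.1 hB
      simp only [List.nodup_cons, List.mem_cons, not_or] at hnd
      obtain ⟨⟨h1, h2, h3, h4⟩, ⟨h5, h6, h7⟩, ⟨h8, h9⟩, h10, h11⟩ := hnd
      -- The path `x' - x - y - y'` is contracted to one bond. Having three bonds, it forces
      -- opposite signs at its ends, so signs for `x` and `y` can be filled in afterwards.
      obtain ⟨ε, hε⟩ := ih ((x', y', 0) :: B₂) hJ (by simp [h6, h7, h10, h11]) (by
        intro z hz
        have hz' := hp.mem_iff.1 (h z (by simp [hz]))
        have hzx : z ≠ x := fun e => hxJ (e ▸ hz)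
        have hzy : z ≠ y := fun e => hyJ (e ▸ hz)
        simpa [hzx, hzy] using hz')
      obtain ⟨hεJ, hεB⟩ := bip_append.1 hε
      obtain ⟨e, hεB⟩ := bip_cons.1 hεB
      refine ⟨Function.update (Function.update ε x (-ε x')) y (-ε y'), bip_cons.2 ⟨?_,
        bip_append.2 ⟨(hεJ.update hxJ _).update hyJ _, (hε₁ _).2 (bip_cons.2 ⟨?_, (hε₂ _).2
          (bip_cons.2 ⟨?_, (hεB.update h4 _).update h9 _⟩)⟩)⟩⟩⟩
      · rw [Function.update_self, Function.update_of_ne hxy, Function.update_self, e]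
      · rw [Function.update_of_ne hxy, Function.update_self, Function.update_of_ne (Ne.symm hyx),
          Function.update_of_ne (Ne.symm h1), neg_neg]
      · rw [Function.update_self, Function.update_of_ne (Ne.symm h8),
          Function.update_of_ne (Ne.symm h3), neg_neg]

end Matching

/-! ### Letters of codes -/

section Codes

/-- Whether the letter is the passage through the crossing `c` as the over-strand (`o = true`) or
as the under-strand. -/
def Letter.isAt (c : ℕ) (o : Bool) : Letter → Bool
  | .over c' _ => o && decide (c' = c)
  | .under c' _ => !o && decide (c' = c)
  | .virt _ => false

theorem Letter.label_of_isAt {c : ℕ} {o : Bool} {l : Letter} (h : l.isAt c o = true) :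
    l.label = c := by
  cases l <;> simp_all [Letter.isAt, Letter.label]

/-- The name and the sign of a crossing at its over-strand. -/
def Letter.overData : Letter → Option (ℕ × ℤˣ)
  | .over c s => some (c, s)
  | _ => none

/-- The classical crossings at which the code passes over. -/
def overs (G : Code) : List (ℕ × ℤˣ) := G.flatten.filterMap Letter.overData

theorem Letter.overData_eq {l : Letter} {x : ℕ × ℤˣ} : l.overData = some x ↔ l = .over x.1 x.2 := by
  obtain ⟨c, s⟩ := x
  cases l <;> simp [Letter.overData]

theorem mem_overs {G : Code} {c : ℕ} {s : ℤˣ} : (c, s) ∈ overs G ↔ Letter.over c s ∈ G.flatten := by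
  simp only [overs, List.mem_filterMap, Letter.overData_eq]
  constructor
  · rintro ⟨l, h, rfl⟩; exact h
  · intro h; exact ⟨_, h, rfl⟩

theorem overs_perm {G H : Code} (h : G.flatten.Perm H.flatten) : (overs G).Perm (overs H) :=
  h.filterMap _

variable {G : Code}

theorem Code.WF.perm_of_over (h : G.WF) {c : ℕ} {s : ℤˣ} (hc : Letter.over c s ∈ G.flatten) :
    (G.flatten.filter fun x => x.label = c).Perm [.over c s, .under c s] := by
  have hm : Letter.over c s ∈ G.flatten.filter fun x => x.label = c :=
    List.mem_filter.2 ⟨hc, decide_eq_true rfl⟩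
  rcases h c with h | ⟨t, h⟩ | h
  · rw [h] at hm; simp at hm
  · have := h.mem_iff.1 hm
    simp at this
    exact this ▸ h
  · rw [h] at hm; simp at hm

theorem Code.WF.perm_of_under (h : G.WF) {c : ℕ} {s : ℤˣ} (hc : Letter.under c s ∈ G.flatten) :
    (G.flatten.filter fun x => x.label = c).Perm [.over c s, .under c s] := by
  have hm : Letter.under c s ∈ G.flatten.filter fun x => x.label = c :=
    List.mem_filter.2 ⟨hc, decide_eq_true rfl⟩
  rcases h c with h | ⟨t, h⟩ | h
  · rw [h] at hm; simp at hm
  · have := h.mem_iff.1 hm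
    simp at this
    exact this ▸ h
  · rw [h] at hm; simp at hm

theorem Code.WF.eq_virt (h : G.WF) {c : ℕ} (hc : Letter.virt c ∈ G.flatten) :
    (G.flatten.filter fun x => x.label = c) = [.virt c, .virt c] := by
  have hm : Letter.virt c ∈ G.flatten.filter fun x => x.label = c :=
    List.mem_filter.2 ⟨hc, decide_eq_true rfl⟩
  rcases h c with h | ⟨t, h⟩ | h
  · rw [h] at hm; simp at hm
  · have := h.mem_iff.1 hm
    simp at this
  · exact h

theorem Code.WF.over_iff_under (h : G.WF) {c : ℕ} {s : ℤˣ} :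
    Letter.over c s ∈ G.flatten ↔ Letter.under c s ∈ G.flatten := by
  constructor
  · intro hc
    exact (List.mem_filter.1 ((h.perm_of_over hc).mem_iff.2 (by simp))).1
  · intro hc
    exact (List.mem_filter.1 ((h.perm_of_under hc).mem_iff.2 (by simp))).1

theorem countP_isAt (w : List Letter) (c : ℕ) (o : Bool) :
    w.countP (Letter.isAt c o) = (w.filter fun x => x.label = c).countP (Letter.isAt c o) := by
  rw [List.countP_filter]
  refine List.countP_congr fun l _ => ?_
  simp only [Bool.and_eq_true, decide_eq_true_eq]
  exact ⟨fun h => ⟨h, Letter.label_of_isAt h⟩, fun h => h.1⟩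

theorem Code.WF.countP_isAt_le (h : G.WF) (c : ℕ) (o : Bool) :
    G.flatten.countP (Letter.isAt c o) ≤ 1 := by
  rw [countP_isAt]
  rcases h c with h | ⟨t, h⟩ | h
  · simp [h]
  · rw [h.countP_eq]
    cases o <;> simp [Letter.isAt]
  · rw [h]
    simp [Letter.isAt]

theorem nodup_overData {w : List Letter} (h : ∀ c, w.countP (Letter.isAt c true) ≤ 1) :
    ((w.filterMap Letter.overData).map Prod.fst).Nodup := by
  rw [List.nodup_iff_count_le_one]
  intro c
  refine le_of_eq_of_le ?_ (h c)
  clear h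
  induction w with
  | nil => rfl
  | cons l w ih =>
    rcases l with ⟨c', s⟩ | ⟨c', s⟩ | c'
    · rw [List.filterMap_cons_some (f := Letter.overData) (b := (c', s)) rfl, List.map_cons, List.count_cons,
        List.countP_cons, ih]
      simp [Letter.isAt]
    · rw [List.filterMap_cons_none (f := Letter.overData) rfl, List.countP_cons, ih]
      simp [Letter.isAt]
    · rw [List.filterMap_cons_none (f := Letter.overData) rfl, List.countP_cons, ih]
      simp [Letter.isAt]

end Codes

/-! ### The sum over all states -/

section StateSum

variable {R : Type} [CommRing R]

open Classical in
/-- The joins at a crossing in the state `S`. -/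
noncomputable def joinsAt (S : Finset ℕ) (x : ℕ × ℤˣ) : List (Bond Pt) :=
  if x.1 ∈ S ↔ x.2 = 1 then
    [(.cr x.1 true false, .cr x.1 false true, 0), (.cr x.1 false false, .cr x.1 true true, 0)]
  else
    [(.cr x.1 true false, .cr x.1 false false, 0), (.cr x.1 true true, .cr x.1 false true, 0)]

/-- The joins in the state `S`. -/
noncomputable def stateJoins (S : Finset ℕ) (Cs : List (ℕ × ℤˣ)) : List (Bond Pt) :=
  Cs.flatMap (joinsAt S)

theorem stateJoins_congr {S S' : Finset ℕ} {Cs : List (ℕ × ℤˣ)}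
    (h : ∀ x ∈ Cs, x.1 ∈ S ↔ x.1 ∈ S') : stateJoins S Cs = stateJoins S' Cs := by
  apply List.flatMap_congr
  intro x hx
  simp only [joinsAt, h x hx]

theorem ends_stateJoins (S : Finset ℕ) (Cs : List (ℕ × ℤˣ)) :
    (ends (stateJoins S Cs)).Perm (Cs.flatMap fun x =>
      [.cr x.1 true false, .cr x.1 true true, .cr x.1 false false, .cr x.1 false true]) := by
  induction Cs with
  | nil => exact List.Perm.nil
  | cons x Cs ih =>
    rw [stateJoins, List.flatMap_cons, ends_append, List.flatMap_cons]
    refine List.Perm.append ?_ ih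
    apply Multiset.coe_eq_coe.1
    unfold joinsAt
    split_ifs <;>
      simp only [ends_cons, ends_nil, ← Multiset.cons_coe, ← Multiset.singleton_add] <;> abel

/-- Expanding the crossings one by one splits the states according to whether they contain `c`. The
oriented smoothing has coefficient `A s` and is the `A`-smoothing exactly if `s = 1`; thus for both
signs membership in `S` contributes `A 1` and non-membership `A (-1)`. -/
theorem crossingSum_eq_sum (A : ℤˣ → R) (f : ℕ → R) (Cs : List (ℕ × ℤˣ))
    (h : (Cs.map Prod.fst).Nodup) (B : List (Bond Pt)) :
    crossingSum A f Cs B = ∑ S ∈ (Cs.map Prod.fst).toFinset.powerset,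
      (∏ c ∈ (Cs.map Prod.fst).toFinset, A (if c ∈ S then 1 else -1)) *
        val f (stateJoins S Cs ++ B) := by
  classical
  induction Cs generalizing B with
  | nil => simp [crossingSum, stateSum, stateJoins]
  | cons x Cs ih =>
    obtain ⟨c, s⟩ := x
    rw [List.map_cons, List.nodup_cons] at h
    rw [crossingSum_cons, List.map_cons, List.toFinset_cons]
    set lab := (Cs.map Prod.fst).toFinset with hlab
    have hc : c ∉ lab := by rw [hlab, List.mem_toFinset]; exact h.1
    rw [Finset.sum_powerset_insert hc, Cross.apply, ih h.2, ih h.2, Finset.mul_sum, Finset.mul_sum,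
      ← Finset.sum_add_distrib, ← Finset.sum_add_distrib]
    refine Finset.sum_congr rfl fun S hS => ?_
    have hcS : c ∉ S := fun h => hc (Finset.mem_powerset.1 hS h)
    have hne : ∀ x ∈ lab, x ≠ c := fun x hx e => hc (e ▸ hx)
    have e1 : stateJoins (insert c S) Cs = stateJoins S Cs := stateJoins_congr fun x hx => by
      have : x.1 ≠ c := hne _ (by rw [hlab, List.mem_toFinset]; exact List.mem_map_of_mem hx)
      simp [this]
    have e2 : ∏ x ∈ lab, A (if x ∈ insert c S then 1 else -1) =
        ∏ x ∈ lab, A (if x ∈ S then 1 else -1) := Finset.prod_congr rfl fun x hx => by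
      simp [hne x hx]
    rw [Finset.prod_insert hc, Finset.prod_insert hc, e2]
    have e3 : ∀ S, stateJoins S ((c, s) :: Cs) = joinsAt S (c, s) ++ stateJoins S Cs := fun S => rfl
    rw [e3, e3, e1]
    have p : ∀ a b : Bond Pt, val f (stateJoins S Cs ++ a :: b :: B) =
        val f ([a, b] ++ stateJoins S Cs ++ B) := by
      intro a b
      apply val_perm
      apply Multiset.coe_eq_coe.1
      simp only [← Multiset.coe_add, ← Multiset.cons_coe, ← Multiset.singleton_add,
        Multiset.coe_nil, add_zero]
      abel
    rw [p, p]
    rcases Int.units_eq_one_or s with rfl | rfl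
    · simp only [joinsAt, crossAt, revSign, hcS, Finset.mem_insert, true_or, if_true, if_false,
        Bool.not_false]
      simp only [iff_true, if_false]
      ring
    · have h1 : ¬ ((-1 : ℤˣ) = 1) := by decide
      simp only [joinsAt, crossAt, revSign, hcS, Finset.mem_insert, true_or, if_true, if_false,
        Bool.not_false, h1, iff_false, not_true_eq_false, neg_neg]
      ring

end StateSum

/-! ### The states of a diagram `D ∪ ω` -/

/-- What a passage of `D` means in `D ∪ ω`: the crossings over which `ω` passes only carry their
signs as weights, and virtual crossings do not matter. -/
def tok (O : List Letter) : Letter → Tok Pt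
  | .over c _ => passTok c true
  | .under c s => if Letter.over c s ∈ O then .wt s else passTok c false
  | .virt _ => .wt 0

theorem labelled_tok (O : List Letter) : Labelled fun l => [tok O l] := by
  intro l p hp
  rcases l with ⟨c, s⟩ | ⟨c, s⟩ | c
  · simp only [tok, passTok, tokPts_pass, tokPts_nil, List.mem_cons, List.not_mem_nil,
      or_false] at hp
    rcases hp with rfl | rfl <;> exact ⟨_, _, rfl⟩
  · simp only [tok] at hp
    split_ifs at hp
    · simp at hp
    · simp only [passTok, tokPts_pass, tokPts_nil, List.mem_cons, List.not_mem_nil,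
        or_false] at hp
      rcases hp with rfl | rfl <;> exact ⟨_, _, rfl⟩
  · simp [tok] at hp

namespace OmegaDiagram

variable (L : OmegaDiagram)

/-- The system of closed strands formed by the base. -/
def system : List (Bond Pt) := codeSys (fun l => [tok L.omega l]) L.base

theorem system_eq : L.system = sys 0 (L.base.map fun w => w.map (tok L.omega)) := by
  unfold system codeSys
  congr 1
  apply List.map_congr_left
  intro w _
  exact List.map_eq_flatMap.symm

theorem countP_base_le (c : ℕ) (o : Bool) : L.base.flatten.countP (Letter.isAt c o) ≤ 1 := by
  have := L.wf.countP_isAt_le c o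
  rw [List.flatten_cons, List.countP_append] at this
  omega

theorem mem_base {l : Letter} : l ∈ L.base.flatten ↔ ∃ p, L.letter p = l := by
  constructor
  · intro h
    obtain ⟨w, hw, hl⟩ := List.mem_flatten.1 h
    obtain ⟨i, rfl⟩ := List.mem_iff_get.1 hw
    obtain ⟨j, rfl⟩ := List.mem_iff_get.1 hl
    exact ⟨⟨i, j⟩, rfl⟩
  · rintro ⟨p, rfl⟩
    exact List.mem_flatten_of_mem (List.get_mem _ _) (List.get_mem _ _)

theorem sum_letters {M : Type} [AddCommMonoid M] (g : Letter → M) :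
    (L.base.flatten.map g).sum = ∑ p, g (L.letter p) := by
  have h1 : ∀ w : List Letter, (w.map g).sum = ∑ j : Fin w.length, g (w.get j) := by
    intro w
    induction w with
    | nil => rfl
    | cons l w ih =>
      rw [List.map_cons, List.sum_cons, ih]
      exact (Fin.sum_univ_succ (n := w.length) fun j => g ((l :: w).get j)).symm
  have h2 : ∀ G : Code, (G.flatten.map g).sum =
      ∑ i : Fin G.length, ∑ j : Fin (G.get i).length, g ((G.get i).get j) := by
    intro G
    induction G with
    | nil => rfl
    | cons w G ih =>
      rw [List.flatten_cons, List.map_append, List.sum_append, ih, h1]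
      exact (Fin.sum_univ_succ (n := G.length) fun i =>
        ∑ j : Fin ((w :: G).get i).length, g (((w :: G).get i).get j)).symm
  rw [h2]
  exact (Fintype.sum_sigma fun p : L.Pos => g (L.letter p)).symm

/-- The passage `p` is a crossing of the base with itself. -/
def Passes (p : L.Pos) (c : ℕ) (o : Bool) : Prop := tok L.omega (L.letter p) = passTok c o

variable {L}

theorem passes_iff {p : L.Pos} {c : ℕ} {o : Bool} : L.Passes p c o ↔
    (o = true ∧ ∃ s, L.letter p = .over c s) ∨
      (o = false ∧ ∃ s, L.letter p = .under c s ∧ Letter.over c s ∉ L.omega) := by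
  unfold Passes
  rcases L.letter p with ⟨c', s⟩ | ⟨c', s⟩ | c'
  · simp [tok, passTok]; tauto
  · by_cases h : Letter.over c' s ∈ L.omega
    · simp only [tok, h, if_true, passTok]
      constructor
      · intro h; cases h
      · rintro (⟨_, s, h'⟩ | ⟨_, s, h', h''⟩)
        · cases h'
        · cases h'; exact absurd h h''
    · simp only [tok, h, if_false, passTok]
      constructor
      · intro h'
        cases h'
        exact Or.inr ⟨rfl, s, rfl, h⟩
      · rintro (⟨_, s, h'⟩ | ⟨rfl, s, h', h''⟩)
        · cases h'
        · cases h'; rfl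
  · simp [tok, passTok]

theorem Passes.isAt {p : L.Pos} {c : ℕ} {o : Bool} (h : L.Passes p c o) :
    (L.letter p).isAt c o = true := by
  rcases passes_iff.1 h with ⟨rfl, s, h⟩ | ⟨rfl, s, h, _⟩ <;> simp [h, Letter.isAt]

/-- The passages of each kind through `c` are counted over all positions; two positions would exceed
the bound from well-formedness. -/
theorem Passes.unique {p q : L.Pos} {c : ℕ} {o : Bool} (hp : L.Passes p c o)
    (hq : L.Passes q c o) : p = q := by
  by_contra hpq
  have h1 : ∀ w : List Letter, w.countP (Letter.isAt c o) =
      (w.map fun l => if l.isAt c o then 1 else 0).sum := by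
    intro w
    induction w with
    | nil => rfl
    | cons l w ih => rw [List.countP_cons, ih, List.map_cons, List.sum_cons, add_comm]
  have h2 := L.countP_base_le c o
  rw [h1, L.sum_letters] at h2
  have h3 : ∑ r ∈ {p, q}, (if (L.letter r).isAt c o then 1 else 0) ≤
      ∑ r, (if (L.letter r).isAt c o then 1 else 0) :=
    Finset.sum_le_sum_of_subset (Finset.subset_univ _)
  rw [Finset.sum_pair hpq, if_pos hp.isAt, if_pos hq.isAt] at h3
  omega

/-- The point at which the edge `e` leaves the last crossing of the base before it. -/
def start (L : OmegaDiagram) (e : L.Edge) : Pt :=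
  after (.base e.1 true) (((L.base.get e.1).take e.2).map (tok L.omega))

theorem start_outEdge (p : L.Pos) :
    L.start (L.outEdge p) = after (L.start (L.inEdge p)) [tok L.omega (L.letter p)] := by
  unfold start outEdge inEdge letter
  simp only [Fin.val_succ, Fin.val_castSucc]
  rw [← after_append, ← List.map_singleton, ← List.map_append]
  exact congrArg (fun w => after (.base p.1 true) (w.map (tok L.omega)))
    (List.take_append_getElem p.2.2).symm

theorem Passes.start_outEdge {p : L.Pos} {c : ℕ} {o : Bool} (h : L.Passes p c o) :
    L.start (L.outEdge p) = .cr c o true := by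
  rw [OmegaDiagram.start_outEdge, show tok L.omega (L.letter p) = passTok c o from h]
  rfl

theorem start_outEdge_of_virt {p : L.Pos} {c : ℕ} (h : L.letter p = .virt c) :
    L.start (L.outEdge p) = L.start (L.inEdge p) := by
  rw [OmegaDiagram.start_outEdge, h]
  rfl

theorem start_outEdge_of_omega {p : L.Pos} {c : ℕ} {s : ℤˣ} (h : L.letter p = .under c s)
    (hω : Letter.over c s ∈ L.omega) : L.start (L.outEdge p) = L.start (L.inEdge p) := by
  rw [OmegaDiagram.start_outEdge, h, tok, if_pos hω]
  rfl

theorem mem_system_close (i : Fin L.base.length) :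
    (Pt.base i false, Pt.base i true, (0 : ℤ)) ∈ L.system := by
  rw [system_eq, mem_sys]
  exact ⟨i, by simp [loopAt]⟩

theorem mem_system_last (i : Fin L.base.length) :
    ∃ n, (L.start ⟨i, Fin.last _⟩, Pt.base i false, n) ∈ L.system := by
  obtain ⟨n, hn⟩ := last_mem_arcs (.base i true) 0 ((L.base.get i).map (tok L.omega))
    (.base i false)
  refine ⟨n, ?_⟩
  rw [system_eq, mem_sys]
  refine ⟨i, List.mem_append_left _ ?_⟩
  rw [zero_add]
  convert hn using 3
  simp [start]

theorem Passes.mem_system {p : L.Pos} {c : ℕ} {o : Bool} (h : L.Passes p c o) :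
    ∃ n, (L.start (L.inEdge p), Pt.cr c o false, n) ∈ L.system := by
  obtain ⟨n, hn⟩ := pass_mem_arcs_map (.base p.1 true) 0 (L.base.get p.1) (g := tok L.omega) p.2 h
    (.base p.1 false)
  refine ⟨n, ?_⟩
  rw [system_eq, mem_sys]
  refine ⟨p.1, List.mem_append_left _ ?_⟩
  rw [zero_add]
  exact hn

theorem mem_system {x y : Pt} {n : ℤ} (h : (x, y, n) ∈ L.system) :
    (∃ i : Fin L.base.length, x = .base i false ∧ y = .base i true) ∨
    (∃ i : Fin L.base.length, x = L.start ⟨i, Fin.last _⟩ ∧ y = .base i false) ∨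
    ∃ p c o, L.Passes p c o ∧ x = L.start (L.inEdge p) ∧ y = .cr c o false := by
  rw [system_eq, mem_sys] at h
  obtain ⟨i, h⟩ := h
  rw [loopAt, List.mem_append, zero_add] at h
  rcases h with h | h
  · rcases mem_arcs_map h with ⟨rfl, rfl⟩ | ⟨j, a, b, e, rfl, rfl⟩
    · refine Or.inr (Or.inl ⟨i, ?_, rfl⟩)
      simp [start]
    · refine Or.inr (Or.inr ⟨⟨i, j⟩, ?_⟩)
      have h : ∃ c o, L.Passes ⟨i, j⟩ c o := by
        unfold Passes letter
        generalize (L.base.get i).get j = l at e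
        rcases l with ⟨c, s⟩ | ⟨c, s⟩ | c
        · exact ⟨c, true, rfl⟩
        · by_cases hω : Letter.over c s ∈ L.omega
          · simp [tok, hω] at e
          · exact ⟨c, false, by simp [tok, hω]⟩
        · simp [tok] at e
      obtain ⟨c, o, h⟩ := h
      refine ⟨c, o, h, rfl, ?_⟩
      have h' : tok L.omega ((L.base.get i).get j) = passTok c o := h
      rw [e] at h'
      cases h'
      rfl
  · rw [List.mem_singleton] at h
    cases h
    exact Or.inl ⟨i, rfl, rfl⟩

/-- Every edge lies on the same strand as the last crossing before it. -/
theorem start_cases (S : Finset ℕ) (e : L.Edge) :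
    (L.start e = .base e.1 true ∧ L.curveOf S e = L.curveOf S ⟨e.1, 0⟩) ∨
    ∃ p c o, L.Passes p c o ∧ L.start e = .cr c o true ∧
      L.curveOf S e = L.curveOf S (L.outEdge p) := by
  obtain ⟨i, j⟩ := e
  induction j using Fin.induction with
  | zero => exact Or.inl ⟨rfl, rfl⟩
  | succ j ih =>
    change _ ∨ _ at ih
    set p : L.Pos := ⟨i, j⟩ with hp
    change (L.start (L.inEdge p) = _ ∧ L.curveOf S (L.inEdge p) = _) ∨
      (∃ q c o, L.Passes q c o ∧ L.start (L.inEdge p) = _ ∧ L.curveOf S (L.inEdge p) = _) at ih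
    change (L.start (L.outEdge p) = _ ∧ L.curveOf S (L.outEdge p) = _) ∨
      (∃ q c o, L.Passes q c o ∧ L.start (L.outEdge p) = _ ∧ L.curveOf S (L.outEdge p) = _)
    have key : (∃ c o, L.Passes p c o) ∨ (L.start (L.outEdge p) = L.start (L.inEdge p) ∧
        L.curveOf S (L.outEdge p) = L.curveOf S (L.inEdge p)) := by
      rcases h : L.letter p with ⟨c, s⟩ | ⟨c, s⟩ | c
      · exact Or.inl ⟨c, true, passes_iff.2 (Or.inl ⟨rfl, s, h⟩)⟩
      · by_cases hω : Letter.over c s ∈ L.omega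
        · exact Or.inr ⟨start_outEdge_of_omega h hω, (Quot.sound ⟨1, .omega p c s h hω⟩).symm⟩
        · exact Or.inl ⟨c, false, passes_iff.2 (Or.inr ⟨rfl, s, h, hω⟩)⟩
      · exact Or.inr ⟨start_outEdge_of_virt h, (Quot.sound ⟨1, .virt p c h⟩).symm⟩
    rcases key with ⟨c, o, h⟩ | ⟨h1, h2⟩
    · exact Or.inr ⟨p, c, o, h, h.start_outEdge, rfl⟩
    · rw [h1, h2]
      exact ih

end OmegaDiagram

/-! ### State curves as components of the system of bonds -/

namespace OmegaDiagram

section Curves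

variable {L : OmegaDiagram}

/-- The over-passage of a crossing occurs only once in `D ∪ ω`. -/
theorem over_notMem_omega {p : L.Pos} {c : ℕ} {s : ℤˣ} (h : L.letter p = .over c s) (t : ℤˣ) :
    Letter.over c t ∉ L.omega := by
  intro hω
  have h1 := L.wf.countP_isAt_le c true
  rw [List.flatten_cons, List.countP_append] at h1
  have h2 : 0 < L.omega.countP (Letter.isAt c true) :=
    List.countP_pos_iff.2 ⟨_, hω, by simp [Letter.isAt]⟩
  have h3 : 0 < L.base.flatten.countP (Letter.isAt c true) :=
    List.countP_pos_iff.2 ⟨_, L.mem_base.2 ⟨p, h⟩, by simp [Letter.isAt]⟩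
  omega

theorem Passes.exists_pair {p : L.Pos} {c : ℕ} {o : Bool} (h : L.Passes p c o) :
    ∃ s, (c, s) ∈ overs L.base := by
  rcases passes_iff.1 h with ⟨_, s, h⟩ | ⟨_, s, h, hω⟩
  · exact ⟨s, mem_overs.2 (L.mem_base.2 ⟨p, h⟩)⟩
  · have h1 : Letter.under c s ∈ (L.omega :: L.base).flatten :=
      List.mem_append_right _ (L.mem_base.2 ⟨p, h⟩)
    have h2 := L.wf.over_iff_under.2 h1
    rw [List.flatten_cons, List.mem_append] at h2
    exact ⟨s, mem_overs.2 (h2.resolve_left hω)⟩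

/-- Because `D` never passes over `ω`, a crossing at which the base passes over has its
under-passage on the base, too. -/
theorem exists_passes {c : ℕ} {s : ℤˣ} (h : (c, s) ∈ overs L.base) : ∃ p q, L.letter p = .over c s ∧
    L.letter q = .under c s ∧ L.Passes p c true ∧ L.Passes q c false := by
  have h' := mem_overs.1 h
  obtain ⟨p, hp⟩ := L.mem_base.1 h'
  obtain ⟨q, hq⟩ := L.mem_base.1 (L.omega_over c s h')
  exact ⟨p, q, hp, hq, passes_iff.2 (Or.inl ⟨rfl, s, hp⟩),
    passes_iff.2 (Or.inr ⟨rfl, s, hq, over_notMem_omega hp s⟩)⟩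

/-- The system of curves of the state `S`. -/
noncomputable def stateSystem (L : OmegaDiagram) (S : Finset ℕ) : List (Bond Pt) :=
  stateJoins S (overs L.base) ++ L.system

variable {S : Finset ℕ}

theorem mem_stateSystem {b : Bond Pt} : b ∈ L.stateSystem S ↔
    (∃ x ∈ overs L.base, b ∈ joinsAt S x) ∨ b ∈ L.system := by
  rw [stateSystem, List.mem_append, stateJoins, List.mem_flatMap]

/-- Every join of two edges is a path of bonds between their starting points, and `δ` is `-1` to the
length of the path. The length is 0 at crossings that are not smoothed, 2 at closings and oriented
joins, 3 where two incoming edges are joined, and 1 where two outgoing edges are joined. -/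
theorem Join.reach {e e' : L.Edge} {δ : ℤˣ} (h : L.Join S e e' δ) :
    Reach (L.stateSystem S) (L.start e) (L.start e') ∧
      ∀ ε, Bip (L.stateSystem S) ε → ε (L.start e') = δ * ε (L.start e) := by
  have hsys : ∀ {b : Bond Pt}, b ∈ L.system → b ∈ L.stateSystem S := fun hb =>
    mem_stateSystem.2 (Or.inr hb)
  have hjoin : ∀ {x b}, x ∈ overs L.base → b ∈ joinsAt S x → b ∈ L.stateSystem S := fun hx hb =>
    mem_stateSystem.2 (Or.inl ⟨_, hx, hb⟩)
  have hpq : ∀ {p q : L.Pos} {c : ℕ} {s : ℤˣ}, L.letter p = .over c s → L.letter q = .under c s →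
      (c, s) ∈ overs L.base ∧ L.Passes p c true ∧ L.Passes q c false := fun {p q c s} hp hq =>
    ⟨mem_overs.2 (L.mem_base.2 ⟨p, hp⟩), passes_iff.2 (Or.inl ⟨rfl, s, hp⟩),
      passes_iff.2 (Or.inr ⟨rfl, s, hq, over_notMem_omega hp s⟩)⟩
  have two : ∀ {x y z : Pt} {n m : ℤ}, (x, y, n) ∈ L.stateSystem S → (y, z, m) ∈ L.stateSystem S →
      Reach (L.stateSystem S) x z ∧ ∀ ε, Bip (L.stateSystem S) ε → ε z = 1 * ε x := by
    intro x y z n m h h'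
    exact ⟨(Reach.of_mem h).trans (Reach.of_mem h'), fun ε hε => by
      rw [hε _ _ _ h', hε _ _ _ h, neg_neg, one_mul]⟩
  cases h with
  | close i =>
    obtain ⟨n, hn⟩ := mem_system_last i
    exact two (hsys hn) (hsys (mem_system_close i))
  | virt p c hp =>
    rw [start_outEdge_of_virt hp]
    exact ⟨Reach.refl _ _, fun ε _ => (one_mul _).symm⟩
  | omega p c s hp hω =>
    rw [start_outEdge_of_omega hp hω]
    exact ⟨Reach.refl _ _, fun ε _ => (one_mul _).symm⟩
  | oriented_over p q c s hp hq hS =>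
    obtain ⟨hx, h1, h2⟩ := hpq hp hq
    obtain ⟨n, hn⟩ := h1.mem_system
    rw [h2.start_outEdge]
    exact two (m := 0) (hsys hn) (hjoin hx (by simp [joinsAt, hS]))
  | oriented_under p q c s hp hq hS =>
    obtain ⟨hx, h1, h2⟩ := hpq hp hq
    obtain ⟨n, hn⟩ := h2.mem_system
    rw [h1.start_outEdge]
    exact two (m := 0) (hsys hn) (hjoin hx (by simp [joinsAt, hS]))
  | disoriented_in p q c s hp hq hS =>
    obtain ⟨hx, h1, h2⟩ := hpq hp hq
    obtain ⟨n, hn⟩ := h1.mem_system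
    obtain ⟨m, hm⟩ := h2.mem_system
    have hj : (Pt.cr c true false, Pt.cr c false false, (0 : ℤ)) ∈ L.stateSystem S :=
      hjoin hx (by simp [joinsAt, hS])
    obtain ⟨h3, h4⟩ := two (hsys hn) hj
    refine ⟨h3.trans (Reach.of_mem (hsys hm)).symm, fun ε hε => ?_⟩
    have h5 := hε _ _ _ (hsys hm)
    rw [h4 ε hε] at h5
    rw [neg_mul, h5, neg_neg]
  | disoriented_out p q c s hp hq hS =>
    obtain ⟨hx, h1, h2⟩ := hpq hp hq
    have hj : (Pt.cr c true true, Pt.cr c false true, (0 : ℤ)) ∈ L.stateSystem S :=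
      hjoin hx (by simp [joinsAt, hS])
    rw [h1.start_outEdge, h2.start_outEdge]
    exact ⟨Reach.of_mem hj, fun ε hε => by rw [hε _ _ _ hj, neg_mul, one_mul]⟩

/-- The state curve on which a point lies. -/
def curveAt (L : OmegaDiagram) (S : Finset ℕ) : Pt → Set (L.Curve S)
  | .base i _ => {C | ∃ h : i < L.base.length, C = L.curveOf S ⟨⟨i, h⟩, 0⟩}
  | .cr c o b => {C | ∃ p, L.Passes p c o ∧
      C = L.curveOf S (cond b (L.outEdge p) (L.inEdge p))}
  | .hole _ _ => ∅

theorem Passes.curveAt {p : L.Pos} {c : ℕ} {o : Bool} (h : L.Passes p c o) (b : Bool) :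
    L.curveAt S (.cr c o b) = {L.curveOf S (cond b (L.outEdge p) (L.inEdge p))} := by
  ext C
  constructor
  · rintro ⟨q, hq, rfl⟩
    rw [h.unique hq]
    rfl
  · rintro rfl
    exact ⟨p, h, rfl⟩

theorem curveAt_base (i : Fin L.base.length) (b : Bool) :
    L.curveAt S (.base i b) = {L.curveOf S ⟨i, 0⟩} := by
  ext C
  constructor
  · rintro ⟨_, rfl⟩; rfl
  · rintro rfl; exact ⟨i.2, rfl⟩

theorem curveAt_start (e : L.Edge) : L.curveAt S (L.start e) = {L.curveOf S e} := by
  rcases start_cases S e with ⟨h1, h2⟩ | ⟨p, c, o, h, h1, h2⟩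
  · rw [h1, h2, curveAt_base]
  · rw [h1, h2, h.curveAt]
    rfl

theorem curveOf_eq {e e' : L.Edge} {δ : ℤˣ} (h : L.Join S e e' δ) : L.curveOf S e = L.curveOf S e' :=
  Quot.sound ⟨δ, h⟩

theorem curveAt_eq {x y : Pt} {n : ℤ} (h : (x, y, n) ∈ L.stateSystem S) :
    L.curveAt S x = L.curveAt S y := by
  rcases mem_stateSystem.1 h with ⟨⟨c, s⟩, hx, hb⟩ | hb
  · obtain ⟨p, q, hp, hq, hP, hQ⟩ := exists_passes hx
    unfold joinsAt at hb
    split_ifs at hb with hS <;> simp only [List.mem_cons, List.not_mem_nil, or_false,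
      Prod.mk.injEq] at hb
    · rcases hb with ⟨rfl, rfl, -⟩ | ⟨rfl, rfl, -⟩
      · rw [hP.curveAt, hQ.curveAt]
        exact congrArg _ (curveOf_eq (.oriented_over p q c s hp hq hS))
      · rw [hP.curveAt, hQ.curveAt]
        exact congrArg _ (curveOf_eq (.oriented_under p q c s hp hq hS))
    · rcases hb with ⟨rfl, rfl, -⟩ | ⟨rfl, rfl, -⟩
      · rw [hP.curveAt, hQ.curveAt]
        exact congrArg _ (curveOf_eq (.disoriented_in p q c s hp hq hS))
      · rw [hP.curveAt, hQ.curveAt]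
        exact congrArg _ (curveOf_eq (.disoriented_out p q c s hp hq hS))
  · rcases mem_system hb with ⟨i, rfl, rfl⟩ | ⟨i, rfl, rfl⟩ | ⟨p, c, o, hP, rfl, rfl⟩
    · rw [curveAt_base, curveAt_base]
    · rw [curveAt_base, curveAt_start]
      exact congrArg _ (curveOf_eq (.close i))
    · rw [curveAt_start, hP.curveAt]
      rfl

/-- In one direction `curveAt` is constant along bonds; in the other, joins are paths of bonds. So
the state curves are the components of the system. -/
theorem reach_start_iff {e e' : L.Edge} :
    Reach (L.stateSystem S) (L.start e) (L.start e') ↔ L.curveOf S e = L.curveOf S e' := by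
  constructor
  · intro h
    have := Reach.invariant (g := L.curveAt S) (fun x y n => curveAt_eq) h
    rw [curveAt_start, curveAt_start] at this
    exact Set.singleton_injective this
  · intro h
    replace h := Quot.eqvGen_exact h
    induction h with
    | rel e e' h => obtain ⟨δ, h⟩ := h; exact h.reach.1
    | refl e => exact Reach.refl _ _
    | symm _ _ _ ih => exact ih.symm
    | trans _ _ _ _ _ ih₁ ih₂ => exact ih₁.trans ih₂

theorem Passes.mem_ends {p : L.Pos} {c : ℕ} {o : Bool} (h : L.Passes p c o) (b : Bool) :
    Pt.cr c o b ∈ ends (L.stateSystem S) := by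
  obtain ⟨s, hs⟩ := h.exists_pair
  rw [stateSystem, ends_append, List.mem_append, (ends_stateJoins S _).mem_iff, List.mem_flatMap]
  refine Or.inl ⟨_, hs, ?_⟩
  cases o <;> cases b <;> simp

theorem start_mem_ends (e : L.Edge) : L.start e ∈ ends (L.stateSystem S) := by
  rcases start_cases S e with ⟨h1, _⟩ | ⟨p, c, o, h, h1, _⟩
  · rw [h1]
    exact right_mem_ends (mem_stateSystem.2 (Or.inr (mem_system_close e.1)))
  · rw [h1]
    exact h.mem_ends true

/-- No component is missed by the edges: every point that occurs lies on the component of the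
starting point of some edge. -/
theorem exists_reach_start {x : Pt} (hx : x ∈ ends (L.stateSystem S)) :
    ∃ e, Reach (L.stateSystem S) x (L.start e) := by
  have hsys : ∀ {b : Bond Pt}, b ∈ L.system → b ∈ L.stateSystem S := fun hb =>
    mem_stateSystem.2 (Or.inr hb)
  have hcr : ∀ {p : L.Pos} {c : ℕ} {o : Bool}, L.Passes p c o → ∀ b,
      ∃ e, Reach (L.stateSystem S) (.cr c o b) (L.start e) := by
    intro p c o h b
    cases b
    · obtain ⟨n, hn⟩ := h.mem_system
      exact ⟨_, (Reach.of_mem (hsys hn)).symm⟩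
    · exact ⟨L.outEdge p, by rw [h.start_outEdge]; exact Reach.refl _ _⟩
  have hbase : ∀ (i : Fin L.base.length) b, ∃ e, Reach (L.stateSystem S) (.base i b) (L.start e) := by
    intro i b
    cases b
    · exact ⟨⟨i, 0⟩, Reach.of_mem (hsys (mem_system_close i))⟩
    · exact ⟨⟨i, 0⟩, Reach.refl _ _⟩
  rw [stateSystem, ends_append, List.mem_append, (ends_stateJoins S _).mem_iff,
    List.mem_flatMap] at hx
  rcases hx with ⟨⟨c, s⟩, hx, h⟩ | hx
  · obtain ⟨p, q, _, _, hP, hQ⟩ := exists_passes hx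
    simp only [List.mem_cons, List.not_mem_nil, or_false] at h
    rcases h with rfl | rfl | rfl | rfl
    · exact hcr hP _
    · exact hcr hP _
    · exact hcr hQ _
    · exact hcr hQ _
  · obtain ⟨y, n, h | h⟩ := Virt.mem_ends.1 hx
    · rcases mem_system h with ⟨i, rfl, rfl⟩ | ⟨i, rfl, rfl⟩ | ⟨p, c, o, hP, rfl, rfl⟩
      · exact hbase i _
      · exact ⟨_, Reach.refl _ _⟩
      · exact ⟨_, Reach.refl _ _⟩
    · rcases mem_system h with ⟨i, rfl, rfl⟩ | ⟨i, rfl, rfl⟩ | ⟨p, c, o, hP, rfl, rfl⟩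
      · exact hbase i _
      · exact hbase i _
      · exact hcr hP _

/-! ### Orientations -/

theorem isOrientation_of_bip {ε : Pt → ℤˣ} (h : Bip (L.stateSystem S) ε) :
    L.IsOrientation S fun e => ε (L.start e) := fun _ _ _ hj => hj.reach.2 ε h

theorem IsOrientation.mul_eq {ε ε' : L.Edge → ℤˣ} (h : L.IsOrientation S ε)
    (h' : L.IsOrientation S ε') {e e' : L.Edge} (he : L.curveOf S e = L.curveOf S e') :
    ε e * ε' e = ε e' * ε' e' := by
  replace he := Quot.eqvGen_exact he
  induction he with
  | rel e e' hj =>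
    obtain ⟨δ, hj⟩ := hj
    rw [h _ _ _ hj, h' _ _ _ hj, mul_mul_mul_comm, Int.units_mul_self, one_mul]
  | refl e => rfl
  | symm _ _ _ ih => exact ih.symm
  | trans _ _ _ _ _ ih₁ ih₂ => exact ih₁.trans ih₂

/-- Two orientations differ on one curve by a single sign, since the factors `δ` cancel in their
product. -/
theorem vlk_natAbs_eq {ε ε' : L.Edge → ℤˣ} (h : L.IsOrientation S ε)
    (h' : L.IsOrientation S ε') (C : L.Curve S) :
    (L.vlk S ε C).natAbs = (L.vlk S ε' C).natAbs := by
  classical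
  obtain ⟨e, rfl⟩ := Quot.mk_surjective C
  have key : L.vlk S ε (Quot.mk _ e) = ((ε e * ε' e : ℤˣ) : ℤ) * L.vlk S ε' (Quot.mk _ e) := by
    unfold vlk
    rw [Finset.mul_sum]
    refine Finset.sum_congr rfl fun p _ => ?_
    rcases L.letter p with ⟨c, s⟩ | ⟨c, s⟩ | c
    · simp
    · dsimp only
      split_ifs with hp
      · have := h.mul_eq h' (show L.curveOf S e = L.curveOf S (L.inEdge p) from hp.2.symm)
        rw [this, ← Units.val_mul]
        congr 1
        have h2 : ε' (L.inEdge p) * ε' (L.inEdge p) = 1 := Int.units_mul_self _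
        calc s * ε (L.inEdge p) = s * ε (L.inEdge p) * (ε' (L.inEdge p) * ε' (L.inEdge p)) := by
              rw [h2, mul_one]
          _ = _ := by ac_rfl
      · rw [mul_zero]
    · simp
  rw [key, Int.natAbs_mul, Int.units_natAbs, one_mul]

end Curves

end OmegaDiagram

/-! ### Orientability -/

section Orientability

/-- The strands of a system, without the bonds between their ends. -/
def openSys : ℕ → List (List (Tok Pt)) → List (Bond Pt)
  | _, [] => []
  | i, w :: G => arcs (.base i true) 0 w (.base i false) ++ openSys (i + 1) G

/-- The bonds between the ends of the strands of a system. -/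
def closings (i n : ℕ) : List (Bond Pt) :=
  (List.range' i n).map fun j => (.base j false, .base j true, 0)

/-- The ends of the strands of a system. -/
def basePts (i n : ℕ) : List Pt := (List.range' i n).flatMap fun j => [.base j false, .base j true]

theorem sys_perm_openSys (i : ℕ) (G : List (List (Tok Pt))) :
    (sys i G).Perm (closings i G.length ++ openSys i G) := by
  induction G generalizing i with
  | nil => exact List.Perm.nil
  | cons w G ih =>
    rw [sys_cons, loopAt]
    refine (List.Perm.append_left _ (ih (i + 1))).trans ?_
    apply Multiset.coe_eq_coe.1
    simp only [closings, openSys, List.length_cons, List.range'_succ, List.map_cons,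
      ← Multiset.coe_add, ← Multiset.cons_coe, ← Multiset.singleton_add, Multiset.coe_nil, add_zero]
    abel

theorem ends_closings (i n : ℕ) : ends (closings i n) = basePts i n := by
  rw [ends, closings, basePts, List.flatMap_map]

theorem ends_openSys (i : ℕ) (G : List (List (Tok Pt))) :
    (ends (openSys i G)).Perm (basePts i G.length ++ tokPts G.flatten) := by
  induction G generalizing i with
  | nil => exact List.Perm.nil
  | cons w G ih =>
    rw [openSys, ends_append, List.flatten_cons, tokPts_append]
    refine (List.Perm.append (ends_arcs _ _ _ _) (ih (i + 1))).trans ?_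
    apply Multiset.coe_eq_coe.1
    simp only [basePts, List.length_cons, List.range'_succ, List.flatMap_cons,
      ← Multiset.coe_add, ← Multiset.cons_coe, ← Multiset.singleton_add, Multiset.coe_nil, add_zero]
    abel

theorem nodup_basePts (i n : ℕ) : (basePts i n).Nodup := by
  rw [basePts, List.nodup_flatMap]
  refine ⟨fun j _ => by simp, (List.nodup_range' (s := i) (n := n)).imp fun {a b} hab => ?_⟩
  simp only [Function.onFun, List.disjoint_cons_left, List.mem_cons]
  simp [hab]

theorem mem_basePts {i n : ℕ} {p : Pt} (h : p ∈ basePts i n) : ∃ j b, p = .base j b := by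
  simp only [basePts, List.mem_flatMap, List.mem_cons, List.not_mem_nil, or_false] at h
  obtain ⟨j, _, rfl | rfl⟩ := h <;> exact ⟨_, _, rfl⟩

theorem count_tokPts_tok (O w : List Letter) (c : ℕ) (o b : Bool) :
    (tokPts (w.map (tok O))).count (.cr c o b) ≤ w.countP (Letter.isAt c o) := by
  induction w with
  | nil => simp
  | cons l w ih =>
    have hpass : ∀ c' o', (tokPts ((passTok c' o') :: w.map (tok O))).count (.cr c o b) =
        (tokPts (w.map (tok O))).count (.cr c o b) + if c' = c ∧ o' = o then 1 else 0 := by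
      intro c' o'
      simp only [passTok, tokPts_pass, List.count_cons, add_assoc]
      congr 1
      by_cases h1 : c' = c <;> by_cases h2 : o' = o <;> cases b <;> simp [h1, h2]
    rw [List.map_cons, List.countP_cons]
    rcases l with ⟨c', s⟩ | ⟨c', s⟩ | c'
    · rw [tok, hpass]
      cases o <;> simp [Letter.isAt, ih]
    · by_cases hO : Letter.over c' s ∈ O
      · rw [tok, if_pos hO]
        exact ih.trans (Nat.le_add_right _ _)
      · rw [tok, if_neg hO, hpass]
        cases o <;> simp [Letter.isAt, ih]
    · exact ih.trans (Nat.le_add_right _ _)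

theorem mem_tokPts_tok {O w : List Letter} {p : Pt} (h : p ∈ tokPts (w.map (tok O))) :
    ∃ c o b, p = .cr c o b := by
  rw [List.map_eq_flatMap] at h
  obtain ⟨l, _, hp⟩ := mem_tokPts_flatMap.1 h
  obtain ⟨o, b, h⟩ := labelled_tok O l p hp
  exact ⟨_, o, b, h⟩

namespace OmegaDiagram

variable (L : OmegaDiagram) (S : Finset ℕ)

theorem nodup_overs : ((overs L.base).map Prod.fst).Nodup :=
  nodup_overData fun c => L.countP_base_le c true

/-- Each end of a crossing and each base point lies on exactly one strand and on exactly one join or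
closing bond. The system is therefore a union of two matchings, and the cycles of such a union are
even. No planarity is needed for orienting state curves. -/
theorem exists_bip_stateSystem : ∃ ε, Bip (L.stateSystem S) ε := by
  set G := L.base.map fun w => w.map (tok L.omega) with hG
  have hGf : G.flatten = L.base.flatten.map (tok L.omega) := by
    rw [hG, List.map_flatten]
  have hJ := (ends_stateJoins S (overs L.base)).append
    (List.Perm.refl (basePts 0 G.length))
  have hB := ends_openSys 0 G
  rw [hGf] at hB
  have hcr : ∀ {p}, p ∈ ((overs L.base).flatMap fun x => [Pt.cr x.1 true false, .cr x.1 true true,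
      .cr x.1 false false, .cr x.1 false true]) → ∃ x ∈ overs L.base, ∃ o b, p = .cr x.1 o b := by
    intro p hp
    obtain ⟨x, hx, hp⟩ := List.mem_flatMap.1 hp
    simp only [List.mem_cons, List.not_mem_nil, or_false] at hp
    rcases hp with rfl | rfl | rfl | rfl <;> exact ⟨x, hx, _, _, rfl⟩
  suffices h : ∃ ε, Bip (stateJoins S (overs L.base) ++ closings 0 G.length ++ openSys 0 G) ε by
    obtain ⟨ε, hε⟩ := h
    refine ⟨ε, hε.perm ?_⟩
    rw [stateSystem, system_eq, List.append_assoc]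
    exact (sys_perm_openSys 0 G).symm.append_left _
  refine exists_bip_matchings _ _ ?_ ?_ ?_
  · rw [ends_append, ends_closings, hJ.nodup_iff, List.nodup_append]
    refine ⟨?_, nodup_basePts _ _, ?_⟩
    · rw [List.nodup_flatMap]
      refine ⟨fun x _ => by simp, ?_⟩
      have := List.pairwise_map.1 L.nodup_overs
      refine this.imp fun {x y} hxy => ?_
      simp only [Function.onFun, List.disjoint_cons_left, List.mem_cons]
      simp [hxy]
    · intro p hp q hq e
      obtain ⟨x, _, o, b, rfl⟩ := hcr hp
      obtain ⟨j, b', h⟩ := mem_basePts hq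
      rw [h] at e
      cases e
  · rw [hB.nodup_iff, List.nodup_append]
    refine ⟨nodup_basePts _ _, ?_, ?_⟩
    · rw [List.nodup_iff_count_le_one]
      intro p
      by_cases hp : p ∈ tokPts (L.base.flatten.map (tok L.omega))
      · obtain ⟨c, o, b, rfl⟩ := mem_tokPts_tok hp
        exact (count_tokPts_tok _ _ _ _ _).trans (L.countP_base_le c o)
      · rw [List.count_eq_zero_of_not_mem hp]
        exact Nat.zero_le _
    · intro p hp q hq e
      obtain ⟨j, b', rfl⟩ := mem_basePts hp
      obtain ⟨c, o, b, h⟩ := mem_tokPts_tok hq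
      rw [h] at e
      cases e
  · intro p hp
    rw [ends_append, ends_closings, hJ.mem_iff, List.mem_append] at hp
    rw [hB.mem_iff, List.mem_append]
    rcases hp with hp | hp
    · right
      obtain ⟨⟨c, s⟩, hx, o, b, rfl⟩ := hcr hp
      obtain ⟨p, q, _, _, hP, hQ⟩ := exists_passes hx
      have hmem : ∀ {p : L.Pos} {c o}, L.Passes p c o →
          Pt.cr c o b ∈ tokPts (L.base.flatten.map (tok L.omega)) := by
        intro p c o h
        refine mem_tokPts_of_mem (t := passTok c o) ?_ ?_
        · rw [← show tok L.omega (L.letter p) = passTok c o from h]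
          exact List.mem_map_of_mem (L.mem_base.2 ⟨p, rfl⟩)
        · cases b <;> simp [passTok]
      cases o
      · exact hmem hQ
      · exact hmem hP
    · exact Or.inl hp

theorem nonempty_orientations : Nonempty L.Orientations :=
  ⟨fun S => ⟨_, isOrientation_of_bip (L.exists_bip_stateSystem S).choose_spec⟩⟩

end OmegaDiagram

end Orientability

/-! ### The bracket as a sum over states -/

section Bracket

namespace OmegaDiagram

variable {L : OmegaDiagram} {S : Finset ℕ}

theorem total_stateJoins (S : Finset ℕ) (Cs : List (ℕ × ℤˣ)) (ε : Pt → ℤˣ) (C : Set Pt) :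
    total (stateJoins S Cs) ε C = 0 := by
  apply List.sum_eq_zero
  intro n hn
  obtain ⟨b, hb, rfl⟩ := List.mem_map.1 hn
  obtain ⟨x, _, hb⟩ := List.mem_flatMap.1 hb
  have : b.2.2 = 0 := by
    unfold joinsAt at hb
    split_ifs at hb <;> simp only [List.mem_cons, List.not_mem_nil, or_false] at hb <;>
      rcases hb with rfl | rfl <;> rfl
  rw [this, mul_zero, ite_self]

open Classical in
theorem total_system (ε : Pt → ℤˣ) (C : Set Pt) : total L.system ε C =
    ∑ p, if L.start (L.inEdge p) ∈ C then
      (ε (L.start (L.inEdge p)) : ℤ) * (tok L.omega (L.letter p)).weight else 0 := by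
  have h0 : ∀ i, total [(Pt.base i false, Pt.base i true, (0 : ℤ))] ε C = 0 := by
    intro i
    simp [total]
  rw [system_eq, total_sys]
  refine Eq.trans ?_ (Fintype.sum_sigma (fun p : L.Pos => if L.start (L.inEdge p) ∈ C then
      (ε (L.start (L.inEdge p)) : ℤ) * (tok L.omega (L.letter p)).weight else 0)).symm
  refine Finset.sum_congr rfl fun i _ => ?_
  rw [loopAt, total_append, h0, add_zero, total_arcs, mul_zero, ite_self, zero_add, zero_add]
  rfl

/-- The only tokens with nonzero weight are the passages under `ω`, whose weight is the sign of the
crossing; joins weigh nothing. -/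
theorem total_stateSystem (ε : Pt → ℤˣ) (e : L.Edge) :
    total (L.stateSystem S) ε (comp (L.stateSystem S) (L.start e)) =
      L.vlk S (fun e => ε (L.start e)) (L.curveOf S e) := by
  classical
  rw [stateSystem, total_append, total_stateJoins, zero_add, total_system]
  unfold vlk
  refine Finset.sum_congr rfl fun p _ => ?_
  have h : L.start (L.inEdge p) ∈ comp (stateJoins S (overs L.base) ++ L.system) (L.start e) ↔
      L.curveOf S (L.inEdge p) = L.curveOf S e := by
    rw [mem_comp, eq_comm]
    exact reach_start_iff
  rw [if_congr h rfl rfl]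
  rcases L.letter p with ⟨c, s⟩ | ⟨c, s⟩ | c
  · simp [tok, passTok, Tok.weight]
  · by_cases hω : Letter.over c s ∈ L.omega
    · simp only [tok, hω, if_true, Tok.weight, true_and, Units.val_mul]
      rw [mul_comm]
    · simp [tok, hω, passTok, Tok.weight]
  · simp [tok, Tok.weight]

/-- Curves and components are both quotients of the set of edges by the same relation, and any
orientation may be replaced by the one coming from a sign function on points. -/
theorem prod_curves {R : Type} [CommRing R] (f : ℕ → R) {ε : L.Edge → ℤˣ}
    (h : L.IsOrientation S ε) :
    ∏ C : L.Curve S, f (L.vlk S ε C).natAbs = val f (L.stateSystem S) := by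
  classical
  obtain ⟨ε', hε'⟩ := L.exists_bip_stateSystem S
  rw [val_eq f hε', valWith]
  have e1 : (ends (L.stateSystem S)).toFinset.image (comp (L.stateSystem S)) =
      Finset.univ.image fun e => comp (L.stateSystem S) (L.start e) := by
    ext C
    simp only [Finset.mem_image, List.mem_toFinset, Finset.mem_univ, true_and]
    constructor
    · rintro ⟨x, hx, rfl⟩
      obtain ⟨e, he⟩ := exists_reach_start hx
      exact ⟨e, comp_eq_iff.2 he.symm⟩
    · rintro ⟨e, rfl⟩
      exact ⟨_, start_mem_ends e, rfl⟩
  have e2 : (Finset.univ : Finset (L.Curve S)) = Finset.univ.image (L.curveOf S) :=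
    (Finset.image_univ_of_surjective (f := L.curveOf S) Quot.mk_surjective).symm
  have key := prod_image_congr Finset.univ (L.curveOf S)
    (fun e => comp (L.stateSystem S) (L.start e)) (fun C => f (L.vlk S ε C).natAbs)
    (fun C => f (total (L.stateSystem S) ε' C).natAbs) ?_ ?_
  · rw [← e1, ← e2] at key
    convert key
  · intro e _ e' _
    rw [comp_eq_iff, reach_start_iff]
  · intro e _
    rw [total_stateSystem, vlk_natAbs_eq h (isOrientation_of_bip hε')]

end OmegaDiagram

end Bracket

/-! ### The ring of the Zh-polynomial -/

section Ring

/-- The value of a curve without linking. -/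
noncomputable def loopValue : ZhRing := -Apow 2 - Apow (-2)

/-- The coefficient of a smoothing. -/
noncomputable def smoothing (s : ℤˣ) : ZhRing := Apow s

/-- The contribution of a curve with the given linking number. -/
noncomputable def curveValue (n : ℕ) : ZhRing := loopValue * Z (n / 2)

theorem smoothing_mul : smoothing 1 * smoothing (-1) = 1 := by
  rw [smoothing, smoothing, ← Apow_add]
  exact Apow_zero

theorem curveValue_zero : curveValue 0 = -smoothing 1 ^ 2 - smoothing (-1) ^ 2 := by
  have h : Z (0 / 2) = 1 := dif_neg (lt_irrefl 0)
  rw [curveValue, h, mul_one, smoothing, smoothing, pow_two, pow_two, ← Apow_add, ← Apow_add]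
  rfl

instance : IsDomain ZhRing := inferInstanceAs (IsDomain (LaurentPolynomial (MvPolynomial ℕ+ ℤ)))

theorem loopValue_ne_zero : loopValue ≠ 0 := by
  intro h
  have h2 : (-LaurentPolynomial.T 2 - LaurentPolynomial.T (-2) :
    LaurentPolynomial (MvPolynomial ℕ+ ℤ)) = 0 := h
  -- The coefficient of `A²` is `-1`.
  have h3 := congrArg (fun p : LaurentPolynomial (MvPolynomial ℕ+ ℤ) => p.coeff 2) h2
  simp at h3

theorem loopValue_mul_cancel {x y : ZhRing} (h : loopValue * x = loopValue * y) : x = y :=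
  mul_left_cancel₀ loopValue_ne_zero h

end Ring

/-! ### The bracket and the polynomial as state sums -/

section Bracket

/-- The normalized sum over all states of the crossings `Cs` in a system. -/
noncomputable def normalized (Cs : List (ℕ × ℤˣ)) (B : List (Bond Pt)) : ZhRing :=
  (((-unitA) ^ (-3 * (Cs.map fun x => (x.2 : ℤ)).sum) : ZhRingˣ) : ZhRing) *
    crossingSum smoothing curveValue Cs B

namespace OmegaDiagram

variable {L : OmegaDiagram}

theorem crossings_eq (L : OmegaDiagram) : L.crossings = ((overs L.base).map Prod.fst).toFinset := by
  rw [crossings, overs, List.map_filterMap]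
  congr 2
  funext l
  cases l <;> rfl

/-- A nonempty base has an edge. This makes the natural-number exponent `|S| - 1` in the bracket a
genuine difference. -/
theorem one_le_card_curve (L : OmegaDiagram) (S : Finset ℕ) : 1 ≤ Fintype.card (L.Curve S) := by
  have : Nonempty (L.Curve S) :=
    ⟨L.curveOf S ⟨⟨0, List.length_pos_of_ne_nil L.nonempty⟩, 0⟩⟩
  exact Fintype.card_pos

/-- The additional factor completes `|S| - 1` loop values to `|S|`, one for each curve, so that
every state contributes a product over its curves and local laws can be used. -/
theorem loopValue_mul_bracket (o : L.Orientations) : loopValue * L.bracket o =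
    crossingSum smoothing curveValue (overs L.base) L.system := by
  rw [crossingSum_eq_sum _ _ _ L.nodup_overs, ← crossings_eq, bracket, Finset.mul_sum]
  refine Finset.sum_congr rfl fun S hS => ?_
  have hS := Finset.mem_powerset.1 hS
  have e1 : ∏ c ∈ L.crossings, smoothing (if c ∈ S then 1 else -1) =
      Apow ((S.card : ℤ) - ((L.crossings \ S).card : ℤ)) := by
    have hpow : ∀ (s : ℤˣ) (n : ℕ), smoothing s ^ n = Apow (n * s) := by
      intro s n
      induction n with
      | zero => rw [pow_zero, Nat.cast_zero, zero_mul, Apow_zero]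
      | succ n ih => rw [pow_succ, ih, smoothing, ← Apow_add]; congr 1; push_cast; ring
    rw [← Finset.prod_sdiff hS, Finset.prod_congr rfl (g := fun _ => smoothing (-1)),
      Finset.prod_congr (s₁ := S) rfl (g := fun _ => smoothing 1), Finset.prod_const,
      Finset.prod_const, hpow, hpow, ← Apow_add]
    · congr 1
      push_cast
      ring
    · intro c hc; rw [if_pos hc]
    · intro c hc; rw [if_neg (Finset.mem_sdiff.1 hc).2]
  have e2 : val curveValue (L.stateSystem S) =
      loopValue ^ Fintype.card (L.Curve S) * L.weight S (o S) := by
    rw [← prod_curves curveValue (o S).2]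
    unfold curveValue weight
    rw [Finset.prod_mul_distrib, Finset.prod_const, Finset.card_univ]
  rw [e1]
  change _ = _ * val curveValue (L.stateSystem S)
  rw [e2]
  obtain ⟨n, hn⟩ := Nat.exists_eq_add_of_le (L.one_le_card_curve S)
  rw [hn, Nat.add_sub_cancel_left, pow_add, pow_one]
  change loopValue * (_ * loopValue ^ n * _) = _
  ring

theorem bracket_eq_of_crossingSum {L' : OmegaDiagram} (o : L.Orientations) (o' : L'.Orientations)
    (h : crossingSum smoothing curveValue (overs L.base) L.system =
      crossingSum smoothing curveValue (overs L'.base) L'.system) : L.bracket o = L'.bracket o' :=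
  loopValue_mul_cancel (by rw [loopValue_mul_bracket, loopValue_mul_bracket, h])

theorem bracket_eq (o o' : L.Orientations) : L.bracket o = L.bracket o' :=
  bracket_eq_of_crossingSum o o' rfl

theorem polynomial_eq (o o' : L.Orientations) : L.polynomial o = L.polynomial o' := by
  rw [polynomial, polynomial, bracket_eq o o']

theorem writhe_eq (L : OmegaDiagram) : L.writhe = ((overs L.base).map fun x => (x.2 : ℤ)).sum := by
  rw [writhe, overs]
  induction L.base.flatten with
  | nil => rfl
  | cons l w ih =>
    rcases l with ⟨c, s⟩ | ⟨c, s⟩ | c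
    · rw [List.filterMap_cons_some (f := Letter.overData) (b := (c, s)) rfl, List.map_cons,
        List.map_cons, List.sum_cons, List.sum_cons, ih]
    · rw [List.filterMap_cons_none (f := Letter.overData) rfl, List.map_cons, List.sum_cons, ih,
        zero_add]
    · rw [List.filterMap_cons_none (f := Letter.overData) rfl, List.map_cons, List.sum_cons, ih,
        zero_add]

theorem loopValue_mul_polynomial (o : L.Orientations) :
    loopValue * L.polynomial o = normalized (overs L.base) L.system := by
  rw [polynomial, mul_left_comm, loopValue_mul_bracket, writhe_eq, normalized]

theorem polynomial_eq_of_normalized {L' : OmegaDiagram} (o : L.Orientations) (o' : L'.Orientations)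
    (h : normalized (overs L.base) L.system = normalized (overs L'.base) L'.system) :
    L.polynomial o = L'.polynomial o' :=
  loopValue_mul_cancel (by rw [loopValue_mul_polynomial, loopValue_mul_polynomial, h])

end OmegaDiagram

theorem normalized_perm {Cs Cs' : List (ℕ × ℤˣ)} (h : Cs.Perm Cs') : normalized Cs = normalized Cs' := by
  funext B
  rw [normalized, normalized, crossingSum_perm _ _ h, (h.map _).sum_eq]

/-- The exponent is odd, so `(-A) ^ (3 s) = -A ^ (3 s)`, which is the factor of a curl; the change
of the writhe removes it. -/
theorem normalized_curl {c : ℕ} {s : ℤˣ} {Cs : List (ℕ × ℤˣ)} {B B' : List (Bond Pt)}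
    (h : crossingSum smoothing curveValue ((c, s) :: Cs) B =
      -smoothing s ^ 3 * crossingSum smoothing curveValue Cs B') :
    normalized ((c, s) :: Cs) B = normalized Cs B' := by
  have e : (((-unitA) ^ (3 * (s : ℤ)) : ZhRingˣ) : ZhRing) = -smoothing s ^ 3 := by
    rcases Int.units_eq_one_or s with rfl | rfl
    · have : ((-unitA) ^ (3 * ((1 : ℤˣ) : ℤ)) : ZhRingˣ) = (-unitA) ^ 3 := rfl
      rw [this, Units.val_pow_eq_pow_val, Units.val_neg, Odd.neg_pow (by decide)]
      rfl
    · have : ((-unitA) ^ (3 * ((-1 : ℤˣ) : ℤ)) : ZhRingˣ) = ((-unitA)⁻¹) ^ 3 := by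
        rw [inv_pow, ← zpow_natCast, ← zpow_neg]
        rfl
      rw [this, Units.val_pow_eq_pow_val, inv_neg, Units.val_neg, Odd.neg_pow (by decide)]
      rfl
  rw [normalized, normalized, h, ← e, ← mul_assoc, ← Units.val_mul, ← zpow_add, List.map_cons,
    List.sum_cons]
  congr 4
  ring

end Bracket

/-! ### Filled templates -/

section Fill

variable {k : ℕ}

theorem TokEq.pad (w : List (Tok Pt)) : TokEq w (.wt 0 :: (w ++ [.wt 0])) := by
  intro x n y
  have h1 : TokEq (w ++ [.wt 0]) w := by
    have : TokEq [.wt 0] ([] : List (Tok Pt)) := fun x n y => by simp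
    simpa using this.prepend w
  simpa using (h1 x n y).symm

theorem Template.Linear.perm_holes {T : Template k} (hT : T.Linear) :
    (List.finRange k).Perm (holes T) := by
  rw [List.perm_iff_count]
  intro i
  have h1 : ∀ w : List (Letter ⊕ Fin k), (wordHoles w).count i = w.count (Sum.inr i) := by
    intro w
    induction w with
    | nil => rfl
    | cons t w ih =>
      rcases t with l | j
      · have : wordHoles (Sum.inl l :: w) = wordHoles w := rfl
        have e : ((Sum.inl l : Letter ⊕ Fin k) == Sum.inr i) = false := rfl
        rw [this, ih, List.count_cons, e]
        rfl
      · have : wordHoles (Sum.inr j :: w) = j :: wordHoles w := rfl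
        have e : ((Sum.inr j : Letter ⊕ Fin k) == Sum.inr i) = (j == i) := rfl
        rw [this, List.count_cons, List.count_cons, ih, e]
  rw [holes, h1, hT i]
  exact List.count_eq_one_of_mem (List.nodup_finRange k) (List.mem_finRange i)

theorem filterMap_fill_perm {T : Template k} {hs : List (Fin k)} (h : hs.Perm (holes T))
    (g : Fin k → List Letter) : (overs (T.fill g)).Perm (hs.flatMap (fun i =>
      (g i).filterMap Letter.overData) ++ (letters T).filterMap Letter.overData) := by
  refine ((fill_flatten_perm T g).filterMap _).trans ?_
  rw [List.filterMap_append]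
  refine List.perm_append_comm.trans (List.Perm.append_right _ ?_)
  refine ((h.symm.flatMap_right g).filterMap _).trans ?_
  rw [List.filterMap_flatMap]

/-- A crossing that is passed twice in a part of a code is not passed in the other part. -/
theorem Code.WF.label_ne {G : Code} (h : G.WF) {U V : List Letter} (hG : G.flatten.Perm (U ++ V))
    {c : ℕ} {s : ℤˣ} (h₁ : Letter.over c s ∈ V) (h₂ : Letter.under c s ∈ V) :
    ∀ l ∈ U, l.label ≠ c := by
  intro l hl e
  have hc : Letter.over c s ∈ G.flatten := hG.mem_iff.2 (List.mem_append_right _ h₁)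
  have hp := ((hG.filter fun x => decide (x.label = c)).symm.trans (h.perm_of_over hc)).length_eq
  rw [List.filter_append, List.length_append] at hp
  have h3 : 0 < (U.filter fun x => decide (x.label = c)).length :=
    List.length_pos_of_mem (List.mem_filter.2 ⟨hl, decide_eq_true e⟩)
  -- Both passages of `c` lie in `V`, and `c` has only two; none is left for `U`.
  have h4 : 2 ≤ (V.filter fun x => decide (x.label = c)).length := by
    have hsub : [Letter.over c s, Letter.under c s] ⊆ V.filter fun x => decide (x.label = c) := by
      intro x hx
      simp only [List.mem_cons, List.not_mem_nil, or_false] at hx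
      rcases hx with rfl | rfl
      · exact List.mem_filter.2 ⟨h₁, decide_eq_true rfl⟩
      · exact List.mem_filter.2 ⟨h₂, decide_eq_true rfl⟩
    exact (List.subperm_of_subset (by simp) hsub).length_le
  simp only [List.length_cons, List.length_nil] at hp
  omega

theorem Code.WF.label_ne_of_fill {T : Template k} (hT : T.Linear) {g : Fin k → List Letter}
    (h : Code.WF (T.fill g)) {c : ℕ} {s : ℤˣ} {i j : Fin k} (hi : Letter.over c s ∈ g i)
    (hj : Letter.under c s ∈ g j) : ∀ l ∈ letters T, l.label ≠ c := by
  have hm : ∀ i, i ∈ holes T := fun i => hT.perm_holes.mem_iff.1 (List.mem_finRange i)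
  exact h.label_ne (fill_flatten_perm T g) (List.mem_flatMap.2 ⟨i, hm i, hi⟩)
    (List.mem_flatMap.2 ⟨j, hm j, hj⟩)

theorem freshIn_of_label_ne {c : ℕ} {Cs : List (ℕ × ℤˣ)} {T : Template k}
    (h : ∀ l ∈ letters T, l.label ≠ c) (hc : ∀ x ∈ Cs, x.1 ≠ c) :
    FreshIn c (Cs ++ (letters T).filterMap Letter.overData) T := by
  refine ⟨fun x hx => ?_, h⟩
  rcases List.mem_append.1 hx with hx | hx
  · exact hc x hx
  · obtain ⟨l, hl, e⟩ := List.mem_filterMap.1 hx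
    rw [Letter.overData_eq] at e
    have := h l hl
    rw [e] at this
    exact this

end Fill

/-! ### Renaming, rotating and permuting -/

section SameCode

variable {R : Type} [CommRing R]

/-- Renaming of the crossings of points. -/
def Pt.rename (f : ℕ → ℕ) : Pt → Pt
  | .cr c o b => .cr (f c) o b
  | .base i b => .base i b
  | .hole i j => .hole i j

/-- Renaming of the crossings of tokens. -/
def Tok.rename (f : ℕ → ℕ) : Tok Pt → Tok Pt
  | .wt n => .wt n
  | .pass a b => .pass (a.rename f) (b.rename f)

theorem Pt.rename_injective {f : ℕ → ℕ} (hf : f.Injective) : (Pt.rename f).Injective := by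
  intro p q h
  cases p <;> cases q <;> simp_all [Pt.rename]
  exact hf h.1

/-- Renaming of the crossings of bonds. -/
def renameBonds (f : ℕ → ℕ) (B : List (Bond Pt)) : List (Bond Pt) :=
  B.map fun b => (b.1.rename f, b.2.1.rename f, b.2.2)

theorem arcs_rename (f : ℕ → ℕ) (x : Pt) (n : ℤ) (w : List (Tok Pt)) (y : Pt) :
    arcs (x.rename f) n (w.map (Tok.rename f)) (y.rename f) = renameBonds f (arcs x n w y) := by
  induction w generalizing x n with
  | nil => rfl
  | cons t w ih =>
    rcases t with m | ⟨a, b⟩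
    · exact ih x (n + m)
    · exact congrArg (List.cons _) (ih b 0)

theorem sys_rename (f : ℕ → ℕ) (i : ℕ) (G : List (List (Tok Pt))) :
    sys i (G.map fun w => w.map (Tok.rename f)) = renameBonds f (sys i G) := by
  induction G generalizing i with
  | nil => rfl
  | cons w G ih =>
    rw [List.map_cons, sys_cons, sys_cons, ih, loopAt, loopAt]
    have h1 := arcs_rename f (.base i true) 0 w (.base i false)
    simp only [Pt.rename] at h1
    rw [h1]
    simp [renameBonds, Pt.rename]

theorem crossingSum_rename (A : ℤˣ → R) (f : ℕ → R) {g : ℕ → ℕ} (hg : g.Injective)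
    (Cs : List (ℕ × ℤˣ)) (B : List (Bond Pt)) :
    crossingSum A f (Cs.map fun x => (g x.1, x.2)) (renameBonds g B) = crossingSum A f Cs B := by
  induction Cs generalizing B with
  | nil => exact val_rename f _ (Pt.rename_injective hg) B
  | cons x Cs ih =>
    obtain ⟨c, s⟩ := x
    rw [List.map_cons, crossingSum_cons, crossingSum_cons, Cross.apply, Cross.apply, ← ih, ← ih]
    rfl

/-- Renaming acts injectively on points, starting points move by `sys_rotate`, and components are
reordered by `sys_perm`. -/
theorem crossingSum_sameCode (A : ℤˣ → R) (f : ℕ → R) {g : ℕ → ℕ} (hg : g.Injective) {G G' : Code}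
    (h : SameCode g G G') {τ τ' : Letter → List (Tok Pt)} (hτ' : Labelled τ')
    (e : ∀ l ∈ G.flatten, τ' (l.relabel g) = (τ l).map (Tok.rename g)) :
    crossingSum A f (overs G') (codeSys τ' G') = crossingSum A f (overs G) (codeSys τ G) ∧
      (overs G').Perm ((overs G).map fun x => (g x.1, x.2)) := by
  obtain ⟨H, hGH, hHG'⟩ := h
  set G₁ : Code := G.map fun w => w.map (Letter.relabel g) with hG₁
  have hrot : List.Forall₂ List.IsRotated G₁ H := by
    rw [hG₁, List.forall₂_map_left_iff]
    exact hGH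
  have hNB : ∀ w : List Letter, NoBase (w.flatMap τ') := by
    intro w i b hp
    obtain ⟨l, _, hp⟩ := mem_tokPts_flatMap.1 hp
    obtain ⟨o, b', h⟩ := hτ' l _ hp
    cases h
  have hflat : ∀ {G H : Code}, List.Forall₂ List.IsRotated G H → G.flatten.Perm H.flatten := by
    intro G H h
    induction h with
    | nil => exact List.Perm.nil
    | cons h _ ih => exact h.perm.append ih
  have hov : (overs G₁).Perm (overs G') :=
    overs_perm ((hflat hrot).trans hHG'.flatten)
  have hov₁ : overs G₁ = (overs G).map fun x => (g x.1, x.2) := by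
    rw [hG₁, overs, overs, ← List.map_flatten, List.filterMap_map, List.map_filterMap]
    congr 1
    funext l
    cases l <;> rfl
  have hsys₁ : codeSys τ' G₁ = renameBonds g (codeSys τ G) := by
    rw [codeSys, codeSys, ← sys_rename, hG₁, List.map_map, List.map_map]
    congr 1
    apply List.map_congr_left
    intro w hw
    simp only [Function.comp, List.flatMap_map, List.map_flatMap]
    apply List.flatMap_congr
    intro l hl
    exact e l (List.mem_flatten_of_mem hw hl)
  have hlaw := lawful_crossingSum A f (overs G')
  have hN : ∀ i b, Pt.base i b ∉ crossingPts (overs G') := by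
    rintro i b ⟨x, _, o, b', h⟩
    cases h
  refine ⟨?_, (hov₁ ▸ hov).symm⟩
  rw [← crossingSum_rename A f hg (overs G), ← hsys₁, ← hov₁, crossingSum_perm A f hov]
  refine Eq.trans (hlaw.sys_perm (hHG'.symm.map _) ?_ 0 fun i b _ => hN i b)
    (hlaw.sys_rotate ?_ ?_ 0 fun i b _ => hN i b).symm
  · intro w hw
    obtain ⟨w, _, rfl⟩ := List.mem_map.1 hw
    exact hNB w
  · rw [List.forall₂_map_left_iff, List.forall₂_map_right_iff]
    refine hrot.imp fun w w' h => ?_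
    obtain ⟨n, rfl⟩ := h
    rw [List.rotate_eq_drop_append_take_mod]
    set m := n % w.length
    have e : w.flatMap τ' = (w.take m).flatMap τ' ++ (w.drop m).flatMap τ' := by
      rw [← List.flatMap_append, List.take_append_drop]
    rw [e, List.flatMap_append]
    exact List.isRotated_append
  · intro w hw
    obtain ⟨w, _, rfl⟩ := List.mem_map.1 hw
    exact hNB w

end SameCode

/-! ### Virtual crossings -/

section Virtual

/-- Whether a letter is the passage through a classical crossing. -/
def Letter.classical : Letter → Bool
  | .virt _ => false
  | _ => true

/-- Delete all passages through virtual crossings. -/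
def dropVirt (G : Code) : Code := G.map (List.filter Letter.classical)

theorem filter_classical_filterMap (w : List Letter) :
    (w.filter Letter.classical).filterMap Letter.overData = w.filterMap Letter.overData := by
  induction w with
  | nil => rfl
  | cons l w ih =>
    rcases l with ⟨c, s⟩ | ⟨c, s⟩ | c
    · exact congrArg (List.cons (c, s)) ih
    · exact ih
    · exact ih

theorem overs_dropVirt (G : Code) : overs (dropVirt G) = overs G := by
  rw [overs, overs, dropVirt, ← List.filter_flatten, filter_classical_filterMap]

theorem codeSys_dropVirt {τ : Letter → List (Tok Pt)} (hτ : ∀ c, TokEq (τ (.virt c)) []) (G : Code) :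
    codeSys τ (dropVirt G) = codeSys τ G := by
  unfold codeSys dropVirt
  rw [List.map_map]
  refine sys_congr 0 G _ _ fun w hw => ?_
  clear hw
  induction w with
  | nil => exact TokEq.refl _
  | cons l w ih =>
    rw [List.flatMap_cons]
    rcases l with ⟨c, s⟩ | ⟨c, s⟩ | c
    · exact ih.prepend _
    · exact ih.prepend _
    · exact ih.trans ((hτ c).symm.append_append (TokEq.refl _))

theorem filter_classical_fillWord {k : ℕ} (g : Fin k → List Letter) (hg : ∀ i, ∀ l ∈ g i,
    l.classical = false) (N : Finset ℕ) (w : List (Letter ⊕ Fin k))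
    (h : ∀ l, Sum.inl l ∈ w → l.label ∈ N → l.classical = false) :
    (fillWord g w).filter Letter.classical =
      (wordLetters (w.filter (Sum.elim (fun x => decide (x.label ∉ N)) fun _ => true))).filter
        Letter.classical := by
  induction w with
  | nil => rfl
  | cons t w ih =>
    have ih := ih fun l hl => h l (List.mem_cons_of_mem _ hl)
    rcases t with l | i
    · have e : fillWord g (Sum.inl l :: w) = l :: fillWord g w := rfl
      rw [e]
      by_cases hl : l.label ∈ N
      · rw [List.filter_cons_of_neg (by simp [h l List.mem_cons_self hl]),
          List.filter_cons_of_neg (by simp [hl]), ih]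
      · rw [List.filter_cons_of_pos (a := Sum.inl l) (by simp [hl])]
        have e' : ∀ v : List (Letter ⊕ Fin k), wordLetters (Sum.inl l :: v) = l :: wordLetters v :=
          fun v => rfl
        rw [e', List.filter_cons, List.filter_cons, ih]
    · have e : fillWord g (Sum.inr i :: w) = g i ++ fillWord g w := rfl
      rw [e, List.filter_append, List.filter_eq_nil_iff.2 (fun l hl => by simp [hg i l hl]),
        List.filter_cons_of_pos (by rfl), ih]
      rfl

/-- Every erased name belongs to a virtual passage of the arc, so by well-formedness all passages
with this name are virtual. Both codes thus become the same once all virtual passages are dropped.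
-/
theorem Detour.dropVirt_eq {G G' : Code} (h : Detour G G') (hG : G.WF) (hG' : G'.WF) :
    dropVirt G = dropVirt G' := by
  obtain ⟨T, T', hT, hT', u, v, h⟩ := h
  have key : ∀ (T : Template 1) (hT : T.Linear) (u : List ℕ),
      Code.WF (T.fill ![u.map .virt]) → dropVirt (T.fill ![u.map .virt]) =
        (T.erase u.toFinset).map fun w => (wordLetters w).filter Letter.classical := by
    intro T hT u hG
    rw [dropVirt, fill_eq, Template.erase, List.map_map, List.map_map]
    apply List.map_congr_left
    intro w hw
    refine filter_classical_fillWord _ ?_ _ w ?_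
    · intro i l hl
      fin_cases i
      obtain ⟨c, _, rfl⟩ := List.mem_map.1 (show l ∈ u.map Letter.virt from hl)
      rfl
    · intro l hl hN
      have h1 : Letter.virt l.label ∈ (T.fill ![u.map .virt]).flatten := by
        rw [(fill_flatten_perm T _).mem_iff, List.mem_append, List.mem_flatMap]
        refine Or.inr ⟨0, hT.perm_holes.mem_iff.1 (List.mem_finRange 0), ?_⟩
        exact List.mem_map_of_mem (List.mem_toFinset.1 hN)
      have h2 : l ∈ (T.fill ![u.map .virt]).flatten := by
        rw [(fill_flatten_perm T _).mem_iff, List.mem_append]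
        exact Or.inl (mem_wordLetters.2 (List.mem_flatten_of_mem hw hl))
      have h3 : l ∈ (T.fill ![u.map .virt]).flatten.filter fun x => decide (x.label = l.label) :=
        List.mem_filter.2 ⟨h2, decide_eq_true rfl⟩
      rw [hG.eq_virt h1] at h3
      have h4 : l = .virt l.label := by simpa using h3
      rw [h4]
      rfl
  rw [key T hT u hG, key T' hT' v hG', h]

end Virtual

/-! ### Diagrams `D ∪ ω` -/

section SemiWelded

open OmegaDiagram

theorem tok_congr {O O' : List Letter} {l : Letter}
    (h : ∀ c s, l = .under c s → (Letter.over c s ∈ O ↔ Letter.over c s ∈ O')) :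
    tok O l = tok O' l := by
  rcases l with ⟨c, s⟩ | ⟨c, s⟩ | c
  · rfl
  · simp only [tok, h c s rfl]
  · rfl

theorem tok_virt (O : List Letter) (c : ℕ) : TokEq [tok O (.virt c)] [] := fun x n y => by
  simp [tok]

theorem overs_fill_perm {k : ℕ} {T : Template k} {g g' : Fin k → List Letter}
    (h : ∀ i ∈ holes T, ((g i).filterMap Letter.overData).Perm ((g' i).filterMap Letter.overData)) :
    (overs (T.fill g)).Perm (overs (T.fill g')) := by
  refine (filterMap_fill_perm (List.Perm.refl _) g).trans (List.Perm.trans ?_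
    (filterMap_fill_perm (List.Perm.refl _) g').symm)
  exact (List.Perm.flatMap_left _ h).append_right _

theorem perm_ord (p : ℤˣ) (x y : Letter) : (ord p x y).Perm [x, y] := by
  unfold ord
  split_ifs
  · exact List.Perm.refl _
  · exact List.Perm.swap _ _ _

variable {L L' : OmegaDiagram}

/-- The system uses only which letters occur on `ω`, not their order. In the drawn version each
lower strand keeps its weight, because the virtual crossing has weight 0. -/
theorem OmegaDiagram.OCC.crossingSum_eq (h : OCC L L') :
    (overs L.base).Perm (overs L'.base) ∧ L.system = L'.system := by
  have hmem : ∀ {O O' u v x y : List Letter}, O = u ++ x ++ v → O' = u ++ y ++ v → x.Perm y →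
      ∀ l, l ∈ O ↔ l ∈ O' := by
    rintro O O' u v x y rfl rfl hxy l
    exact ((hxy.append_left u).append_right v).mem_iff
  have hτ : ∀ {O O' : List Letter}, (∀ l, l ∈ O ↔ l ∈ O') →
      (fun l => [tok O l]) = fun l => [tok O' l] := by
    intro O O' h
    funext l
    rw [tok_congr fun c s _ => h _]
  cases h with
  | gauss u v c d a b hω hω' hb =>
    have e := hτ (hmem hω hω' (List.Perm.swap _ _ _))
    rw [system, system, e, hb]
    exact ⟨List.Perm.refl _, rfl⟩
  | drawn u v T hT c d e a b p q r h hω hω' hb hb' =>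
    have hm := hmem hω hω' ((perm_ord _ _ _).trans (perm_ord _ _ _).symm)
    rw [system, system, ← hτ hm, hb, hb']
    have hc : Letter.over c a ∈ L.omega := by
      rw [hω]
      exact List.mem_append_left _ (List.mem_append_right _ ((perm_ord _ _ _).mem_iff.2 (by simp)))
    have hd : Letter.over d b ∈ L.omega := by
      rw [hω]
      exact List.mem_append_left _ (List.mem_append_right _ ((perm_ord _ _ _).mem_iff.2 (by simp)))
    have ho : ∀ (q : ℤˣ) c a e, (ord q (.under c a) (.virt e)).filterMap Letter.overData = [] := by
      intro q c a e
      unfold ord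
      split_ifs <;> rfl
    have ht : ∀ (q : ℤˣ) c a e, Letter.over c a ∈ L.omega →
        TokEq ((ord q (.under c a) (.virt e)).flatMap fun l => [tok L.omega l]) [.wt a] := by
      intro q c a e hc x n y
      unfold ord
      split_ifs <;> simp [tok, hc]
    constructor
    · refine overs_fill_perm fun i _ => ?_
      fin_cases i <;> simp only [Fin.zero_eta, Fin.mk_one, Matrix.cons_val_zero,
        Matrix.cons_val_one, ho] <;> exact List.Perm.refl _
    · refine codeSys_fill_congr (fun _ _ => rfl) fun i _ => ?_
      fin_cases i
      · exact (ht q c a e hc).trans (ht (-q) c a e hc).symm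
      · exact (ht r d b e hd).trans (ht (-r) d b e hd).symm

theorem system_eq_of_dropVirt (h : dropVirt L.code = dropVirt L'.code) :
    overs L.base = overs L'.base ∧ L.system = L'.system := by
  have h' : L.omega.filter Letter.classical :: dropVirt L.base =
    L'.omega.filter Letter.classical :: dropVirt L'.base := h
  rw [List.cons.injEq] at h'
  obtain ⟨h₁, h₂⟩ := h'
  refine ⟨by rw [← overs_dropVirt, h₂, overs_dropVirt], ?_⟩
  have e : (fun l => [tok L.omega l]) = fun l => [tok L'.omega l] := by
    funext l
    rw [tok_congr]
    intro c s _
    have := congrArg (fun w => Letter.over c s ∈ w) h₁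
    simpa [List.mem_filter, Letter.classical] using this
  rw [system, system, ← codeSys_dropVirt (tok_virt L.omega), h₂, e, codeSys_dropVirt (tok_virt _)]

theorem system_of_sameCode {f : ℕ → ℕ} (hf : f.Injective) (hω : SameWord f L.omega L'.omega)
    (hb : SameCode f L.base L'.base) :
    normalized (overs L.base) L.system = normalized (overs L'.base) L'.system := by
  obtain ⟨h1, h2⟩ := crossingSum_sameCode smoothing curveValue hf hb
    (τ := fun l => [tok L.omega l]) (labelled_tok L'.omega) (by
    intro l _
    have hm : ∀ c s, Letter.over (f c) s ∈ L'.omega ↔ Letter.over c s ∈ L.omega := by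
      intro c s
      rw [← hω.perm.mem_iff, List.mem_map]
      constructor
      · rintro ⟨l, hl, e⟩
        rcases l with ⟨c', s'⟩ | ⟨c', s'⟩ | c'
        · simp only [Letter.relabel, Letter.over.injEq] at e
          rw [← hf e.1, ← e.2]
          exact hl
        · cases e
        · cases e
      · exact fun h => ⟨_, h, rfl⟩
    rcases l with ⟨c, s⟩ | ⟨c, s⟩ | c
    · rfl
    · simp only [Letter.relabel, tok, hm]
      split_ifs <;> rfl
    · rfl)
  rw [normalized, normalized, system, system, h1, (h2.map _).sum_eq, List.map_map]
  rfl

end SemiWelded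

/-! ### Reidemeister moves of `D ∪ ω` -/

section Moves

open OmegaDiagram

variable {k : ℕ} {L L' : OmegaDiagram} {T₀ : List (Letter ⊕ Fin k)} {T : Template k}
  {g g' : Fin k → List Letter}

/-- `D ∪ ω` arises by filling the template `T₀` for `ω` and the template `T` for the base. -/
structure Fills (L : OmegaDiagram) (T₀ : List (Letter ⊕ Fin k)) (T : Template k)
    (g : Fin k → List Letter) : Prop where
  linear : Template.Linear (T₀ :: T)
  omega : L.omega = fillWord g T₀
  base : L.base = T.fill g

/-- `ω` is the first component of the code, so the first word of the template is the one for `ω`.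
The moves can then be sorted by the strands that lie on `ω`. -/
theorem Fills.of_code {T₁ : Template k} (hT : T₁.Linear) (h : L.code = T₁.fill g)
    (h' : L'.code = T₁.fill g') : ∃ (T₀ : List (Letter ⊕ Fin k)) (T : Template k), Fills L T₀ T g ∧ Fills L' T₀ T g' := by
  cases T₁ with
  | nil => cases h
  | cons T₀ T =>
    have h₁ : L.omega :: L.base = fillWord g T₀ :: Template.fill T g := h
    have h₂ : L'.omega :: L'.base = fillWord g' T₀ :: Template.fill T g' := h'
    rw [List.cons.injEq] at h₁ h₂
    exact ⟨T₀, T, ⟨hT, h₁.1, h₁.2⟩, ⟨hT, h₂.1, h₂.2⟩⟩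

theorem Fills.label_ne (F : Fills L T₀ T g) {c : ℕ} {s : ℤˣ} {i j : Fin k}
    (hi : Letter.over c s ∈ g i) (hj : Letter.under c s ∈ g j) :
    (∀ l ∈ wordLetters T₀, l.label ≠ c) ∧ ∀ l ∈ letters T, l.label ≠ c := by
  have h : Code.WF (Template.fill (T₀ :: T) g) := by
    have e : Template.fill (T₀ :: T) g = L.omega :: L.base := by
      rw [F.omega, F.base]
      rfl
    rw [e]
    exact L.wf
  have h' := h.label_ne_of_fill F.linear hi hj
  rw [letters_cons] at h'
  exact ⟨fun l hl => h' l (List.mem_append_left _ hl), fun l hl => h' l (List.mem_append_right _ hl)⟩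

theorem Fills.perm_holes (F : Fills L T₀ T g) :
    (List.finRange k).Perm (wordHoles T₀ ++ holes T) := by
  have := F.linear.perm_holes
  rwa [holes_cons] at this

theorem Fills.mem_or (F : Fills L T₀ T g) (i : Fin k) : i ∈ wordHoles T₀ ∨ i ∈ holes T :=
  List.mem_append.1 (F.perm_holes.mem_iff.1 (List.mem_finRange i))

theorem Fills.perm_of (F : Fills L T₀ T g) {hs : List (Fin k)} (hnd : hs.Nodup)
    (h : ∀ i, i ∈ hs ∧ i ∈ holes T ∨ i ∉ hs ∧ i ∈ wordHoles T₀) : hs.Perm (holes T) := by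
  have h' := List.nodup_append.1 (F.perm_holes.nodup_iff.1 (List.nodup_finRange k))
  refine (List.perm_ext_iff_of_nodup hnd h'.2.1).2 fun i => ?_
  rcases h i with h | h
  · simp [h]
  · exact ⟨fun h₂ => absurd h₂ h.1, fun h₂ => absurd rfl (h'.2.2 i h.2 i h₂)⟩

theorem Fills.mem_omega (F : Fills L T₀ T g) {i : Fin k} (hi : i ∈ wordHoles T₀) {l : Letter}
    (hl : l ∈ g i) : l ∈ L.omega := by
  rw [F.omega, (fillWord_perm g T₀).mem_iff, List.mem_append, List.mem_flatMap]
  exact Or.inr ⟨i, hi, hl⟩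

theorem Fills.mem_base (F : Fills L T₀ T g) {i : Fin k} (hi : i ∈ holes T) {l : Letter}
    (hl : l ∈ g i) : l ∈ L.base.flatten := by
  rw [F.base, (fill_flatten_perm T g).mem_iff, List.mem_append, List.mem_flatMap]
  exact Or.inr ⟨i, hi, hl⟩

theorem Fills.tok_omega (F : Fills L T₀ T g) {i : Fin k} (hi : i ∈ wordHoles T₀) {c : ℕ} {s : ℤˣ}
    (hl : Letter.over c s ∈ g i) : tok L.omega (.under c s) = .wt s := by
  rw [tok, if_pos (F.mem_omega hi hl)]

theorem Fills.tok_base (F : Fills L T₀ T g) {i : Fin k} (hi : i ∈ holes T) {c : ℕ} {s : ℤˣ}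
    (hl : Letter.over c s ∈ g i) : tok L.omega (.under c s) = passTok c false := by
  obtain ⟨p, hp⟩ := L.mem_base.1 (F.mem_base hi hl)
  rw [tok, if_neg (over_notMem_omega hp s)]

/-- This excludes the moves in which the base would pass over `ω`. -/
theorem Fills.not_under_omega (F : Fills L T₀ T g) {i j : Fin k} (hi : i ∈ holes T)
    (hj : j ∈ wordHoles T₀) {c : ℕ} {s : ℤˣ} (hi' : Letter.over c s ∈ g i)
    (hj' : Letter.under c s ∈ g j) : False := by
  have h1 := L.wf.countP_isAt_le c false
  rw [List.flatten_cons, List.countP_append] at h1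
  have h2 : 0 < L.omega.countP (Letter.isAt c false) :=
    List.countP_pos_iff.2 ⟨_, F.mem_omega hj hj', by simp [Letter.isAt]⟩
  have h3 : 0 < L.base.flatten.countP (Letter.isAt c false) :=
    List.countP_pos_iff.2 ⟨_, L.omega_over c s (F.mem_base hi hi'), by simp [Letter.isAt]⟩
  omega

theorem Fills.tok_eq (F : Fills L T₀ T g) (F' : Fills L' T₀ T g')
    (h : ∀ i, ∀ x ∈ g i, ∀ l ∈ letters T, l.label ≠ x.label)
    (h' : ∀ i, ∀ x ∈ g' i, ∀ l ∈ letters T, l.label ≠ x.label) :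
    ∀ l ∈ letters T, [tok L.omega l] = [tok L'.omega l] := by
  intro l hl
  rw [tok_congr]
  rintro c s rfl
  rw [F.omega, F'.omega, (fillWord_perm g T₀).mem_iff, (fillWord_perm g' T₀).mem_iff,
    List.mem_append, List.mem_append, List.mem_flatMap, List.mem_flatMap]
  refine or_congr Iff.rfl ⟨?_, ?_⟩
  · rintro ⟨i, _, hi⟩
    exact absurd rfl (h i _ hi (.under c s) hl)
  · rintro ⟨i, _, hi⟩
    exact absurd rfl (h' i _ hi (.under c s) hl)

theorem Fills.overs_perm (F : Fills L T₀ T g) {hs : List (Fin k)} (h : hs.Perm (holes T)) :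
    (overs L.base).Perm (hs.flatMap (fun i => (g i).filterMap Letter.overData) ++
      (letters T).filterMap Letter.overData) := by
  rw [F.base]
  exact filterMap_fill_perm h g

/-- A move under which the strands of the base look the same. -/
theorem Fills.normalized_congr (F : Fills L T₀ T g) (F' : Fills L' T₀ T g')
    (h : ∀ i, ∀ x ∈ g i, ∀ l ∈ letters T, l.label ≠ x.label)
    (h' : ∀ i, ∀ x ∈ g' i, ∀ l ∈ letters T, l.label ≠ x.label)
    (ho : ∀ i ∈ holes T, ((g i).filterMap Letter.overData).Perm ((g' i).filterMap Letter.overData))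
    (ht : ∀ i ∈ holes T, TokEq ((g i).flatMap fun l => [tok L.omega l])
      ((g' i).flatMap fun l => [tok L'.omega l])) :
    normalized (overs L.base) L.system = normalized (overs L'.base) L'.system := by
  have e1 : L.system = L'.system := by
    rw [system, system, F.base, F'.base]
    exact codeSys_fill_congr (F.tok_eq F' h h') ht
  rw [e1, normalized_perm]
  rw [F.base, F'.base]
  exact overs_fill_perm ho

theorem filterMap_ord_over (p : ℤˣ) (c d : ℕ) (a b : ℤˣ) :
    ((ord p (.over c a) (.over d b)).filterMap Letter.overData).Perm [(c, a), (d, b)] :=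
  (perm_ord p _ _).filterMap _

theorem filterMap_ord_over_under (p : ℤˣ) (c d : ℕ) (a b : ℤˣ) :
    (ord p (.over c a) (.under d b)).filterMap Letter.overData = [(c, a)] := by
  unfold ord; split_ifs <;> rfl

theorem filterMap_ord_under_over (p : ℤˣ) (c d : ℕ) (a b : ℤˣ) :
    (ord p (.under c a) (.over d b)).filterMap Letter.overData = [(d, b)] := by
  unfold ord; split_ifs <;> rfl

theorem filterMap_ord_under (p : ℤˣ) (c d : ℕ) (a b : ℤˣ) :
    (ord p (.under c a) (.under d b)).filterMap Letter.overData = [] := by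
  unfold ord; split_ifs <;> rfl

theorem ord_flatMap {α : Type} (τ : Letter → α) (p : ℤˣ) (x y : Letter) :
    (ord p x y).flatMap (fun l => [τ l]) = cond (decide (p = -1)) [τ y, τ x] [τ x, τ y] := by
  rcases Int.units_eq_one_or p with rfl | rfl
  · rfl
  · rfl

/-- A curl on `ω` does not touch the base; a curl on the base is a classical one. -/
theorem normalized_r1 {T₀ : List (Letter ⊕ Fin 1)} {T : Template 1} {c : ℕ} {s p : ℤˣ}
    (F : Fills L T₀ T ![ord p (.over c s) (.under c s)]) (F' : Fills L' T₀ T ![[]]) :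
    normalized (overs L.base) L.system = normalized (overs L'.base) L'.system := by
  have ho : Letter.over c s ∈ ![ord p (.over c s) (.under c s)] 0 :=
    (perm_ord p _ _).mem_iff.2 (by simp)
  have hu : Letter.under c s ∈ ![ord p (.over c s) (.under c s)] 0 :=
    (perm_ord p _ _).mem_iff.2 (by simp)
  have hc := (F.label_ne ho hu).2
  have h : ∀ i, ∀ x ∈ ![ord p (.over c s) (.under c s)] i, ∀ l ∈ letters T, l.label ≠ x.label := by
    intro i x hx l hl
    fin_cases i
    have := (perm_ord p _ _).mem_iff.1 hx
    simp only [List.mem_cons, List.not_mem_nil, or_false] at this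
    rcases this with rfl | rfl <;> exact hc l hl
  have h' : ∀ i : Fin 1, ∀ x ∈ (![[]] : Fin 1 → List Letter) i, ∀ l ∈ letters T,
      l.label ≠ x.label := by
    intro i x hx
    fin_cases i
    simp at hx
  rcases F.mem_or 0 with h0 | h0
  · have hp : ([] : List (Fin 1)).Perm (holes T) := F.perm_of List.nodup_nil fun i => by
      fin_cases i; exact Or.inr ⟨by simp, h0⟩
    have hne : ∀ i, i ∉ holes T := fun i hi => by simpa using hp.mem_iff.2 hi
    exact F.normalized_congr F' h h' (fun i hi => absurd hi (hne i)) fun i hi => absurd hi (hne i)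
  · have hp : ([0] : List (Fin 1)).Perm (holes T) := F.perm_of (by simp) fun i => by
      fin_cases i; exact Or.inl ⟨by simp, h0⟩
    rw [normalized_perm (F.overs_perm hp), normalized_perm (F'.overs_perm hp)]
    simp only [List.flatMap_cons, List.flatMap_nil, Matrix.cons_val_zero, filterMap_ord_over_under,
      List.filterMap_nil, List.append_nil, List.nil_append, List.cons_append]
    apply normalized_curl
    rw [system, system, F.base, F'.base]
    refine crossingSum_curl smoothing_mul curveValue_zero s (decide (p = -1)) _ T hp
      (by simpa using freshIn_of_label_ne (Cs := []) hc (by simp)) (labelled_tok _) (labelled_tok _)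
      (F.tok_eq F' h h') _ _ (fun _ => 0) (fun _ => 0) ?_ ?_
    · intro i
      fin_cases i
      refine TokEq.trans ?_ (TokEq.pad _)
      simp only [Fin.zero_eta, Matrix.cons_val_zero, ord_flatMap, F.tok_base h0 ho]
      exact TokEq.refl _
    · intro i
      fin_cases i
      exact TokEq.pad _

/-- If the over-strand lies on `ω`, it leaves the weights `s` and `-s` on the other strand, when
that belongs to the base, and these cancel. Otherwise both strands lie on the base. -/
theorem normalized_r2 {T₀ : List (Letter ⊕ Fin 2)} {T : Template 2} {c d : ℕ} {s p : ℤˣ}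
    (F : Fills L T₀ T ![[.over c s, .over d (-s)], ord p (.under c s) (.under d (-s))])
    (F' : Fills L' T₀ T ![[], []]) :
    normalized (overs L.base) L.system = normalized (overs L'.base) L'.system := by
  set g : Fin 2 → List Letter :=
    ![[.over c s, .over d (-s)], ord p (.under c s) (.under d (-s))] with hg
  have ho₁ : Letter.over c s ∈ g 0 := by simp [hg]
  have ho₂ : Letter.over d (-s) ∈ g 0 := by simp [hg]
  have hu₁ : Letter.under c s ∈ g 1 := (perm_ord p _ _).mem_iff.2 (by simp)
  have hu₂ : Letter.under d (-s) ∈ g 1 := (perm_ord p _ _).mem_iff.2 (by simp)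
  have hc := (F.label_ne ho₁ hu₁).2
  have hd := (F.label_ne ho₂ hu₂).2
  have h : ∀ i, ∀ x ∈ g i, ∀ l ∈ letters T, l.label ≠ x.label := by
    intro i x hx l hl
    fin_cases i
    · simp only [hg, Fin.zero_eta, Matrix.cons_val_zero, List.mem_cons, List.not_mem_nil,
        or_false] at hx
      rcases hx with rfl | rfl
      · exact hc l hl
      · exact hd l hl
    · have := (perm_ord p _ _).mem_iff.1 hx
      simp only [List.mem_cons, List.not_mem_nil, or_false] at this
      rcases this with rfl | rfl
      · exact hc l hl
      · exact hd l hl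
  have h' : ∀ i : Fin 2, ∀ x ∈ (![[], []] : Fin 2 → List Letter) i, ∀ l ∈ letters T,
      l.label ≠ x.label := by
    intro i x hx
    fin_cases i <;> simp at hx
  rcases F.mem_or 0 with h0 | h0
  · have hne : 0 ∉ holes T := fun h => absurd rfl ((List.nodup_append.1
      (F.perm_holes.nodup_iff.1 (List.nodup_finRange 2))).2.2 0 h0 0 h)
    refine F.normalized_congr F' h h' (fun i hi => ?_) fun i hi => ?_
    · fin_cases i
      · exact absurd hi hne
      · simp [hg, filterMap_ord_under]
    · fin_cases i
      · exact absurd hi hne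
      · change TokEq ((ord p (.under c s) (.under d (-s))).flatMap fun l => [tok L.omega l]) []
        rw [ord_flatMap, F.tok_omega h0 ho₁, F.tok_omega h0 ho₂]
        intro x n y
        cases decide (p = -1) <;> simp
  · rcases F.mem_or 1 with h1 | h1
    · exact (F.not_under_omega h0 h1 ho₁ hu₁).elim
    · have hp : ([0, 1] : List (Fin 2)).Perm (holes T) := F.perm_of (by simp) fun i => by
        fin_cases i
        · exact Or.inl ⟨by simp, h0⟩
        · exact Or.inl ⟨by simp, h1⟩
      -- Otherwise the base would pass over the same crossing twice.
      have hcd : c ≠ d := by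
        rintro rfl
        have h2 := ((filterMap_fill_perm hp g).map Prod.fst).nodup_iff.1 (by
          rw [← F.base]; exact L.nodup_overs)
        simp [hg, Letter.overData] at h2
      rw [normalized_perm (F.overs_perm hp), normalized_perm (F'.overs_perm hp)]
      have e1 : ([0, 1] : List (Fin 2)).flatMap (fun i => (g i).filterMap Letter.overData) =
          [(c, s), (d, -s)] := by
        simp [hg, filterMap_ord_under, Letter.overData]
      have e2 : ([0, 1] : List (Fin 2)).flatMap (fun i => ((![[], []] : Fin 2 → List Letter)
          i).filterMap Letter.overData) = [] := by
        simp
      rw [e1, e2, system, system, F.base, F'.base]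
      simp only [List.nil_append, List.cons_append]
      have key := crossingSum_bigon smoothing_mul curveValue_zero hcd s (decide (p = -1))
        ((letters T).filterMap Letter.overData) T hp
        (by simpa using freshIn_of_label_ne (Cs := []) hc (by simp))
        (by simpa using freshIn_of_label_ne (Cs := []) hd (by simp)) (labelled_tok L.omega)
        (labelled_tok L'.omega) (F.tok_eq F' h h') (fun _ => 0) (fun _ => 0) g ![[], []] ?_ ?_
      · rw [normalized, normalized, key]
        congr 4
        simp
      · intro i
        fin_cases i
        · exact TokEq.pad _
        · refine TokEq.trans ?_ (TokEq.pad _)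
          change TokEq ((ord p (.under c s) (.under d (-s))).flatMap fun l => [tok L.omega l]) _
          rw [ord_flatMap, F.tok_base h0 ho₁, F.tok_base h0 ho₂]
          exact TokEq.refl _
      · intro i
        fin_cases i <;> exact TokEq.pad _

end Moves

/-! ### The third Reidemeister move of `D ∪ ω`, and all semi-welded moves -/

section Moves

open OmegaDiagram

variable {L L' : OmegaDiagram} {T₀ : List (Letter ⊕ Fin 3)} {T : Template 3}
  {c d e : ℕ} {a b f p q r : ℤˣ}

/-- The three strands of a triangle. -/
def triangleWords (c d e : ℕ) (a b f p q r : ℤˣ) : Fin 3 → List Letter :=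
  ![ord p (.over c a) (.over d b), ord q (.under c a) (.over e f), ord r (.under d b) (.under e f)]

theorem label_of_mem_ord {x y l : Letter} (h : l ∈ ord p x y) : l.label = x.label ∨
    l.label = y.label := by
  have := (perm_ord p x y).mem_iff.1 h
  simp only [List.mem_cons, List.not_mem_nil, or_false] at this
  rcases this with rfl | rfl
  · exact Or.inl rfl
  · exact Or.inr rfl

theorem left_mem_ord (p : ℤˣ) (x y : Letter) : x ∈ ord p x y := (perm_ord p x y).mem_iff.2 (by simp)

theorem right_mem_ord (p : ℤˣ) (x y : Letter) : y ∈ ord p x y :=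
  (perm_ord p x y).mem_iff.2 (by simp)

theorem label_of_mem_triangleWords {i : Fin 3} {l : Letter}
    (h : l ∈ triangleWords c d e a b f p q r i) : l.label = c ∨ l.label = d ∨ l.label = e := by
  fin_cases i <;> rcases label_of_mem_ord h with h | h <;> rw [h] <;> simp [Letter.label]

/-- Reversing the strands of order `-1` multiplies the signs of `c`, `d`, `e` by `p q`, `p r`, `q
r`. The two equations that describe planar triangles say exactly that the results coincide. -/
theorem revSign_triangle : ∀ p q r a b f : ℤˣ, p * f = q * b → q * b = r * a →
    revSign a (decide (p = -1)) (decide (q = -1)) = revSign b (decide (p = -1)) (decide (r = -1)) ∧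
    revSign b (decide (p = -1)) (decide (r = -1)) =
      revSign f (decide (q = -1)) (decide (r = -1)) := by
  decide

theorem cond_neg {α : Type} (p : ℤˣ) (x y : α) :
    cond (decide (-p = -1)) x y = cond (decide (p = -1)) y x := by
  rcases Int.units_eq_one_or p with rfl | rfl <;> rfl

/-- The order of a crossing with `ω` and another crossing matters only for the place of the
weight. -/
theorem tokEq_wt_pass (q : ℤˣ) (n : ℤ) (t : Tok Pt) :
    TokEq (cond (decide (q = -1)) [t, .wt n] [.wt n, t])
      [.wt (cond (decide (q = -1)) 0 n), t, .wt (cond (decide (q = -1)) n 0)] := by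
  intro x m y
  cases decide (q = -1) <;> cases t <;> simp

/-- Strands on `ω` can only lie above strands of the base. If the upper two lie on `ω`, the bottom
strand at most exchanges two weights; if only the top one does, `ω` slides over the crossing `e`;
otherwise the triangle is classical. -/
theorem normalized_r3_aux (h₁ : p * f = q * b) (h₂ : q * b = r * a)
    (F : Fills L T₀ T (triangleWords c d e a b f p q r))
    (F' : Fills L' T₀ T (triangleWords c d e a b f (-p) (-q) (-r))) :
    normalized (overs L.base) L.system = normalized (overs L'.base) L'.system := by
  set g := triangleWords c d e a b f p q r with hg
  set g' := triangleWords c d e a b f (-p) (-q) (-r) with hg'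
  have oc : Letter.over c a ∈ g 0 := left_mem_ord _ _ _
  have od : Letter.over d b ∈ g 0 := right_mem_ord _ _ _
  have oe : Letter.over e f ∈ g 1 := right_mem_ord _ _ _
  have uc : Letter.under c a ∈ g 1 := left_mem_ord _ _ _
  have ud : Letter.under d b ∈ g 2 := left_mem_ord _ _ _
  have ue : Letter.under e f ∈ g 2 := right_mem_ord _ _ _
  have oc' : Letter.over c a ∈ g' 0 := left_mem_ord _ _ _
  have od' : Letter.over d b ∈ g' 0 := right_mem_ord _ _ _
  have oe' : Letter.over e f ∈ g' 1 := right_mem_ord _ _ _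
  have hc := (F.label_ne oc uc).2
  have hd := (F.label_ne od ud).2
  have he := (F.label_ne oe ue).2
  have hall : ∀ p q r i, ∀ x ∈ triangleWords c d e a b f p q r i, ∀ l ∈ letters T,
      l.label ≠ x.label := by
    intro p q r i x hx l hl
    rcases label_of_mem_triangleWords hx with h | h | h <;> rw [h]
    · exact hc l hl
    · exact hd l hl
    · exact he l hl
  have hxor : ∀ i, i ∈ wordHoles T₀ → i ∉ holes T := fun i hi h => absurd rfl ((List.nodup_append.1
    (F.perm_holes.nodup_iff.1 (List.nodup_finRange 3))).2.2 i hi i h)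
  have fresh : ∀ {c}, (∀ l ∈ letters T, l.label ≠ c) →
      FreshIn c ((letters T).filterMap Letter.overData) T := fun hc => by
    simpa using freshIn_of_label_ne (Cs := []) hc (by simp)
  have hτ := F.tok_eq F' (hall p q r) (hall _ _ _)
  rcases F.mem_or 0 with h0 | h0
  · rcases F.mem_or 1 with h1 | h1
    · refine F.normalized_congr F' (hall p q r) (hall _ _ _) (fun i hi => ?_) fun i hi => ?_
      · fin_cases i
        · exact absurd hi (hxor _ h0)
        · exact absurd hi (hxor _ h1)
        · change ((ord r _ _).filterMap _).Perm ((ord (-r) _ _).filterMap _)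
          rw [filterMap_ord_under, filterMap_ord_under]
      · fin_cases i
        · exact absurd hi (hxor _ h0)
        · exact absurd hi (hxor _ h1)
        · change TokEq ((ord r (.under d b) (.under e f)).flatMap fun l => [tok L.omega l])
            ((ord (-r) (.under d b) (.under e f)).flatMap fun l => [tok L'.omega l])
          rw [ord_flatMap, ord_flatMap, F.tok_omega h0 od, F.tok_omega h1 oe, F'.tok_omega h0 od',
            F'.tok_omega h1 oe', cond_neg]
          intro x n y
          cases decide (r = -1) <;> exact congrArg (fun m => [(x, y, m)]) (add_right_comm _ _ _)
    · rcases F.mem_or 2 with h2 | h2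
      · exact (F.not_under_omega h1 h2 oe ue).elim
      · have hp : ([1, 2] : List (Fin 3)).Perm (holes T) := F.perm_of (by simp) fun i => by
          fin_cases i
          · exact Or.inr ⟨by simp, h0⟩
          · exact Or.inl ⟨by simp, h1⟩
          · exact Or.inl ⟨by simp, h2⟩
        have ho : ∀ p q r, ([1, 2] : List (Fin 3)).flatMap (fun i =>
            (triangleWords c d e a b f p q r i).filterMap Letter.overData) = [(e, f)] := by
          intro p q r
          simp [triangleWords, filterMap_ord_under, filterMap_ord_under_over]
        rw [normalized_perm (F.overs_perm hp), normalized_perm (F'.overs_perm hp), ho, ho, system,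
          system, F.base, F'.base]
        -- The weights `a` and `b` move from one side of `e` to the other on both strands. By `h₂`
        -- this is a slide: the numerical conditions are checked for all signs.
        have key := crossingSum_slide (A := smoothing) (f := curveValue) f
          ((letters T).filterMap Letter.overData) T (i := 1) (j := 2) (by decide) hp (fresh he)
          (labelled_tok L.omega) (labelled_tok L'.omega) hτ g g' (n₁ := cond (decide (q = -1)) 0 a)
          (n₂ := cond (decide (q = -1)) a 0) (n₃ := cond (decide (r = -1)) 0 b)
          (n₄ := cond (decide (r = -1)) b 0) (n₁' := cond (decide (-q = -1)) 0 a)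
          (n₂' := cond (decide (-q = -1)) a 0) (n₃' := cond (decide (-r = -1)) 0 b)
          (n₄' := cond (decide (-r = -1)) b 0) ?_ ?_ ?_ ?_ ?_ ?_ ?_
        · rw [normalized, normalized, List.singleton_append, key]
        · change TokEq ((ord q (.under c a) (.over e f)).flatMap fun l => [tok L.omega l]) _
          rw [ord_flatMap, F.tok_omega h0 oc]
          exact tokEq_wt_pass _ _ _
        · change TokEq ((ord r (.under d b) (.under e f)).flatMap fun l => [tok L.omega l]) _
          rw [ord_flatMap, F.tok_omega h0 od, F.tok_base h1 oe]
          exact tokEq_wt_pass _ _ _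
        · change TokEq ((ord (-q) (.under c a) (.over e f)).flatMap fun l => [tok L'.omega l]) _
          rw [ord_flatMap, F'.tok_omega h0 oc']
          exact tokEq_wt_pass _ _ _
        · change TokEq ((ord (-r) (.under d b) (.under e f)).flatMap fun l => [tok L'.omega l]) _
          rw [ord_flatMap, F'.tok_omega h0 od', F'.tok_base h1 oe']
          exact tokEq_wt_pass _ _ _
        all_goals
          clear * - h₂
          revert h₂
          revert a b q r
          decide
  · rcases F.mem_or 1 with h1 | h1
    · exact (F.not_under_omega h0 h1 oc uc).elim
    rcases F.mem_or 2 with h2 | h2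
    · exact (F.not_under_omega h0 h2 od ud).elim
    have hp : ([0, 1, 2] : List (Fin 3)).Perm (holes T) := F.perm_of (by simp) fun i => by
      fin_cases i
      · exact Or.inl ⟨by simp, h0⟩
      · exact Or.inl ⟨by simp, h1⟩
      · exact Or.inl ⟨by simp, h2⟩
    have ho : ∀ p q r, (([0, 1, 2] : List (Fin 3)).flatMap (fun i =>
        (triangleWords c d e a b f p q r i).filterMap Letter.overData)).Perm
          [(c, a), (d, b), (e, f)] := by
      intro p q r
      simp only [triangleWords, List.flatMap_cons, List.flatMap_nil, Matrix.cons_val_zero,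
        Matrix.cons_val_one, Matrix.cons_val, filterMap_ord_under, filterMap_ord_under_over,
        List.append_nil]
      exact (filterMap_ord_over p c d a b).append_right [(e, f)]
    have hov := (F.overs_perm hp).trans ((ho p q r).append_right _)
    have hov' := (F'.overs_perm hp).trans ((ho (-p) (-q) (-r)).append_right _)
    -- The three crossings have different names because the base passes over each crossing only
    -- once.
    have hnd := (hov.map Prod.fst).nodup_iff.1 L.nodup_overs
    simp only [List.cons_append, List.map_cons, List.nodup_cons, List.mem_cons, not_or] at hnd
    obtain ⟨⟨hcd, hce, -⟩, ⟨hde, -⟩, -⟩ := hnd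
    obtain ⟨k₁, k₂⟩ := revSign_triangle p q r a b f h₁ h₂
    rw [normalized_perm hov, normalized_perm hov', system, system, F.base, F'.base]
    have key := crossingSum_triangle smoothing_mul curveValue_zero hcd hce hde k₁ k₂
      ((letters T).filterMap Letter.overData) T hp (fresh hc) (fresh hd) (fresh he)
      (labelled_tok L.omega) (labelled_tok L'.omega) hτ (fun _ => 0) (fun _ => 0) g g' ?_ ?_
    · rw [normalized, normalized]
      simp only [List.cons_append, List.nil_append]
      rw [key]
    · intro i
      refine TokEq.trans ?_ (TokEq.pad _)
      fin_cases i
      · change TokEq ((ord p (.over c a) (.over d b)).flatMap fun l => [tok L.omega l]) _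
        rw [ord_flatMap]
        exact TokEq.refl _
      · change TokEq ((ord q (.under c a) (.over e f)).flatMap fun l => [tok L.omega l]) _
        rw [ord_flatMap, F.tok_base h0 oc]
        exact TokEq.refl _
      · change TokEq ((ord r (.under d b) (.under e f)).flatMap fun l => [tok L.omega l]) _
        rw [ord_flatMap, F.tok_base h0 od, F.tok_base h1 oe]
        exact TokEq.refl _
    · intro i
      refine TokEq.trans ?_ (TokEq.pad _)
      fin_cases i
      · change TokEq ((ord (-p) (.over c a) (.over d b)).flatMap fun l => [tok L'.omega l]) _
        rw [ord_flatMap, cond_neg]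
        exact TokEq.refl _
      · change TokEq ((ord (-q) (.under c a) (.over e f)).flatMap fun l => [tok L'.omega l]) _
        rw [ord_flatMap, F'.tok_base h0 oc', cond_neg]
        exact TokEq.refl _
      · change TokEq ((ord (-r) (.under d b) (.under e f)).flatMap fun l => [tok L'.omega l]) _
        rw [ord_flatMap, F'.tok_base h0 od', F'.tok_base h1 oe', cond_neg]
        exact TokEq.refl _

theorem normalized_reidemeister (h : Reidemeister L.code L'.code) :
    normalized (overs L.base) L.system = normalized (overs L'.base) L'.system := by
  generalize hG : L.code = G at h
  generalize hG' : L'.code = G' at h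
  cases h with
  | r1 T hT c s p =>
    obtain ⟨T₀, T, F, F'⟩ := Fills.of_code hT hG hG'
    exact normalized_r1 F F'
  | r2 T hT c d s p =>
    obtain ⟨T₀, T, F, F'⟩ := Fills.of_code hT hG hG'
    exact normalized_r2 F F'
  | r3 T hT c d e a b f p q r h₁ h₂ =>
    obtain ⟨T₀, T, F, F'⟩ := Fills.of_code hT hG hG'
    exact normalized_r3_aux h₁ h₂ F F'

theorem normalized_semiWelded (h : SemiWelded L L') :
    normalized (overs L.base) L.system = normalized (overs L'.base) L'.system := by
  induction h with
  | rel L L' h =>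
    rcases h with h | h | h | ⟨f, hf, hω, hb⟩
    · exact normalized_reidemeister h
    · obtain ⟨h₁, h₂⟩ := system_eq_of_dropVirt (h.dropVirt_eq L.wf L'.wf)
      rw [h₁, h₂]
    · obtain ⟨h₁, h₂⟩ := h.crossingSum_eq
      rw [normalized_perm h₁, h₂]
    · exact system_of_sameCode hf hω hb
  | refl L => rfl
  | symm _ _ _ ih => exact ih.symm
  | trans _ _ _ _ _ ih₁ ih₂ => exact ih₁.trans ih₂

end Moves

/-! ### The diagram `Zhᵒᵖ(D)` -/

section Zh

open OmegaDiagram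

/-- The weight that a strand gets before it passes a crossing of sign `s` over or under, for a
given choice of the arcs of `ωᵒᵖ` there. -/
def weightBefore (k o : Bool) (s : ℤˣ) : ℤ := cond k (cond o 0 (-s : ℤˣ)) (cond o s 0)

/-- The weight that a strand gets after it passes a crossing. -/
def weightAfter (k o : Bool) (s : ℤˣ) : ℤ := cond k (cond o s 0) (cond o 0 (-s : ℤˣ))

/-- What a passage of `D` means in `Zhᵒᵖ(D)`. -/
def zhTok (k : ℕ → Bool) : Letter → List (Tok Pt)
  | .over c s => [.wt (weightBefore (k c) true s), passTok c true, .wt (weightAfter (k c) true s)]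
  | .under c s =>
      [.wt (weightBefore (k c) false s), passTok c false, .wt (weightAfter (k c) false s)]
  | .virt _ => []

theorem labelled_zhTok (k : ℕ → Bool) : Labelled (zhTok k) := by
  intro l p hp
  rcases l with ⟨c, s⟩ | ⟨c, s⟩ | c
  · simp only [zhTok, passTok, tokPts_wt, tokPts_pass, tokPts_nil, List.mem_cons,
      List.not_mem_nil, or_false] at hp
    rcases hp with rfl | rfl <;> exact ⟨_, _, rfl⟩
  · simp only [zhTok, passTok, tokPts_wt, tokPts_pass, tokPts_nil, List.mem_cons,
      List.not_mem_nil, or_false] at hp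
    rcases hp with rfl | rfl <;> exact ⟨_, _, rfl⟩
  · simp [zhTok] at hp

theorem zhTok_congr {k k' : ℕ → Bool} {l : Letter} (h : k l.label = k' l.label) :
    zhTok k l = zhTok k' l := by
  rcases l with ⟨c, s⟩ | ⟨c, s⟩ | c
  · have h : k c = k' c := h
    rw [zhTok, zhTok, h]
  · have h : k c = k' c := h
    rw [zhTok, zhTok, h]
  · rfl

theorem tokEq_decorate {k : ℕ → Bool} {l : Bool → ℕ → ℕ} {O : List Letter} {x : Letter}
    (h₁ : ∀ y ∈ omegaPassages l x, y ∈ O) (h₂ : ∀ c s, x = .under c s → Letter.over c s ∉ O) :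
    TokEq ((decorate k l x).flatMap fun y => [tok O y]) (zhTok k x) := by
  rcases x with ⟨c, s⟩ | ⟨c, s⟩ | c
  · have h : tok O (.under (l true c) s) = .wt s := by
      rw [tok, if_pos (h₁ _ (by simp [omegaPassages]))]
    have h' : tok O (.over c s) = passTok c true := rfl
    intro x n y
    rcases hk : k c <;>
      simp [decorate, zhTok, hk, h, h', weightBefore, weightAfter, passTok]
  · have h : tok O (.under (l false c) (-s)) = .wt (-s : ℤˣ) := by
      rw [tok, if_pos (h₁ _ (by simp [omegaPassages]))]
    have h' : tok O (.under c s) = passTok c false := by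
      rw [tok, if_neg (h₂ c s rfl)]
    intro x n y
    rcases hk : k c <;>
      simp [decorate, zhTok, hk, h, h', weightBefore, weightAfter, passTok]
  · exact tok_virt O c

theorem filterMap_decorate (k : ℕ → Bool) (l : Bool → ℕ → ℕ) (w : List Letter) :
    (w.flatMap (decorate k l)).filterMap Letter.overData = w.filterMap Letter.overData := by
  induction w with
  | nil => rfl
  | cons x w ih =>
    rw [List.flatMap_cons, List.filterMap_append, ih]
    rcases x with ⟨c, s⟩ | ⟨c, s⟩ | c
    · rcases hk : k c <;> simp only [decorate, hk, if_true, if_false, Bool.false_eq_true] <;> rfl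
    · rcases hk : k c <;> simp only [decorate, hk, if_true, if_false, Bool.false_eq_true] <;> rfl
    · rfl

theorem self_mem_decorate (k : ℕ → Bool) (l : Bool → ℕ → ℕ) (x : Letter) : x ∈ decorate k l x := by
  rcases x with ⟨c, s⟩ | ⟨c, s⟩ | c
  · rcases hk : k c <;> simp [decorate, hk]
  · rcases hk : k c <;> simp [decorate, hk]
  · simp [decorate]

/-- The names of the new crossings, the order in which the arcs are connected and the additional
virtual crossings do not influence the weights. Only the choice `k` of the arcs remains. -/
theorem IsZhOp.system {D : Diagram} {L : OmegaDiagram} (h : IsZhOp D L) :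
    ∃ k, overs L.base = overs D.code ∧ L.system = codeSys (zhTok k) D.code := by
  obtain ⟨k, l, N, hN, hb, hω⟩ := h
  refine ⟨k, ?_⟩
  -- A name in `N` occurs as a virtual passage of `ωᵒᵖ`, hence only as a virtual crossing; erasing
  -- `N` is invisible after virtual passages are dropped.
  have hvirt : ∀ x ∈ L.base.flatten, x.label ∈ N → x.classical = false := by
    intro x hx hxN
    have h1 : Letter.virt x.label ∈ (L.omega :: L.base).flatten :=
      List.mem_append_left _ (hN _ hxN)
    have h2 : x ∈ (L.omega :: L.base).flatten.filter fun y => decide (y.label = x.label) :=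
      List.mem_filter.2 ⟨List.mem_append_right _ hx, decide_eq_true rfl⟩
    rw [L.wf.eq_virt h1] at h2
    have h3 : x = .virt x.label := by simpa using h2
    rw [h3]
    rfl
  have hdrop : dropVirt (L.base.map (eraseWord N)) = dropVirt L.base := by
    rw [dropVirt, List.map_map]
    apply List.map_congr_left
    intro w hw
    simp only [Function.comp, eraseWord, List.filter_filter]
    apply List.filter_congr
    intro x hx
    have := hvirt x (List.mem_flatten_of_mem hw hx)
    by_cases hxN : x.label ∈ N
    · simp [this hxN]
    · simp [hxN]
  have hflat : ∀ {x}, x ∈ D.code.flatten → ∀ y ∈ decorate k l x, y ∈ L.base.flatten := by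
    intro x hx y hy
    obtain ⟨w, hw, hx⟩ := List.mem_flatten.1 hx
    have h1 : w.flatMap (decorate k l) ∈ L.base.map (eraseWord N) := by
      rw [hb]
      exact List.mem_map_of_mem hw
    obtain ⟨v, hv, e⟩ := List.mem_map.1 h1
    have h2 : y ∈ eraseWord N v := by
      rw [e]
      exact List.mem_flatMap.2 ⟨x, hx, hy⟩
    exact List.mem_flatten_of_mem hv (List.mem_of_mem_filter h2)
  constructor
  · rw [← overs_dropVirt, ← hdrop, overs_dropVirt, hb, overs, overs]
    have : (D.code.map fun w => w.flatMap (decorate k l)).flatten =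
        D.code.flatten.flatMap (decorate k l) := by
      simp only [List.flatMap, List.map_flatten, List.flatten_flatten, List.map_map]
      rfl
    rw [this, filterMap_decorate]
  · rw [OmegaDiagram.system, ← codeSys_dropVirt (tok_virt _), ← hdrop,
      codeSys_dropVirt (tok_virt _), hb, codeSys, codeSys, List.map_map]
    refine sys_congr 0 _ _ _ fun w hw => ?_
    simp only [Function.comp, List.flatMap_assoc]
    refine TokEq.flatMap w fun x hx => ?_
    have hx' : x ∈ D.code.flatten := List.mem_flatten_of_mem hw hx
    refine tokEq_decorate (fun y hy => ?_) ?_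
    · have h1 : y ∈ eraseWord N L.omega := hω.mem_iff.2 (List.mem_flatMap.2 ⟨x, hx', hy⟩)
      exact List.mem_of_mem_filter h1
    · rintro c s rfl
      have h1 := hflat (D.wf.over_iff_under.2 hx') _ (self_mem_decorate k l _)
      obtain ⟨p, hp⟩ := L.mem_base.1 h1
      exact over_notMem_omega hp s

/-! ### Independence of the choices -/

/-- The normalized sum over all states of `Zhᵒᵖ(D)`, for given choices of the arcs of `ωᵒᵖ`. -/
noncomputable def zhSum (k : ℕ → Bool) (G : Code) : ZhRing :=
  normalized (overs G) (codeSys (zhTok k) G)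

/-- Cut out the two passages through a crossing. -/
def cutLetter (c : ℕ) (s : ℤˣ) (x : Letter) : Letter ⊕ Fin 2 :=
  if x = .over c s then .inr 0 else if x = .under c s then .inr 1 else .inl x

theorem fill_cut (c : ℕ) (s : ℤˣ) (G : Code) :
    Template.fill (G.map fun w => w.map (cutLetter c s)) ![[.over c s], [.under c s]] = G := by
  rw [fill_eq, List.map_map]
  refine (List.map_congr_left fun w hw => ?_).trans (List.map_id G)
  clear hw
  simp only [Function.comp, fillWord, List.flatMap_map, id_eq]
  induction w with
  | nil => rfl
  | cons x w ih =>
    rw [List.flatMap_cons, ih, cutLetter]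
    split_ifs with h1 h2
    · rw [h1]; rfl
    · rw [h2]; rfl
    · rfl

theorem linear_cut {G : Code} (hG : G.WF) {c : ℕ} {s : ℤˣ} (hc : Letter.over c s ∈ G.flatten) :
    Template.Linear (G.map fun w => w.map (cutLetter c s)) := by
  have h1 : ∀ (i : Fin 2) (w : List Letter), (w.map (cutLetter c s)).count (.inr i) =
      w.countP fun x => x = (![Letter.over c s, .under c s] i) := by
    intro i w
    rw [List.count, List.countP_map]
    refine List.countP_congr fun x _ => ?_
    simp only [Function.comp, cutLetter, decide_eq_true_eq]
    have e : ∀ j : Fin 2, ((Sum.inr j : Letter ⊕ Fin 2) == Sum.inr i) = (j == i) := fun j => rfl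
    have e' : ((Sum.inl x : Letter ⊕ Fin 2) == Sum.inr i) = false := rfl
    split_ifs with h h'
    · rw [e, h]
      fin_cases i <;> simp
    · rw [e, h']
      fin_cases i <;> simp
    · rw [e']
      fin_cases i <;> simp [h, h']
  intro i
  rw [← List.map_flatten, h1]
  have h2 : (G.flatten.countP fun x => x = (![Letter.over c s, .under c s] i)) =
      (G.flatten.filter fun x => x.label = c).countP
        fun x => x = (![Letter.over c s, .under c s] i) := by
    rw [List.countP_filter]
    refine List.countP_congr fun x _ => ?_
    simp only [Bool.and_eq_true, decide_eq_true_eq]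
    refine ⟨fun h => ⟨h, ?_⟩, fun h => h.1⟩
    rw [h]
    fin_cases i <;> rfl
  rw [h2, (hG.perm_of_over hc).countP_eq]
  fin_cases i <;> simp

theorem tokEq_zhTok_singleton (k : ℕ → Bool) (x : Letter) : TokEq ([x].flatMap (zhTok k)) (zhTok k x) := by
  intro y n z
  simp

/-- Passing from the pair of arcs behind the over-strand to the one before it adds `s` to both
incoming arcs of `c` and subtracts `s` from both outgoing ones. This is a slide of `ωᵒᵖ` across `c`.
-/
theorem zhSum_change {G : Code} (hG : G.WF) {c : ℕ} {s : ℤˣ} (hc : Letter.over c s ∈ G.flatten)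
    {k k' : ℕ → Bool} (hk : ∀ x ≠ c, k x = k' x) : zhSum k G = zhSum k' G := by
  set T : Template 2 := G.map fun w => w.map (cutLetter c s) with hT
  have hlin : T.Linear := linear_cut hG hc
  have hfill : T.fill ![[.over c s], [.under c s]] = G := fill_cut c s G
  have hp : ([0, 1] : List (Fin 2)).Perm (holes T) := hlin.perm_holes
  have hne : ∀ l ∈ letters T, l.label ≠ c := by
    refine Code.WF.label_ne_of_fill (s := s) (i := 0) (j := 1) hlin (by rw [hfill]; exact hG) ?_ ?_
    · simp
    · simp
  have hov := filterMap_fill_perm hp ![[.over c s], [.under c s]]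
  rw [hfill] at hov
  have key := crossingSum_slide (A := smoothing) (f := curveValue) s
    ((letters T).filterMap Letter.overData) T (i := 0) (j := 1) (by decide) hp
    (by simpa using freshIn_of_label_ne (Cs := []) hne (by simp)) (labelled_zhTok k)
    (labelled_zhTok k') (fun l hl => zhTok_congr (hk _ (hne l hl))) ![[.over c s], [.under c s]]
    ![[.over c s], [.under c s]] (tokEq_zhTok_singleton k (.over c s))
    (tokEq_zhTok_singleton k (.under c s)) (tokEq_zhTok_singleton k' (.over c s))
    (tokEq_zhTok_singleton k' (.under c s)) ?_ ?_ ?_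
  · rw [hfill] at key
    rw [zhSum, zhSum, normalized_perm hov, normalized, normalized]
    simp only [List.flatMap_cons, List.flatMap_nil, Matrix.cons_val_zero, Matrix.cons_val_one,
      List.filterMap_cons, List.filterMap_nil, Letter.overData, List.append_nil,
      List.cons_append, List.nil_append]
    rw [key]
  all_goals
    cases k c <;> cases k' c <;> simp [weightBefore, weightAfter]

theorem zhSum_indep {G : Code} (hG : G.WF) (k k' : ℕ → Bool) : zhSum k G = zhSum k' G := by
  -- The choices are changed at one crossing at a time; `k` and `k'` may differ at infinitely many
  -- names that do not occur.
  have key : ∀ l : List (ℕ × ℤˣ), (∀ x ∈ l, x ∈ overs G) →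
      zhSum k G = zhSum (fun c => if c ∈ l.map Prod.fst then k' c else k c) G := by
    intro l
    induction l with
    | nil => intro _; simp
    | cons x l ih =>
      intro h
      rw [ih fun y hy => h y (List.mem_cons_of_mem _ hy)]
      obtain ⟨c, s⟩ := x
      refine zhSum_change hG (mem_overs.1 (h _ List.mem_cons_self)) fun d hd => ?_
      simp [hd]
  rw [key (overs G) fun x hx => hx]
  have : ∀ l ∈ G.flatten, l.classical = true →
      l.label ∈ (overs G).map Prod.fst := by
    intro l hl hc
    rcases l with ⟨c, s⟩ | ⟨c, s⟩ | c
    · exact List.mem_map.2 ⟨(c, s), mem_overs.2 hl, rfl⟩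
    · exact List.mem_map.2 ⟨(c, s), mem_overs.2 (hG.over_iff_under.2 hl), rfl⟩
    · cases hc
  rw [zhSum, zhSum]
  congr 1
  rw [codeSys, codeSys]
  congr 1
  apply List.map_congr_left
  intro w hw
  apply List.flatMap_congr
  intro l hl
  rcases h : l.classical
  · rcases l with ⟨c, s⟩ | ⟨c, s⟩ | c
    · cases h
    · cases h
    · rfl
  · exact zhTok_congr (if_pos (this l (List.mem_flatten_of_mem hw hl) h))

end Zh

/-! ### Invariance of the Zh-polynomial -/

section ZhMoves

variable {G G' : Code} {c d e : ℕ}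

/-- By the last hypothesis the weights between the two passages cancel; only the outer weights `u`
and `v` survive, and these can be assigned to the frame. -/
theorem tokEq_ord {τ : Letter → List (Tok Pt)} {X Y : Letter} {P Q : Tok Pt} {x₁ x₂ y₁ y₂ : ℤ}
    (hX : τ X = [.wt x₁, P, .wt x₂]) (hY : τ Y = [.wt y₁, Q, .wt y₂]) (p : ℤˣ) {u v : ℤ}
    (hu : cond (decide (p = -1)) y₁ x₁ = u) (hv : cond (decide (p = -1)) x₂ y₂ = v)
    (h : cond (decide (p = -1)) (y₂ + x₁) (x₂ + y₁) = 0) :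
    TokEq ((ord p X Y).flatMap τ)
      (.wt u :: (cond (decide (p = -1)) [Q, P] [P, Q] ++ [.wt v])) := by
  have h0 : ∀ n m : ℤ, n + m = 0 → TokEq [.wt n, .wt m] ([] : List (Tok Pt)) := by
    intro n m h x k y
    simp [add_assoc, h]
  have hw : ord p X Y = cond (decide (p = -1)) [Y, X] [X, Y] := by
    rcases Int.units_eq_one_or p with rfl | rfl <;> rfl
  rw [hw, ← hu, ← hv]
  generalize decide (p = -1) = t at *
  cases t
  · have := ((h0 _ _ h).append [Q, .wt y₂]).prepend [.wt x₁, P]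
    simpa [hX, hY] using this
  · have := ((h0 _ _ h).append [P, .wt x₂]).prepend [.wt y₁, Q]
    simpa [hX, hY] using this

theorem zhTok_over (k : ℕ → Bool) (c : ℕ) (s : ℤˣ) : zhTok k (.over c s) =
    [.wt (weightBefore (k c) true s), passTok c true, .wt (weightAfter (k c) true s)] := rfl

theorem zhTok_under (k : ℕ → Bool) (c : ℕ) (s : ℤˣ) : zhTok k (.under c s) =
    [.wt (weightBefore (k c) false s), passTok c false, .wt (weightAfter (k c) false s)] := rfl

theorem zhSum_r1 {T : Template 1} (hT : T.Linear) {s p : ℤˣ}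
    (hG : Code.WF (T.fill ![ord p (.over c s) (.under c s)])) (k k' : ℕ → Bool) :
    zhSum k (T.fill ![ord p (.over c s) (.under c s)]) = zhSum k' (T.fill ![[]]) := by
  have hne := hG.label_ne_of_fill (i := 0) (j := 0) hT (left_mem_ord p _ _) (right_mem_ord p _ _)
  have hp : ([0] : List (Fin 1)).Perm (holes T) := hT.perm_holes
  -- With this choice both weights at the curl lie between its two passages, where they cancel.
  set k₀ : ℕ → Bool := fun x => if x = c then decide (p = 1) else k' x with hk₀
  have hkc : k₀ c = decide (p = 1) := if_pos rfl
  rw [zhSum_indep hG k k₀, zhSum, zhSum, normalized_perm (filterMap_fill_perm hp _),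
    normalized_perm (filterMap_fill_perm hp ![[]])]
  simp only [List.flatMap_cons, List.flatMap_nil, Matrix.cons_val_zero, filterMap_ord_over_under,
    List.filterMap_nil, List.append_nil, List.nil_append, List.cons_append]
  apply normalized_curl
  refine crossingSum_curl smoothing_mul curveValue_zero s (decide (p = -1)) _ T hp
    (by simpa using freshIn_of_label_ne (Cs := []) hne (by simp)) (labelled_zhTok _)
    (labelled_zhTok _) (fun l hl => zhTok_congr (if_neg (hne l hl))) _ _ (fun _ => 0) (fun _ => 0)
    ?_ ?_
  · intro i
    fin_cases i
    refine tokEq_ord (zhTok_over _ _ _) (zhTok_under _ _ _) p ?_ ?_ ?_ <;>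
      rw [hkc] <;> clear * - <;> revert s p <;> decide
  · intro i
    fin_cases i
    exact TokEq.pad _

theorem zhSum_r2 {T : Template 2} (hT : T.Linear) {s p : ℤˣ}
    (hG : Code.WF (T.fill ![[.over c s, .over d (-s)], ord p (.under c s) (.under d (-s))]))
    (k k' : ℕ → Bool) :
    zhSum k (T.fill ![[.over c s, .over d (-s)], ord p (.under c s) (.under d (-s))]) =
      zhSum k' (T.fill ![[], []]) := by
  set g : Fin 2 → List Letter :=
    ![[.over c s, .over d (-s)], ord p (.under c s) (.under d (-s))] with hg
  have hc := hG.label_ne_of_fill (c := c) (s := s) (i := 0) (j := 1) hT (by simp [hg])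
    (left_mem_ord p _ _)
  have hd := hG.label_ne_of_fill (c := d) (s := -s) (i := 0) (j := 1) hT (by simp [hg])
    (right_mem_ord p _ _)
  have hp : ([0, 1] : List (Fin 2)).Perm (holes T) := hT.perm_holes
  have hov := filterMap_fill_perm hp g
  have e1 : ([0, 1] : List (Fin 2)).flatMap (fun i => (g i).filterMap Letter.overData) =
      [(c, s), (d, -s)] := by
    simp [hg, filterMap_ord_under, Letter.overData]
  rw [e1] at hov
  have hcd : c ≠ d := by
    have h2 := (hov.map Prod.fst).nodup_iff.1 (nodup_overData fun c => hG.countP_isAt_le c true)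
    simp at h2
    tauto
  -- The two choices are opposite, like the signs of the crossings. For `p = -1` all weights lie
  -- inside the bigon and cancel; for `p = 1` the over-strand retains `s` and `-s` outside, which
  -- cancel once the bigon is gone.
  set k₀ : ℕ → Bool := fun x => if x = c then decide (p = -1) else if x = d then decide (p = 1)
    else k' x with hk₀
  have hkc : k₀ c = decide (p = -1) := if_pos rfl
  have hkd : k₀ d = decide (p = 1) := by simp [hk₀, hcd.symm]
  have hagree : ∀ l ∈ letters T, zhTok k₀ l = zhTok k' l := fun l hl =>
    zhTok_congr (by simp [hk₀, hc l hl, hd l hl])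
  rw [zhSum_indep hG k k₀, zhSum, zhSum, normalized_perm hov,
    normalized_perm (filterMap_fill_perm hp ![[], []])]
  have e2 : ([0, 1] : List (Fin 2)).flatMap (fun i => ((![[], []] : Fin 2 → List Letter)
      i).filterMap Letter.overData) = [] := by
    simp
  rw [e2]
  simp only [List.nil_append, List.cons_append]
  have key := crossingSum_bigon smoothing_mul curveValue_zero hcd s (decide (p = -1))
    ((letters T).filterMap Letter.overData) T hp
    (by simpa using freshIn_of_label_ne (Cs := []) hc (by simp))
    (by simpa using freshIn_of_label_ne (Cs := []) hd (by simp)) (labelled_zhTok k₀)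
    (labelled_zhTok k') hagree
    ![cond (decide (p = -1)) 0 s, 0] ![cond (decide (p = -1)) 0 (-s : ℤˣ), 0] g ![[], []] ?_ ?_
  · rw [normalized, normalized, key]
    congr 4
    simp
  · intro i
    fin_cases i
    · have h1 : g 0 = ord 1 (.over c s) (.over d (-s)) := rfl
      change TokEq ((g 0).flatMap _) _
      rw [h1]
      refine tokEq_ord (zhTok_over _ _ _) (zhTok_over _ _ _) 1 ?_ ?_ ?_ <;>
        simp only [hkc, hkd] <;> clear * - <;> revert s p <;> decide
    · refine tokEq_ord (zhTok_under _ _ _) (zhTok_under _ _ _) p ?_ ?_ ?_ <;>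
        simp only [hkc, hkd] <;> clear * - <;> revert s p <;> decide
  · intro i
    fin_cases i
    · intro x n y
      clear * -
      revert s p
      intro s p
      change [(x, y, n)] = [(x, y, n + cond (decide (p = -1)) 0 (s : ℤ) +
        cond (decide (p = -1)) 0 ((-s : ℤˣ) : ℤ))]
      cases decide (p = -1) <;> simp
    · exact TokEq.pad _

theorem zhSum_r3 {T : Template 3} (hT : T.Linear) {a b f p q r : ℤˣ} (h₁ : p * f = q * b)
    (h₂ : q * b = r * a) (hG : Code.WF (T.fill (triangleWords c d e a b f p q r)))
    (hG' : Code.WF (T.fill (triangleWords c d e a b f (-p) (-q) (-r)))) (k k' : ℕ → Bool) :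
    zhSum k (T.fill (triangleWords c d e a b f p q r)) =
      zhSum k' (T.fill (triangleWords c d e a b f (-p) (-q) (-r))) := by
  set g := triangleWords c d e a b f p q r with hg
  set g' := triangleWords c d e a b f (-p) (-q) (-r) with hg'
  have hc := hG.label_ne_of_fill (c := c) (s := a) (i := 0) (j := 1) hT (left_mem_ord _ _ _)
    (left_mem_ord _ _ _)
  have hd := hG.label_ne_of_fill (c := d) (s := b) (i := 0) (j := 2) hT (right_mem_ord _ _ _)
    (left_mem_ord _ _ _)
  have he := hG.label_ne_of_fill (c := e) (s := f) (i := 1) (j := 2) hT (right_mem_ord _ _ _)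
    (right_mem_ord _ _ _)
  have hp : ([0, 1, 2] : List (Fin 3)).Perm (holes T) := hT.perm_holes
  have ho : ∀ p q r, (([0, 1, 2] : List (Fin 3)).flatMap (fun i =>
      (triangleWords c d e a b f p q r i).filterMap Letter.overData)).Perm
        [(c, a), (d, b), (e, f)] := by
    intro p q r
    simp only [triangleWords, List.flatMap_cons, List.flatMap_nil, Matrix.cons_val_zero,
      Matrix.cons_val_one, Matrix.cons_val, filterMap_ord_under, filterMap_ord_under_over,
      List.append_nil]
    exact (filterMap_ord_over p c d a b).append_right [(e, f)]
  have hov := (filterMap_fill_perm hp g).trans ((ho p q r).append_right _)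
  have hov' := (filterMap_fill_perm hp g').trans ((ho (-p) (-q) (-r)).append_right _)
  have hnd := (hov.map Prod.fst).nodup_iff.1 (nodup_overData fun c => hG.countP_isAt_le c true)
  simp only [List.cons_append, List.map_cons, List.nodup_cons, List.mem_cons, not_or] at hnd
  obtain ⟨⟨hcd, hce, -⟩, ⟨hde, -⟩, -⟩ := hnd
  -- The middle crossing `d` gets the choice opposite to `c` and `e`, and the move reverses all
  -- three choices. Then the weights between the crossings cancel on each strand, and the outer
  -- weights are the same before and after the move. All this is a finite check of signs.
  set t : ℤˣ := p * q * r with ht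
  set k₁ : ℕ → Bool := fun x => if x = d then decide (t = 1) else if x = c ∨ x = e then
    decide (t = -1) else false with hk₁
  set k₂ : ℕ → Bool := fun x => if x = d then decide (t = -1) else if x = c ∨ x = e then
    decide (t = 1) else false with hk₂
  have k₁c : k₁ c = decide (t = -1) := by simp [hk₁, hcd]
  have k₁d : k₁ d = decide (t = 1) := by simp [hk₁]
  have k₁e : k₁ e = decide (t = -1) := by simp [hk₁, Ne.symm hde]
  have k₂c : k₂ c = decide (t = 1) := by simp [hk₂, hcd]
  have k₂d : k₂ d = decide (t = -1) := by simp [hk₂]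
  have k₂e : k₂ e = decide (t = 1) := by simp [hk₂, Ne.symm hde]
  have hagree : ∀ l ∈ letters T, zhTok k₁ l = zhTok k₂ l := fun l hl =>
    zhTok_congr (by simp [hk₁, hk₂, hc l hl, hd l hl, he l hl])
  have fresh : ∀ {c}, (∀ l ∈ letters T, l.label ≠ c) →
      FreshIn c ((letters T).filterMap Letter.overData) T := fun hc => by
    simpa using freshIn_of_label_ne (Cs := []) hc (by simp)
  obtain ⟨s₁, s₂⟩ := revSign_triangle p q r a b f h₁ h₂
  rw [zhSum_indep hG k k₁, zhSum_indep hG' k' k₂, zhSum, zhSum, normalized_perm hov,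
    normalized_perm hov']
  have key := crossingSum_triangle smoothing_mul curveValue_zero hcd hce hde s₁ s₂
    ((letters T).filterMap Letter.overData) T hp (fresh hc) (fresh hd) (fresh he)
    (labelled_zhTok k₁) (labelled_zhTok k₂) hagree
    ![cond (decide (p = -1)) (weightBefore (decide (t = 1)) true b)
        (weightBefore (decide (t = -1)) true a),
      cond (decide (q = -1)) (weightBefore (decide (t = -1)) true f)
        (weightBefore (decide (t = -1)) false a),
      cond (decide (r = -1)) (weightBefore (decide (t = -1)) false f)
        (weightBefore (decide (t = 1)) false b)]
    ![cond (decide (p = -1)) (weightAfter (decide (t = -1)) true a)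
        (weightAfter (decide (t = 1)) true b),
      cond (decide (q = -1)) (weightAfter (decide (t = -1)) false a)
        (weightAfter (decide (t = -1)) true f),
      cond (decide (r = -1)) (weightAfter (decide (t = 1)) false b)
        (weightAfter (decide (t = -1)) false f)] g g' ?_ ?_
  · rw [normalized, normalized]
    simp only [List.cons_append, List.nil_append]
    rw [key]
  · intro i
    fin_cases i
    · refine tokEq_ord (zhTok_over _ _ _) (zhTok_over _ _ _) p (by rw [k₁c, k₁d]; rfl)
        (by rw [k₁c, k₁d]; rfl) ?_
      rw [k₁c, k₁d, ht]
      clear * - h₁ h₂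
      revert p q r a b f
      decide
    · refine tokEq_ord (zhTok_under _ _ _) (zhTok_over _ _ _) q (by rw [k₁c, k₁e]; rfl)
        (by rw [k₁c, k₁e]; rfl) ?_
      rw [k₁c, k₁e, ht]
      clear * - h₁ h₂
      revert p q r a b f
      decide
    · refine tokEq_ord (zhTok_under _ _ _) (zhTok_under _ _ _) r (by rw [k₁d, k₁e]; rfl)
        (by rw [k₁d, k₁e]; rfl) ?_
      rw [k₁d, k₁e, ht]
      clear * - h₁ h₂
      revert p q r a b f
      decide
  · intro i
    fin_cases i
    · have := fun u v => tokEq_ord (zhTok_over k₂ c a) (zhTok_over k₂ d b) (-p) (u := u) (v := v)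
      simp only [cond_neg] at this
      refine this _ _ ?_ ?_ ?_ <;> rw [k₂c, k₂d, ht] <;> clear * - h₁ h₂ <;>
        revert p q r a b f <;> decide
    · have := fun u v => tokEq_ord (zhTok_under k₂ c a) (zhTok_over k₂ e f) (-q) (u := u) (v := v)
      simp only [cond_neg] at this
      refine this _ _ ?_ ?_ ?_ <;> rw [k₂c, k₂e, ht] <;> clear * - h₁ h₂ <;>
        revert p q r a b f <;> decide
    · have := fun u v => tokEq_ord (zhTok_under k₂ d b) (zhTok_under k₂ e f) (-r) (u := u) (v := v)
      simp only [cond_neg] at this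
      refine this _ _ ?_ ?_ ?_ <;> rw [k₂d, k₂e, ht] <;> clear * - h₁ h₂ <;>
        revert p q r a b f <;> decide

theorem zhSum_step {D D' : Diagram} (h : D.Step D') (k k' : ℕ → Bool) :
    zhSum k D.code = zhSum k' D'.code := by
  rcases h with h | h | ⟨g, hg, h⟩
  · have hD := D.wf
    have hD' := D'.wf
    generalize D.code = G at h hD
    generalize D'.code = G' at h hD'
    cases h with
    | r1 T hT c s p => exact zhSum_r1 hT hD k k'
    | r2 T hT c d s p => exact zhSum_r2 hT hD k k'
    | r3 T hT c d e a b f p q r h₁ h₂ => exact zhSum_r3 hT h₁ h₂ hD hD' k k'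
  · have h := h.dropVirt_eq D.wf D'.wf
    have hv : ∀ k c, TokEq (zhTok k (.virt c)) [] := fun _ _ => TokEq.refl _
    rw [zhSum_indep D.wf k k', zhSum, zhSum, ← codeSys_dropVirt (hv k') D.code, h,
      codeSys_dropVirt (hv k'), ← overs_dropVirt D.code, h, overs_dropVirt]
  · obtain ⟨h₁, h₂⟩ := crossingSum_sameCode smoothing curveValue hg h
      -- A constant choice is compatible with any renaming of the crossings.
      (τ := zhTok fun _ => true) (τ' := zhTok fun _ => true) (labelled_zhTok _) (by
        intro l _
        cases l <;> rfl)
    rw [zhSum_indep D.wf k fun _ => true, zhSum_indep D'.wf k' fun _ => true, zhSum, zhSum,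
      normalized, normalized, h₁, (h₂.map _).sum_eq, List.map_map]
    rfl

theorem zhSum_equivalent {D D' : Diagram} (h : Relation.EqvGen Diagram.Step D D')
    (k k' : ℕ → Bool) : zhSum k D.code = zhSum k' D'.code := by
  induction h generalizing k k' with
  | rel _ _ h => exact zhSum_step h k k'
  | refl D => exact zhSum_indep D.wf k k'
  | symm _ _ _ ih => exact (ih k' k).symm
  | trans _ _ _ _ _ ih₁ ih₂ => exact (ih₁ k k).trans (ih₂ k k')

end ZhMoves

/-! ### The existence of `Zhᵒᵖ(D)` -/

section Existence

/-- The passages of `D` under `ωᵒᵖ`. -/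
def underPassages (l : Bool → ℕ → ℕ) : Letter → List Letter
  | .over c s => [.under (l true c) s]
  | .under c s => [.under (l false c) (-s)]
  | .virt _ => []

theorem filter_flatMap_of_isAt {f g : Letter → List Letter} {n c : ℕ} {o : Bool} (w : List Letter)
    (h : ∀ x ∈ w, (f x).filter (fun y => y.label = n) = if x.isAt c o then g x else []) :
    (w.flatMap f).filter (fun y => y.label = n) = (w.filter (Letter.isAt c o)).flatMap g := by
  induction w with
  | nil => rfl
  | cons x w ih =>
    rw [List.flatMap_cons, List.filter_append, h x List.mem_cons_self,
      ih fun y hy => h y (List.mem_cons_of_mem _ hy), List.filter_cons]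
    split_ifs <;> simp

theorem filter_flatMap_of_self {f : Letter → List Letter} {n : ℕ} (w : List Letter)
    (h : ∀ x ∈ w, (f x).filter (fun y => y.label = n) = [x].filter fun y => y.label = n) :
    (w.flatMap f).filter (fun y => y.label = n) = w.filter fun y => y.label = n := by
  induction w with
  | nil => rfl
  | cons x w ih =>
    rw [List.flatMap_cons, List.filter_append, h x List.mem_cons_self,
      ih fun y hy => h y (List.mem_cons_of_mem _ hy), ← List.filter_append]
    rfl

/-- Names for the crossings of `D` with `ωᵒᵖ`. -/
def freshLabel (M : ℕ) (o : Bool) (c : ℕ) : ℕ := M + 2 * c + cond o 1 0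

theorem freshLabel_eq_iff {M c c' : ℕ} {o o' : Bool} :
    freshLabel M o' c' = freshLabel M o c ↔ c' = c ∧ o' = o := by
  cases o <;> cases o' <;> simp [freshLabel] <;> omega

theorem le_freshLabel (M : ℕ) (o : Bool) (c : ℕ) : M ≤ freshLabel M o c := by
  cases o <;> (simp [freshLabel]; try omega)

theorem exists_freshLabel {M n : ℕ} (h : M ≤ n) : ∃ o c, n = freshLabel M o c := by
  refine ⟨decide ((n - M) % 2 = 1), (n - M) / 2, ?_⟩
  rcases Nat.mod_two_eq_zero_or_one (n - M) with h' | h' <;> (simp [freshLabel, h']; omega)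

variable {k : ℕ → Bool} {M : ℕ} {x : Letter}

theorem filter_omegaPassages (c : ℕ) (o : Bool) :
    (omegaPassages (freshLabel M) x).filter (fun y => y.label = freshLabel M o c) =
      if x.isAt c o then omegaPassages (freshLabel M) x else [] := by
  rcases x with ⟨c', s⟩ | ⟨c', s⟩ | c' <;> cases o <;>
    simp [omegaPassages, Letter.label, Letter.isAt, freshLabel_eq_iff, List.filter_singleton]

theorem filter_decorate (hx : x.label < M) (c : ℕ) (o : Bool) :
    (decorate k (freshLabel M) x).filter (fun y => y.label = freshLabel M o c) =
      if x.isAt c o then underPassages (freshLabel M) x else [] := by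
  have h : x.label ≠ freshLabel M o c := fun e => by
    have := le_freshLabel M o c
    omega
  rcases x with ⟨c', s⟩ | ⟨c', s⟩ | c' <;> simp only [Letter.label] at h
  · rcases hk : k c' <;> cases o <;>
      simp [decorate, hk, underPassages, Letter.label, Letter.isAt, freshLabel_eq_iff,
        List.filter_cons, h]
  · rcases hk : k c' <;> cases o <;>
      simp [decorate, hk, underPassages, Letter.label, Letter.isAt, freshLabel_eq_iff,
        List.filter_cons, h]
  · simp [decorate, Letter.label, Letter.isAt, h]

theorem filter_decorate_of_lt {n : ℕ} (hn : n < M) :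
    (decorate k (freshLabel M) x).filter (fun y => y.label = n) =
      [x].filter fun y => y.label = n := by
  have h : ∀ o c, freshLabel M o c ≠ n := fun o c e => by
    have := le_freshLabel M o c
    omega
  rcases x with ⟨c', s⟩ | ⟨c', s⟩ | c'
  · rcases hk : k c' <;> simp [decorate, hk, Letter.label, List.filter_cons, h]
  · rcases hk : k c' <;> simp [decorate, hk, Letter.label, List.filter_cons, h]
  · rfl

theorem filter_omegaPassages_of_lt {n : ℕ} (hn : n < M) :
    (omegaPassages (freshLabel M) x).filter (fun y => y.label = n) = [] := by
  have h : ∀ o c, freshLabel M o c ≠ n := fun o c e => by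
    have := le_freshLabel M o c
    omega
  rcases x with ⟨c', s⟩ | ⟨c', s⟩ | c' <;> simp [omegaPassages, Letter.label, h]

theorem flatten_map_flatMap {α β : Type} (G : List (List α)) (f : α → List β) :
    (G.map fun w => w.flatMap f).flatten = G.flatten.flatMap f := by
  simp only [List.flatMap, List.map_flatten, List.flatten_flatten, List.map_map]
  rfl

/-- Names below `M` behave as in `G`. A name from `M` on encodes exactly one kind of passage `(o,
c)`; it is used once on `ωᵒᵖ` and once on the base if `G` contains this passage, and never
otherwise. -/
theorem wf_decorate {G : Code} (hG : G.WF) (hM : ∀ x ∈ G.flatten, x.label < M) :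
    Code.WF (G.flatten.flatMap (omegaPassages (freshLabel M)) ::
      G.map fun w => w.flatMap (decorate k (freshLabel M))) := by
  intro n
  rw [List.flatten_cons, flatten_map_flatMap, List.filter_append]
  rcases lt_or_ge n M with hn | hn
  · rw [filter_flatMap_of_self (f := decorate k (freshLabel M)) _ fun x _ =>
      filter_decorate_of_lt hn, List.filter_flatMap,
      List.flatMap_eq_nil_iff.2 fun x _ => filter_omegaPassages_of_lt hn, List.nil_append]
    exact hG n
  · obtain ⟨o, c, rfl⟩ := exists_freshLabel hn
    rw [filter_flatMap_of_isAt (f := omegaPassages (freshLabel M)) _ fun x _ =>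
      filter_omegaPassages c o, filter_flatMap_of_isAt (f := decorate k (freshLabel M)) _ fun x hx =>
      filter_decorate (hM x hx) c o]
    have h1 := hG.countP_isAt_le c o
    rw [List.countP_eq_length_filter] at h1
    rcases h : G.flatten.filter (Letter.isAt c o) with _ | ⟨x, _ | ⟨y, w⟩⟩
    · exact Or.inl rfl
    · right; left
      have hx : x.isAt c o = true := by
        have : x ∈ G.flatten.filter (Letter.isAt c o) := by simp [h]
        exact (List.mem_filter.1 this).2
      rcases x with ⟨c', s⟩ | ⟨c', s⟩ | c' <;> cases o <;>
        simp only [Letter.isAt, Bool.true_and, Bool.not_true, Bool.false_and,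
          Bool.not_false, decide_eq_true_eq, Bool.false_eq_true] at hx <;> subst hx <;>
        exact ⟨_, List.Perm.refl _⟩
    · rw [h] at h1
      simp at h1

theorem over_mem_decorate {l : Bool → ℕ → ℕ} {c : ℕ} {s : ℤˣ}
    (h : Letter.over c s ∈ decorate k l x) : x = .over c s := by
  rcases x with ⟨c', t⟩ | ⟨c', t⟩ | c'
  · rcases hk : k c' <;> simp [decorate, hk] at h <;> rw [h.1, h.2]
  · rcases hk : k c' <;> simp [decorate, hk] at h
  · simp [decorate] at h

theorem exists_isZhOp (D : Diagram) : ∃ L : OmegaDiagram, IsZhOp D L := by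
  -- The sum of all labels is a crude bound for each of them.
  obtain ⟨M, hM⟩ : ∃ M, ∀ x ∈ D.code.flatten, x.label < M :=
    ⟨(D.code.flatten.map Letter.label).sum + 1, fun x hx =>
      Nat.lt_succ_of_le (List.le_sum_of_mem (List.mem_map_of_mem hx))⟩
  -- Planarity is not recorded, so `ωᵒᵖ` may visit the arcs in the order of the code without any
  -- additional virtual crossings: `N = ∅`.
  refine ⟨⟨_, _, wf_decorate (k := fun _ => true) D.wf hM, by simpa using D.nonempty, ?_⟩,
    fun _ => true, freshLabel M, ∅, by simp, ?_, ?_⟩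
  · intro c s h
    rw [flatten_map_flatMap, List.mem_flatMap] at h ⊢
    obtain ⟨x, hx, h⟩ := h
    rw [over_mem_decorate h] at hx
    exact ⟨_, D.wf.over_iff_under.1 hx, self_mem_decorate _ _ _⟩
  · simp [eraseWord]
  · simp [eraseWord]

end Existence

/-! ### The parity of the virtual linking numbers -/

section Parity

variable {G : Code}

/-- The other passage through the same classical crossing. -/
def Letter.swap : Letter → Letter
  | .over c s => .under c s
  | .under c s => .over c s
  | .virt c => .virt c

theorem filterMap_overData_swap (hG : G.WF) :
    ((G.flatten.map Letter.swap).filterMap Letter.overData).Perm (overs G) := by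
  have h : ∀ (o : Bool) c, ((G.flatten.map Letter.swap).countP (Letter.isAt c o)) =
      G.flatten.countP (Letter.isAt c !o) := by
    intro o c
    rw [List.countP_map]
    congr 1
    funext l
    cases l <;> simp [Letter.swap, Letter.isAt]
  rw [overs, List.perm_ext_iff_of_nodup (List.Nodup.of_map _ (nodup_overData fun c => by
    rw [h]; exact hG.countP_isAt_le c _)) (List.Nodup.of_map _ (nodup_overData fun c =>
    hG.countP_isAt_le c _))]
  rintro ⟨c, s⟩
  rw [← overs, mem_overs, hG.over_iff_under, List.mem_filterMap]
  constructor
  · rintro ⟨l, hl, e⟩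
    obtain ⟨l', hl', rfl⟩ := List.mem_map.1 hl
    rw [Letter.overData_eq] at e
    rcases l' with ⟨c', t⟩ | ⟨c', t⟩ | c' <;> simp [Letter.swap] at e
    rw [← e.1, ← e.2]
    exact hl'
  · intro h
    exact ⟨_, List.mem_map_of_mem h, rfl⟩

/-- Passages are grouped by crossings: exchanging the over- and the under-passage of each crossing
turns the sum over the under-passages into a sum over `overs G`. -/
theorem sum_flatten {M : Type} [AddCommMonoid M] (hG : G.WF) (g : Letter → M)
    (hg : ∀ c, g (.virt c) = 0) : (G.flatten.map g).sum =
      ((overs G).map fun x => g (.over x.1 x.2) + g (.under x.1 x.2)).sum := by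
  rw [List.sum_map_add, 
    ← ((filterMap_overData_swap hG).map fun x => g (.under x.1 x.2)).sum_eq, overs]
  induction G.flatten with
  | nil => simp
  | cons l w ih =>
    rcases l with ⟨c, s⟩ | ⟨c, s⟩ | c
    · simp only [List.map_cons, List.sum_cons, Letter.swap, List.filterMap_cons, Letter.overData, ih,
        add_assoc]
    · simp only [List.map_cons, List.sum_cons, Letter.swap, List.filterMap_cons, Letter.overData, ih,
        add_left_comm]
    · simp only [List.map_cons, List.sum_cons, Letter.swap, List.filterMap_cons, Letter.overData, ih,
        hg, zero_add]

variable (k : ℕ → Bool) (χ : Pt → ℤ)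

/-- The change of `χ` at a passage. -/
def jump : Letter → ℤ
  | .over c _ => χ (.cr c true false) - χ (.cr c true true)
  | .under c _ => χ (.cr c false false) - χ (.cr c false true)
  | .virt _ => 0

/-- The contribution of a passage to the parity of the virtual linking number. -/
def parityAt : Letter → ZMod 2
  | .over c _ => χ (.cr c true (k c))
  | .under c _ => χ (.cr c false (!k c))
  | .virt _ => 0

theorem unit_cast_two (s : ℤˣ) : ((s : ℤ) : ZMod 2) = 1 := by
  rcases Int.units_eq_one_or s with rfl | rfl <;> decide

open Classical in
theorem total_cons_cast {x y : Pt} {n : ℤ} {B : List (Bond Pt)} {ε : Pt → ℤˣ} {C : Set Pt} :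
    (total ((x, y, n) :: B) ε C : ZMod 2) =
      ((if x ∈ C then 1 else 0 : ℤ) : ZMod 2) * n + total B ε C := by
  rw [total_cons]
  split_ifs <;> simp [unit_cast_two]

-- The indicator `χ` is constant along arcs and changes only at passages, so the jumps telescope.
-- Modulo 2 every passage contributes one weight equal to 1, which counts if the arc carrying it
-- lies in `C`.
open Classical in
theorem arcs_parity (ε : Pt → ℤˣ) {C : Set Pt} (hχ : ∀ p, χ p = if p ∈ C then 1 else 0)
    (w : List Letter) (x y : Pt) (n : ℤ)
    (h : ∀ b ∈ arcs x n (w.flatMap (zhTok k)) y, χ b.1 = χ b.2.1) :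
    (w.map (jump χ)).sum = χ x - χ y ∧
      (total (arcs x n (w.flatMap (zhTok k)) y) ε C : ZMod 2) =
        χ x * n + (w.map (parityAt k χ)).sum := by
  induction w generalizing x n with
  | nil =>
    have h1 := h (x, y, n) (by simp)
    simp only [List.flatMap_nil, arcs_nil, total_cons_cast, List.map_nil, List.sum_nil, ← hχ]
    refine ⟨by rw [h1, sub_self], ?_⟩
    simp [total]
  | cons l w ih =>
    have key : ∀ c o s, (∀ b ∈ (x, Pt.cr c o false, n + weightBefore (k c) o s) ::
          arcs (.cr c o true) (weightAfter (k c) o s) (w.flatMap (zhTok k)) y, χ b.1 = χ b.2.1) →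
        χ (.cr c o false) - χ (.cr c o true) + (w.map (jump χ)).sum = χ x - χ y ∧
        (total ((x, Pt.cr c o false, n + weightBefore (k c) o s) ::
          arcs (.cr c o true) (weightAfter (k c) o s) (w.flatMap (zhTok k)) y) ε C : ZMod 2) =
          χ x * n + (χ (.cr c o (o == k c)) + (w.map (parityAt k χ)).sum) := by
      intro c o s hb
      obtain ⟨h1, h2⟩ := ih _ _ fun b hb' => hb b (List.mem_cons_of_mem _ hb')
      have h3 : χ x = χ (.cr c o false) := hb _ List.mem_cons_self
      refine ⟨by rw [h1, h3]; ring, ?_⟩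
      rw [total_cons_cast, ← hχ, h2, h3]
      rcases k c <;> cases o <;>
        simp [weightBefore, weightAfter, unit_cast_two, mul_add, add_assoc]
    rcases l with ⟨c, s⟩ | ⟨c, s⟩ | c
    · have e : arcs x n ((Letter.over c s :: w).flatMap (zhTok k)) y =
          (x, Pt.cr c true false, n + weightBefore (k c) true s) ::
          arcs (.cr c true true) (weightAfter (k c) true s) (w.flatMap (zhTok k)) y := by
        simp [zhTok, passTok]
      rw [e] at h ⊢
      simpa [jump, parityAt] using key c true s h
    · have e : arcs x n ((Letter.under c s :: w).flatMap (zhTok k)) y =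
          (x, Pt.cr c false false, n + weightBefore (k c) false s) ::
          arcs (.cr c false true) (weightAfter (k c) false s) (w.flatMap (zhTok k)) y := by
        simp [zhTok, passTok]
      rw [e] at h ⊢
      simpa [jump, parityAt] using key c false s h
    · simpa [zhTok, jump, parityAt] using ih x n h

-- The closing bonds make `χ` equal at both ends of each strand, so the telescoping sums vanish.
open Classical in
theorem codeSys_parity (ε : Pt → ℤˣ) {C : Set Pt} (hχ : ∀ p, χ p = if p ∈ C then 1 else 0)
    (h : ∀ b ∈ codeSys (zhTok k) G, χ b.1 = χ b.2.1) :
    (G.flatten.map (jump χ)).sum = 0 ∧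
      (total (codeSys (zhTok k) G) ε C : ZMod 2) = (G.flatten.map (parityAt k χ)).sum := by
  unfold codeSys at h ⊢
  generalize 0 = m at h ⊢
  induction G generalizing m with
  | nil => simp [total]
  | cons w G ih =>
    rw [List.map_cons, sys_cons, loopAt] at h ⊢
    obtain ⟨h1, h2⟩ := ih _ fun b hb => h b (List.mem_append_right _ hb)
    obtain ⟨h3, h4⟩ := arcs_parity k χ ε hχ w _ _ _ fun b hb =>
      h b (List.mem_append_left _ (List.mem_append_left _ hb))
    have h5 : χ (.base m false) = χ (.base m true) :=
      h (.base m false, .base m true, 0) (by simp)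
    have h6 : total [(Pt.base m false, Pt.base m true, (0 : ℤ))] ε C = 0 := by simp [total]
    rw [List.flatten_cons, List.map_append, List.map_append, List.sum_append, List.sum_append,
      total_append, total_append, h6, h1, h3, h5, add_zero, add_zero, sub_self]
    refine ⟨rfl, ?_⟩
    push_cast
    rw [h2, h4]
    simp

-- At an oriented smoothing the two weights lie on joined arcs, so they contribute an even number,
-- and the jumps cancel. At the other smoothings the two passages jump by the same amount `t`, and
-- the weights contribute `t` modulo 2. All jumps together give `2 ∑ t = 0`, so the weights
-- contribute an even number.
open Classical in
theorem even_total {S : Finset ℕ} (hG : G.WF) (ε : Pt → ℤˣ) {C : Set Pt}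
    (h : ∀ b ∈ stateJoins S (overs G) ++ codeSys (zhTok k) G, b.1 ∈ C ↔ b.2.1 ∈ C) :
    Even (total (codeSys (zhTok k) G) ε C) := by
  set χ : Pt → ℤ := fun p => if p ∈ C then 1 else 0 with hχ
  have hb : ∀ b ∈ stateJoins S (overs G) ++ codeSys (zhTok k) G, χ b.1 = χ b.2.1 := fun b hb =>
    if_congr (h b hb) rfl rfl
  obtain ⟨h1, h2⟩ := codeSys_parity k χ ε (fun _ => rfl) fun b h' =>
    hb b (List.mem_append_right _ h')
  let t : ℕ × ℤˣ → ℤ := fun x => if x.1 ∈ S ↔ x.2 = 1 then 0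
    else χ (.cr x.1 true false) - χ (.cr x.1 true true)
  have key : ∀ x ∈ overs G, jump χ (.over x.1 x.2) + jump χ (.under x.1 x.2) = 2 * t x ∧
      parityAt k χ (.over x.1 x.2) + parityAt k χ (.under x.1 x.2) = (t x : ZMod 2) := by
    rintro ⟨c, s⟩ hx
    have hj : ∀ b ∈ joinsAt S (c, s), χ b.1 = χ b.2.1 := fun b h' =>
      hb b (List.mem_append_left _ (List.mem_flatMap.2 ⟨_, hx, h'⟩))
    simp only [joinsAt] at hj
    simp only [t, jump, parityAt]
    have h2 : (2 : ZMod 2) = 0 := rfl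
    split_ifs at hj ⊢ with hS <;> simp only [List.forall_mem_cons] at hj
    · rw [hj.1, hj.2.1]
      refine ⟨by ring, ?_⟩
      rcases k c <;> simp [hj.1, hj.2.1] <;> rw [← two_mul, h2, zero_mul]
    · rw [← hj.1, ← hj.2.1]
      refine ⟨by ring, ?_⟩
      rcases k c <;> simp [← hj.1, ← hj.2.1, CharTwo.sub_eq_add, add_comm]
  -- The jumps have to be summed in the integers: modulo 2 the equation `2 ∑ t = 0` would be empty.
  have h3 : ((overs G).map t).sum = 0 := by
    rw [sum_flatten hG _ fun _ => rfl, List.map_congr_left fun x hx => (key x hx).1,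
      List.sum_map_mul_left] at h1
    omega
  have h4 : (total (codeSys (zhTok k) G) ε C : ZMod 2) = (((overs G).map t).sum : ℤ) := by
    rw [h2, sum_flatten hG _ fun _ => rfl, List.map_congr_left fun x hx => (key x hx).2,
      Int.cast_list_sum, List.map_map]
    rfl
  rw [h3, Int.cast_zero] at h4
  exact even_iff_two_dvd.2 ((ZMod.intCast_zmod_eq_zero_iff_dvd _ 2).1 h4)

open OmegaDiagram in
theorem IsZhOp.even_vlk {D : Diagram} {L : OmegaDiagram} (h : IsZhOp D L) (S : Finset ℕ)
    {ε : L.Edge → ℤˣ} (hε : L.IsOrientation S ε) (C : L.Curve S) : Even (L.vlk S ε C) := by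
  obtain ⟨k, ho, hs⟩ := h.system
  obtain ⟨ε', hε'⟩ := L.exists_bip_stateSystem S
  obtain ⟨e, rfl⟩ : ∃ e, L.curveOf S e = C := Quot.mk_surjective C
  rw [← Int.natAbs_even, vlk_natAbs_eq hε (isOrientation_of_bip hε'), Int.natAbs_even]
  have key := total_stateSystem (S := S) ε' e
  rw [stateSystem, total_append, total_stateJoins, zero_add] at key
  rw [← key, ho, hs]
  refine even_total k (S := S) D.wf ε' ?_
  rintro ⟨x, y, n⟩ hb
  rw [mem_comp, mem_comp]
  exact ⟨fun h => h.trans (Reach.of_mem hb), fun h => h.trans (Reach.of_mem hb).symm⟩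

end Parity

/-! ### The Zh-polynomial of virtual links -/

open OmegaDiagram

theorem IsZhOp.polynomial_eq {D D' : Diagram} (h : virtualEquivalence D D') {L L' : OmegaDiagram}
    (hL : IsZhOp D L) (hL' : IsZhOp D' L') (o : L.Orientations) (o' : L'.Orientations) :
    L.polynomial o = L'.polynomial o' := by
  obtain ⟨k, h₁, h₂⟩ := hL.system
  obtain ⟨k', h₁', h₂'⟩ := hL'.system
  refine polynomial_eq_of_normalized o o' ?_
  rw [h₁, h₂, h₁', h₂']
  exact zhSum_equivalent h k k'

/-- Uniqueness uses that every diagram has some `Zhᵒᵖ(D)` and orientable state curves; otherwise the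
condition on `V` could be vacuous at some links. -/
theorem existsUnique_zhPolynomial : ∃! V : VirtualLink → ZhRing,
    ∀ (D : Diagram) (L : OmegaDiagram) (o : L.Orientations), IsZhOp D L →
      V (Quotient.mk virtualEquivalence D) = L.polynomial o := by
  choose L hL using exists_isZhOp
  have o : ∀ D, (L D).Orientations := fun D => (L D).nonempty_orientations.some
  refine ⟨Quotient.lift (fun D => (L D).polynomial (o D)) fun D D' h =>
    (hL D).polynomial_eq h (hL D') _ _, fun D L' o' h =>
    (hL D).polynomial_eq (Relation.EqvGen.refl D) h _ _, fun V hV => ?_⟩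
  funext x
  induction x using Quotient.ind with
  | _ D => exact hV D (L D) (o D) (hL D)

end Virt

theorem mainTheorem5 :
    -- every diagram has a diagram `Zhᵒᵖ(D)`, and all state curves can be oriented
    (∀ D : Virt.Diagram, ∃ L : Virt.OmegaDiagram, Virt.IsZhOp D L) ∧
    (∀ L : Virt.OmegaDiagram, Nonempty L.Orientations) ∧
    -- the subscripts `|vℓk(ωᵒᵖ, C)| / 2` are integers
    (∀ (D : Virt.Diagram) (L : Virt.OmegaDiagram), Virt.IsZhOp D L →
      ∀ (S : Finset ℕ) (ε : L.Edge → ℤˣ), L.IsOrientation S ε →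
        ∀ C : L.Curve S, Even (L.vlk S ε C)) ∧
    -- independence of the orientations of the state curves
    (∀ (L : Virt.OmegaDiagram) (S : Finset ℕ) (ε ε' : L.Edge → ℤˣ),
      L.IsOrientation S ε → L.IsOrientation S ε' →
        ∀ C : L.Curve S, |L.vlk S ε C| = |L.vlk S ε' C|) ∧
    (∀ (L : Virt.OmegaDiagram) (o o' : L.Orientations),
      L.bracket o = L.bracket o' ∧ L.polynomial o = L.polynomial o') ∧
    -- invariance under semi-welded moves
    (∀ (L L' : Virt.OmegaDiagram) (o : L.Orientations) (o' : L'.Orientations),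
      Virt.OmegaDiagram.OCC L L' → L.bracket o = L'.bracket o') ∧
    (∀ (L L' : Virt.OmegaDiagram) (o : L.Orientations) (o' : L'.Orientations),
      Virt.OmegaDiagram.SemiWelded L L' → L.polynomial o = L'.polynomial o') ∧
    -- a well-defined invariant of virtual links: it depends neither on the choices made
    -- in `Zhᵒᵖ(D)` nor on the diagram `D`
    (∃! V : Virt.VirtualLink → Virt.ZhRing,
      ∀ (D : Virt.Diagram) (L : Virt.OmegaDiagram) (o : L.Orientations), Virt.IsZhOp D L →
        V (Quotient.mk Virt.virtualEquivalence D) = L.polynomial o) := by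
  refine ⟨Virt.exists_isZhOp, fun L => L.nonempty_orientations,
    fun _ _ h S _ hε C => h.even_vlk S hε C, fun L S ε ε' h h' C => ?_, fun L o o' =>
    ⟨Virt.OmegaDiagram.bracket_eq o o', Virt.OmegaDiagram.polynomial_eq o o'⟩,
    fun L L' o o' h => ?_, fun L L' o o' h =>
    Virt.OmegaDiagram.polynomial_eq_of_normalized o o' (Virt.normalized_semiWelded h),
    Virt.existsUnique_zhPolynomial⟩
  · rw [Int.abs_eq_natAbs, Int.abs_eq_natAbs, Virt.OmegaDiagram.vlk_natAbs_eq h h']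
  · obtain ⟨h₁, h₂⟩ := h.crossingSum_eq
    exact Virt.OmegaDiagram.bracket_eq_of_crossingSum o o'
      (by rw [Virt.crossingSum_perm _ _ h₁, h₂])
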